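/- **Setting.** Let $G=(V,E)$ be a simple graph with $V=\{1,\dots,N\}$ and all degrees at most $\mathfrak d$. On the fermionic Fock space of the $2N$ modes $(i,\sigma)$, $i\in V$, $\sigma\in\{\uparrow,\downarrow\}$, let $$H=-\sum_{(i,j):\,i\sim j}\ \sum_{\sigma} h_{ij}\,c_{i\sigma}^\dagger c_{j\sigma}+\sum_{i}\xi_i\,n_{i\uparrow}n_{i\downarrow}$$ (sum over ordered pairs of neighbours), with real $h_{ij}=h_{ji}$, $|h_{ij}|\le 1$, $|\xi_i|\le 1$. Let $0<\varepsilon\le 1$, $0<\eta<1$, and put $$\chi=4\mathfrak d^2+1,\qquad J=\max\{0,\lceil\log_2\tfrac{\pi}{3\varepsilon}\rceil\},\qquad n=\lceil 9(\log\tfrac4\eta+\log(J+1))\rceil,\qquad \delta=\tfrac{\sqrt3}{2}-\tfrac23 .$$ **Algorithm.** Colour $E$ with $\chi$ colours such that two different edges get different colours if they share a vertex or if some edge shares a vertex with both. Let $E_c$ be the edges of colour $c$, name the vertices of each edge $k_1^C,k_2^C$, and put $V_{c_m}=\{k_m^C:C\in E_c\}$, $V_c=V_{c_1}\cup V_{c_2}$.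 For each colour $c$ there are three families of experiments: * hopping: subsystems $C\in E_c$, with local states $\phi=|\!\uparrow\rangle_{k_1^C}$ and $\tilde\phi=\frac{1+i}{2}|\!\uparrow\rangle_{k_1^C}+\frac{1-i}{2}|\!\uparrow\rangle_{k_2^C}$, randomised sites $R=V\setminus V_c$, and times $t_j=2^j/2$; * on-site, for $m=1,2$: subsystems $\{k\}$ with $k\in V_{c_m}$, with local states $\psi=\frac{1}{\sqrt2}(|-\rangle+|\!\uparrow\downarrow\rangle_k)$ and $\tilde\psi=\frac{1}{\sqrt2}(|-\rangle+i|\!\uparrow\downarrow\rangle_k)$, randomised sites $R=V\setminus V_{c_m}$, and times $t_j=2^j$. For each family and each $j=0,\dots,J$, perform $n$ independent experiments with the wedge product of the local states $\phi$ (resp. $\psi$) as initial state, and $n$ with that of the states $\tilde\phi$ (resp. $\tilde\psi$). In each experiment, apply $\prod_{l=r_j,\dots,1}U_l^\dagger e^{-i(t_j/r_j)H}U_l$ to the initial state, where $U_l=\prod_{i\in R}e^{-i\theta_{l,i}(n_{i\uparrow}+n_{i\downarrow})}$ with independent $\theta_{l,i}$ uniform on $[0,2\pi]$, and then measure jointly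 the commuting projectors $|\phi\rangle\langle\phi|$ (resp. $|\psi\rangle\langle\psi|$) of all subsystems of the family. For each subsystem let $X_j$ and $Y_j$ be the averages, over the $n$ experiments with untilded and with tilded initial state, of $2\cdot\text{outcome}-1$, and put $Z_j=X_j+iY_j$. Starting from $\theta_{-1}=0$, let $\theta_j$ be the number nearest to $\theta_{j-1}$ among $(\arg Z_j+2\pi k)/2^j$, $k\in\mathbb Z$. Output $\theta_J$ as the estimate $\hat h_{k_1^Ck_2^C}$, resp. $\hat\xi_k$, that belongs to the subsystem. Call the step numbers $r_0,\dots,r_J\ge1$ *admissible* if for every family, every $j\le J$ and every subsystem, with projector $O$ and restricted Hamiltonian $H_{\rm loc}$ (the restriction of $H$ to the edge $C$, resp. $\xi_k n_{k\uparrow}n_{k\downarrow}$), and with $\tau=t_j/r_j$ and $r=r_j$, $$\Big\|\mathbb E\Big[\prod_{l=1,\dots,r}\big(U_l^\dagger e^{i\tau H}U_l\big)\;O\prod_{l=r,\dots,1}\big(U_l^\dagger e^{-i\tau H}U_l\big)\Big]-e^{it_jH_{\rm loc}}\,O\,e^{-it_jH_{\rm loc}}\Big\|\le\frac{\delta}{4}.$$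 **Theorem.** For every $\mathfrak d$ there are constants $K,B>0$, depending only on $\mathfrak d$ (in particular not on $N$), such that for all $G,H,\varepsilon,\eta$ as above: 1. Colourings as required by the algorithm exist. The following statements hold for each of them and each naming of the vertices. 2. The step numbers $r_j=\lceil K4^j\rceil$ are admissible. 3. For all admissible step numbers, the outcomes of the algorithm have a well-defined joint probability distribution, under which $$\mathrm{Prob}(|\hat h_{ij}-h_{ij}|<\varepsilon)>1-\eta\qquad\text{and}\qquad \mathrm{Prob}(|\hat\xi_i-\xi_i|<\varepsilon)>1-\eta$$ for every edge $\{i,j\}$ and for every site $i$ that has a neighbour (and for each of the estimates of $\xi_i$, one for every edge at $i$, that the algorithm produces). 4. Put $L=1+\log\eta^{-1}+\log(1+\log\varepsilon^{-1})$. With $r_j=\lceil K4^j\rceil$, the algorithm uses total evolution time at most $B\,\varepsilon^{-1}L$, at most $B\,(1+\log\varepsilon^{-1})\,L$ experiments, and at most $B\,N\varepsilon^{-2}L$ insertions of single-site random unitaries (where each $U_l$ and each $U_l^\dagger$ counts $|R|$ insertions). That is, the cost is $\tilde{\mathcal O}(\varepsilon^{-1}\log\eta^{-1})$, $\tilde{\mathcal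 O}(\log\varepsilon^{-1}\log\eta^{-1})$ and $\tilde{\mathcal O}(N\varepsilon^{-2}\log\eta^{-1})$, respectively. -/

import Mathlib

open scoped Matrix

/-! ### Fermionic Fock space in the occupation-number basis -/

/-- The single-particle modes of `N` sites with spin, ordered by site and then by spin
(up before down). -/
abbrev Mode (N : ℕ) : Type := Fin N ×ₗ Bool

/-- The mode `|↑⟩_i`. -/
def up {N : ℕ} (i : Fin N) : Mode N := toLex (i, false)

/-- The mode `|↓⟩_i`. -/
def dn {N : ℕ} (i : Fin N) : Mode N := toLex (i, true)

/-- Vectors of the Fock space. The basis vector of `S` is the wedge product of the modes in `S`,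
in increasing order. -/
abbrev FockVec (N : ℕ) : Type := Finset (Mode N) → ℂ

/-- Operators on the Fock space. -/
abbrev Op (N : ℕ) : Type := Matrix (Finset (Mode N)) (Finset (Mode N)) ℂ

/-- The operator norm with respect to the Hilbert space norm. -/
noncomputable def opNorm {N : ℕ} (A : Op N) : ℝ :=
  ‖Matrix.toEuclideanCLM (n := Finset (Mode N)) (𝕜 := ℂ) A‖

/-- The vacuum vector `|-⟩`. -/
def vacuum (N : ℕ) : FockVec N := Pi.single ∅ 1

/-- The creation operator `α ↦ |m⟩ ∧ α`. -/
def create {N : ℕ} (m : Mode N) : Op N :=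
  Matrix.of fun T S =>
    if m ∉ S ∧ T = insert m S then (-1 : ℂ) ^ (S.filter (fun m' => m' < m)).card else 0

/-- The annihilation operator. -/
def annihilate {N : ℕ} (m : Mode N) : Op N := (create m)ᴴ

/-- The number operator of a mode. -/
def number {N : ℕ} (m : Mode N) : Op N := create m * annihilate m

/-- The product of a finite family of operators, in some order. It is used where the factors
commute, and for wedge products, where another order changes the vector by a sign only. -/
noncomputable def opProd {N : ℕ} {ι : Type*} (s : Finset ι) (f : ι → Op N) : Op N :=
  (s.toList.map f).prod

/-! ### The Fermi-Hubbard Hamiltonian -/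

/-- The hopping term `∑_σ c†_{iσ} c_{jσ}`. -/
def hopping {N : ℕ} (i j : Fin N) : Op N :=
  create (up i) * annihilate (up j) + create (dn i) * annihilate (dn j)

/-- The on-site interaction `n_{i↑} n_{i↓}`. -/
def onsite {N : ℕ} (i : Fin N) : Op N := number (up i) * number (dn i)

open Classical in
/-- The Fermi-Hubbard Hamiltonian on the graph `G`; the hopping sum runs over ordered pairs of
neighbours. -/
noncomputable def hubbard {N : ℕ} (G : SimpleGraph (Fin N)) (h : Fin N → Fin N → ℝ)
    (ξ : Fin N → ℝ) : Op N :=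
  -(∑ i, ∑ j, if G.Adj i j then (h i j : ℂ) • hopping i j else 0)
    + ∑ i, (ξ i : ℂ) • onsite i

/-! ### Time evolution with random single-site phase unitaries -/

/-- The uniform distribution on `[0, 2π]`. -/
noncomputable def uniformPhase : MeasureTheory.Measure ℝ :=
  ProbabilityTheory.cond MeasureTheory.volume (Set.Icc 0 (2 * Real.pi))

/-- The law of `r` independent families of independent uniform phases. -/
noncomputable def phaseLaw (N r : ℕ) : MeasureTheory.Measure (Fin r → Fin N → ℝ) :=
  MeasureTheory.Measure.pi fun _ => MeasureTheory.Measure.pi fun _ => uniformPhase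

/-- The single-site unitary `exp(-iθ(n_{i↑} + n_{i↓}))`. -/
noncomputable def siteUnitary {N : ℕ} (i : Fin N) (θ : ℝ) : Op N :=
  NormedSpace.exp ((-(Complex.I * θ)) • (number (up i) + number (dn i)))

/-- The unitary `∏_{i ∈ R} exp(-iθ_i(n_{i↑} + n_{i↓}))`. -/
noncomputable def phaseUnitary {N : ℕ} (R : Finset (Fin N)) (θ : Fin N → ℝ) : Op N :=
  opProd R fun i => siteUnitary i (θ i)

/-- The propagator `(U_r† e^{-iτH} U_r) ⋯ (U_1† e^{-iτH} U_1)` with `τ = t / r`. -/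
noncomputable def reshapedPropagator {N r : ℕ} (H : Op N) (R : Finset (Fin N)) (t : ℝ)
    (θ : Fin r → Fin N → ℝ) : Op N :=
  ((List.ofFn fun l : Fin r =>
    (phaseUnitary R (θ l))ᴴ * NormedSpace.exp ((-(Complex.I * (t / r : ℝ))) • H)
      * phaseUnitary R (θ l)).reverse).prod

/-- The expected Heisenberg evolution of `O` under the randomised propagator. -/
noncomputable def reshapedHeisenberg {N : ℕ} (H : Op N) (R : Finset (Fin N)) (t : ℝ) (r : ℕ)
    (O : Op N) : Op N :=
  Matrix.of fun S T => ∫ θ : Fin r → Fin N → ℝ,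
    ((reshapedPropagator H R t θ)ᴴ * O * reshapedPropagator H R t θ) S T ∂(phaseLaw N r)

/-- The Heisenberg evolution of `O` under `H` for time `t`. -/
noncomputable def heisenberg {N : ℕ} (H : Op N) (t : ℝ) (O : Op N) : Op N :=
  NormedSpace.exp ((Complex.I * t) • H) * O * NormedSpace.exp ((-(Complex.I * t)) • H)

/-! ### Edge colouring -/

/-- Two edges share a vertex. -/
def ShareVertex {N : ℕ} {G : SimpleGraph (Fin N)} (C C' : G.edgeSet) : Prop :=
  ∃ v : Fin N, v ∈ (C : Sym2 (Fin N)) ∧ v ∈ (C' : Sym2 (Fin N))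

/-- The graph on the edges of `G` in which two different edges are adjacent if they share a
vertex or if some edge shares a vertex with both. -/
def edgeConflictGraph {N : ℕ} (G : SimpleGraph (Fin N)) : SimpleGraph G.edgeSet :=
  SimpleGraph.fromRel fun C C' =>
    ShareVertex C C' ∨ ∃ C'' : G.edgeSet, ShareVertex C C'' ∧ ShareVertex C' C''

/-- The combinatorial input of the learning algorithm: a colouring of the edges with `χ` colours
and a naming `k₁ C`, `k₂ C` of the two vertices of each edge `C`. -/
structure ColouredEdges {N : ℕ} (G : SimpleGraph (Fin N)) (χ : ℕ) where
  colour : (edgeConflictGraph G).Coloring (Fin χ)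
  k₁ : G.edgeSet → Fin N
  k₂ : G.edgeSet → Fin N
  ends : ∀ C : G.edgeSet, (C : Sym2 (Fin N)) = s(k₁ C, k₂ C)

/-- The edges of colour `c`. -/
abbrev ColourClass {N χ : ℕ} {G : SimpleGraph (Fin N)} (A : ColouredEdges G χ) (c : Fin χ) :
    Type := {C : G.edgeSet // A.colour C = c}

noncomputable instance {N χ : ℕ} {G : SimpleGraph (Fin N)} (A : ColouredEdges G χ) (c : Fin χ) :
    Fintype (ColourClass A c) := Fintype.ofFinite _

/-! ### The experiments -/

/-- For each colour there are three families of experiments: `hop` for the hopping coefficients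
of the edges, and `site₁`, `site₂` for the on-site coefficients of their first and second
vertices. -/
inductive Pass : Type
  | hop
  | site₁
  | site₂
  deriving DecidableEq

instance : Fintype Pass :=
  ⟨{Pass.hop, Pass.site₁, Pass.site₂}, by intro p; cases p <;> simp⟩

/-- Each family has experiments whose signal is a cosine, and experiments whose signal is a
sine. -/
inductive Quadrature : Type
  | cosine
  | sine
  deriving DecidableEq

instance : Fintype Quadrature :=
  ⟨{Quadrature.cosine, Quadrature.sine}, by intro q; cases q <;> simp⟩

section Experiments

variable {N χ : ℕ} {G : SimpleGraph (Fin N)} (A : ColouredEdges G χ)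

open Classical in
/-- The sites on which random phase unitaries act: `V ∖ V_c`, `V ∖ V_{c₁}` or `V ∖ V_{c₂}`. -/
noncomputable def randomSites (c : Fin χ) : Pass → Finset (Fin N)
  | .hop => Finset.univ.filter fun i => ∀ C : ColourClass A c, i ≠ A.k₁ C.1 ∧ i ≠ A.k₂ C.1
  | .site₁ => Finset.univ.filter fun i => ∀ C : ColourClass A c, i ≠ A.k₁ C.1
  | .site₂ => Finset.univ.filter fun i => ∀ C : ColourClass A c, i ≠ A.k₂ C.1

/-- The operator that creates `(|-⟩ + z |↑↓⟩_i) / √2` from the vacuum. -/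
noncomputable def createPair (i : Fin N) (z : ℂ) : Op N :=
  (1 / (Real.sqrt 2 : ℂ)) • (1 + z • (create (up i) * create (dn i)))

/-- The operator that creates the initial state of the edge `C`, or of one of its vertices,
from the vacuum. -/
noncomputable def localCreate (C : G.edgeSet) : Pass → Quadrature → Op N
  | .hop, .cosine => create (up (A.k₁ C))
  | .hop, .sine =>
      ((1 + Complex.I) / 2) • create (up (A.k₁ C)) + ((1 - Complex.I) / 2) • create (up (A.k₂ C))
  | .site₁, .cosine => createPair (A.k₁ C) 1
  | .site₁, .sine => createPair (A.k₁ C) Complex.I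
  | .site₂, .cosine => createPair (A.k₂ C) 1
  | .site₂, .sine => createPair (A.k₂ C) Complex.I

/-- The projector onto the states in which site `i` is empty. -/
def emptySite (i : Fin N) : Op N := (1 - number (up i)) * (1 - number (dn i))

/-- The projector onto the states in which the measured subsystem (the edge `C`, or one of its
vertices) is empty. -/
def localVacuum (C : G.edgeSet) : Pass → Op N
  | .hop => emptySite (A.k₁ C) * emptySite (A.k₂ C)
  | .site₁ => emptySite (A.k₁ C)
  | .site₂ => emptySite (A.k₂ C)

/-- The observable `|φ⟩⟨φ|` of the measured subsystem, where `φ` is its state of type `cosine`. -/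
noncomputable def localObservable (p : Pass) (C : G.edgeSet) : Op N :=
  localCreate A C p .cosine * localVacuum A C p * (localCreate A C p .cosine)ᴴ

/-- The initial state: the wedge product of the local states over all edges of colour `c`. -/
noncomputable def initialState (c : Fin χ) (p : Pass) (q : Quadrature) : FockVec N :=
  opProd (Finset.univ : Finset (ColourClass A c)) (fun C => localCreate A C.1 p q) *ᵥ vacuum N

/-- The evolution time at level `j`. An edge oscillates at frequency `2 h`, so that half of the
time is needed in the hopping experiments. -/
noncomputable def evolutionTime (j : ℕ) : Pass → ℝ
  | .hop => 2 ^ j / 2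
  | .site₁ => 2 ^ j
  | .site₂ => 2 ^ j

/-- The outcomes of one experiment: a yes/no result for every edge of the colour. -/
abbrev Outcome (c : Fin χ) : Type := ColourClass A c → Bool

/-- The projector of an outcome in the joint measurement of all local observables. -/
noncomputable def outcomeProjector (c : Fin χ) (p : Pass) (o : Outcome A c) : Op N :=
  opProd (Finset.univ : Finset (ColourClass A c)) fun C =>
    if o C then localObservable A p C.1 else 1 - localObservable A p C.1

/-- The probability of an outcome: the Born rule, averaged over the random phases. -/
noncomputable def bornWeight (H : Op N) (c : Fin χ) (p : Pass) (q : Quadrature) (t : ℝ) (r : ℕ)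
    (o : Outcome A c) : ℝ :=
  ∫ θ : Fin r → Fin N → ℝ,
    ∑ S, ‖(outcomeProjector A c p o *ᵥ
      (reshapedPropagator H (randomSites A c p) t θ *ᵥ initialState A c p q)) S‖ ^ 2
    ∂(phaseLaw N r)

/-- The law of the outcome of one experiment. -/
noncomputable def outcomeLaw (H : Op N) (c : Fin χ) (p : Pass) (q : Quadrature) (t : ℝ) (r : ℕ) :
    MeasureTheory.Measure (Outcome A c) :=
  MeasureTheory.Measure.sum fun o =>
    ENNReal.ofReal (bornWeight A H c p q t r o) • MeasureTheory.Measure.dirac o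

/-! ### Reshaping error -/

/-- The two-site (or one-site) restriction of the Hamiltonian to the measured subsystem. -/
noncomputable def localHamiltonian (h : Fin N → Fin N → ℝ) (ξ : Fin N → ℝ) (C : G.edgeSet) :
    Pass → Op N
  | .hop => -((h (A.k₁ C) (A.k₂ C) : ℂ) • (hopping (A.k₁ C) (A.k₂ C) + hopping (A.k₂ C) (A.k₁ C)))
      + (ξ (A.k₁ C) : ℂ) • onsite (A.k₁ C) + (ξ (A.k₂ C) : ℂ) • onsite (A.k₂ C)
  | .site₁ => (ξ (A.k₁ C) : ℂ) • onsite (A.k₁ C)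
  | .site₂ => (ξ (A.k₂ C) : ℂ) • onsite (A.k₂ C)

/-- The reshaping error with `r` time steps at level `j`, for the observable measured on `C`. -/
noncomputable def reshapingError (h : Fin N → Fin N → ℝ) (ξ : Fin N → ℝ) (p : Pass) (j r : ℕ)
    (C : G.edgeSet) : ℝ :=
  opNorm (reshapedHeisenberg (hubbard G h ξ) (randomSites A (A.colour C) p) (evolutionTime j p) r
      (localObservable A p C)
    - heisenberg (localHamiltonian A h ξ C p) (evolutionTime j p) (localObservable A p C))

/-- The numbers of time steps at the levels `0, …, J` are large enough for the reshaping error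
to be at most `(√3/2 - 2/3)/4` in every experiment. -/
def StepsAdmissible (h : Fin N → Fin N → ℝ) (ξ : Fin N → ℝ) (J : ℕ) (r : ℕ → ℕ) : Prop :=
  ∀ j ≤ J, 0 < r j ∧
    ∀ (p : Pass) (C : G.edgeSet),
      reshapingError A h ξ p j (r j) C ≤ (Real.sqrt 3 / 2 - 2 / 3) / 4

/-! ### Robust phase estimation -/

/-- The last level of the phase estimation with accuracy `ε`. -/
noncomputable def lastLevel (ε : ℝ) : ℕ := ⌈Real.logb 2 (Real.pi / (3 * ε))⌉₊

/-- The number of repetitions of each experiment. -/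
noncomputable def repetitions (ε η : ℝ) : ℕ :=
  ⌈9 * (Real.log (4 / η) + Real.log (lastLevel ε + 1))⌉₊

/-- One refinement: among the candidates `(arg z + 2πk) / 2^j`, `k ∈ ℤ`, the one nearest to
`θ`. -/
noncomputable def rpeStep (j : ℕ) (θ : ℝ) (z : ℂ) : ℝ :=
  (Complex.arg z + 2 * Real.pi * round ((2 ^ j * θ - Complex.arg z) / (2 * Real.pi))) / 2 ^ j

/-- The estimate of the phase after level `j`, where `Z i` estimates `exp(2^i iθ)`. -/
noncomputable def rpe (Z : ℕ → ℂ) : ℕ → ℝ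
  | 0 => rpeStep 0 0 (Z 0)
  | j + 1 => rpeStep (j + 1) (rpe Z j) (Z (j + 1))

/-! ### The learning algorithm -/

/-- One run of the quantum system. The experiments are indexed by colour, family, level,
quadrature and repetition, with levels `0, …, J` and `n` repetitions. -/
structure Shot (χ J n : ℕ) where
  colour : Fin χ
  pass : Pass
  level : Fin (J + 1)
  quad : Quadrature
  rep : Fin n
  deriving DecidableEq, Fintype

/-- The record of all outcomes of the algorithm. -/
abbrev Record (J n : ℕ) : Type := (s : Shot χ J n) → Outcome A s.colour

/-- The law of the record: all experiments are independent, and an experiment of level `j` uses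
`r j` time steps. -/
noncomputable def recordLaw (H : Op N) (J n : ℕ) (r : ℕ → ℕ) :
    MeasureTheory.Measure (Record A J n) :=
  MeasureTheory.Measure.pi fun s =>
    outcomeLaw A H s.colour s.pass s.quad (evolutionTime s.level s.pass) (r s.level)

/-- The average over all repetitions of the outcome at `C`, rescaled from `{0, 1}` to
`{-1, 1}`. -/
noncomputable def average {J n : ℕ} (ω : Record A J n) (p : Pass) (q : Quadrature)
    (j : Fin (J + 1)) (C : G.edgeSet) : ℝ :=
  (∑ k : Fin n, if ω ⟨A.colour C, p, j, q, k⟩ ⟨C, rfl⟩ then (1 : ℝ) else -1) / n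

/-- The signal `X_j + i Y_j`. -/
noncomputable def signal {J n : ℕ} (ω : Record A J n) (p : Pass) (j : Fin (J + 1))
    (C : G.edgeSet) : ℂ :=
  average A ω p .cosine j C + Complex.I * average A ω p .sine j C

/-- The estimate produced by phase estimation from the signals of the edge `C`. -/
noncomputable def estimate {J n : ℕ} (ω : Record A J n) (p : Pass) (C : G.edgeSet) : ℝ :=
  rpe (fun j => signal A ω p (Fin.ofNat (J + 1) j) C) J

/-- The estimate of the hopping coefficient of two neighbours. -/
noncomputable def hHat {J n : ℕ} (ω : Record A J n) {i j : Fin N} (hij : G.Adj i j) : ℝ :=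
  estimate A ω .hop ⟨s(i, j), hij⟩

/-- The estimate of the on-site coefficient of `i` that results from the colour of the edge
`{i, j}`. -/
noncomputable def ξHat {J n : ℕ} (ω : Record A J n) {i j : Fin N} (hij : G.Adj i j) : ℝ :=
  estimate A ω (if i = A.k₁ ⟨s(i, j), hij⟩ then .site₁ else .site₂) ⟨s(i, j), hij⟩

end Experiments

/-! ### Cost -/

/-- The total evolution time under the unknown Hamiltonian. -/
noncomputable def totalEvolutionTime (χ J n : ℕ) : ℝ :=
  ∑ s : Shot χ J n, evolutionTime s.level s.pass

/-- The number of experiments. -/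
def numExperiments (χ J n : ℕ) : ℕ := Fintype.card (Shot χ J n)

/-- The number of single-site random unitaries that are inserted: each time step takes a
single-site unitary and its inverse at every randomised site. -/
noncomputable def numInsertions {N χ : ℕ} {G : SimpleGraph (Fin N)} (A : ColouredEdges G χ)
    (J n : ℕ) (r : ℕ → ℕ) : ℕ :=
  ∑ s : Shot χ J n, 2 * r s.level * (randomSites A s.colour s.pass).card

/-! Random phases disconnect each measured subsystem from the rest of the lattice. Averaged over the
phases on `R`, a hopping term with an end in `R` vanishes, while hopping between two sites outside
`R` and all on-site terms are unchanged (`phaseAverage_hubbard`). Different edges of one colour have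
no equal or adjacent end points, so a measured subsystem `X` has no unrandomised neighbour outside
itself. On observables of `X` the averaged Hamiltonian therefore generates the same commutator as
the Hamiltonian restricted to `X`.

In one step of length `τ`, the zeroth and first orders in `τ` thus agree with the restricted
evolution after averaging. The remainders are bounded by `τ²` times double commutators such as `[H,
[H, A]]`. Only terms near `X` contribute to these, so their norm depends on the degree but not on
`N` (`norm_doubleCommutator_hubbard_le`). The steps are independent and an averaged step is a
contraction, so `r` steps of total time `t` cost an error of order `t² / r`
(`norm_averagedSteps_sub_heisenberg_le`). Step numbers of order `4 ^ j` keep it below a fixed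
constant at every level.

The restricted dynamics is that of a two-level system and can be solved exactly: a "yes" has
probability `(1 + cos φ) / 2` or `(1 + sin φ) / 2`, where `φ` is `2 ^ j` times the unknown
coefficient (`exists_localAmplitude`). The other subsystems of the wedge product enter only through
a sign (`exists_initialState_eq`). Hence the mean of `X_j + i Y_j` is within a constant of `exp(iφ)`
(`abs_integral_outcome_sub_le`).

Constant accuracy at each level is enough. A signal closer than `√3/2` to `exp(iφ)` has its argument
within `π/3` of `φ` modulo `2π`, and the previous level has already fixed the branch, so each level
halves the error (`abs_rpe_sub_lt`). By Hoeffding's inequality and a union bound over the `2(J + 1)`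
averages of one subsystem, all its signals are that good with probability above `1 - η`
(`measureReal_estimate_gt`). The evolution times grow like `2 ^ j` and the step numbers like `4 ^
j`, so the last level, where `2 ^ J` is of order `1/ε`, dominates the cost. -/

/-! ### Canonical anticommutation relations -/

section Fock

variable {N : ℕ}

/-- The Jordan-Wigner sign of the mode `m` in the configuration `S`. -/
def modeSign (m : Mode N) (S : Finset (Mode N)) : ℂ := (-1) ^ (S.filter (fun m' => m' < m)).card

lemma modeSign_mul_self (m : Mode N) (S : Finset (Mode N)) : modeSign m S * modeSign m S = 1 := by
  rw [modeSign, ← mul_pow]; simp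

lemma modeSign_insert_self (m : Mode N) (S : Finset (Mode N)) :
    modeSign m (insert m S) = modeSign m S := by
  simp [modeSign, Finset.filter_insert]

lemma modeSign_erase_self (m : Mode N) (S : Finset (Mode N)) :
    modeSign m (S.erase m) = modeSign m S := by
  by_cases h : m ∈ S
  · rw [← modeSign_insert_self, Finset.insert_erase h]
  · rw [Finset.erase_eq_of_notMem h]

lemma modeSign_insert {m m' : Mode N} {S : Finset (Mode N)} (h : m' ∉ S) :
    modeSign m (insert m' S) = if m' < m then -modeSign m S else modeSign m S := by
  split_ifs with hlt
  · rw [modeSign, Finset.filter_insert, if_pos hlt, Finset.card_insert_of_notMem (by simp [h]),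
      pow_succ, modeSign]
    ring
  · rw [modeSign, Finset.filter_insert, if_neg hlt, modeSign]

lemma modeSign_erase {m m' : Mode N} {S : Finset (Mode N)} (h : m' ∈ S) :
    modeSign m (S.erase m') = if m' < m then -modeSign m S else modeSign m S := by
  have := modeSign_insert (m := m) (Finset.notMem_erase m' S)
  rw [Finset.insert_erase h] at this
  split_ifs at this ⊢ <;> rw [this]; simp

lemma create_mul_apply (m : Mode N) (X : Op N) (T S : Finset (Mode N)) :
    (create m * X) T S = if m ∈ T then modeSign m T * X (T.erase m) S else 0 := by
  rw [Matrix.mul_apply]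
  split_ifs with h
  · rw [Finset.sum_eq_single (T.erase m)]
    · simp only [create, Matrix.of_apply]
      rw [if_pos ⟨Finset.notMem_erase m T, (Finset.insert_erase h).symm⟩]
      rw [← modeSign_erase_self m T, modeSign]
    · intro U _ hU
      simp only [create, Matrix.of_apply]
      rw [if_neg, zero_mul]
      rintro ⟨h1, rfl⟩
      exact hU (Finset.erase_insert h1).symm
    · simp
  · refine Finset.sum_eq_zero fun U _ => ?_
    simp only [create, Matrix.of_apply]
    rw [if_neg, zero_mul]
    rintro ⟨_, rfl⟩
    exact h (Finset.mem_insert_self _ _)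

lemma annihilate_mul_apply (m : Mode N) (X : Op N) (T S : Finset (Mode N)) :
    (annihilate m * X) T S = if m ∈ T then 0 else modeSign m T * X (insert m T) S := by
  rw [Matrix.mul_apply]
  split_ifs with h
  · refine Finset.sum_eq_zero fun U _ => ?_
    simp [annihilate, Matrix.conjTranspose_apply, create, h]
  · rw [Finset.sum_eq_single (insert m T)]
    · simp [annihilate, Matrix.conjTranspose_apply, create, h, modeSign]
    · intro U _ hU
      simp [annihilate, Matrix.conjTranspose_apply, create, hU]
    · simp

lemma create_mul_self (m : Mode N) : create m * create m = 0 := by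
  ext T S
  rw [create_mul_apply, ← mul_one (create m), create_mul_apply]
  simp

lemma annihilate_mul_self (m : Mode N) : annihilate m * annihilate m = 0 := by
  rw [annihilate, ← Matrix.conjTranspose_mul, create_mul_self, Matrix.conjTranspose_zero]

lemma create_mul_create {m m' : Mode N} (h : m ≠ m') :
    create m * create m' = -(create m' * create m) := by
  ext T S
  rw [← mul_one (create m'), ← mul_one (create m), mul_assoc, mul_assoc, one_mul, one_mul,
    Matrix.neg_apply, create_mul_apply, create_mul_apply, create_mul_apply, create_mul_apply]
  by_cases h1 : m ∈ T <;> by_cases h2 : m' ∈ T <;>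
    simp only [h1, h2, Finset.mem_erase, h, h.symm, if_true, if_false, ne_eq,
      not_false_eq_true, and_true, and_false, mul_zero, neg_zero]
  rw [modeSign_erase h1, modeSign_erase h2, Finset.erase_right_comm]
  rcases lt_or_gt_of_ne h with hlt | hlt <;> simp only [hlt, hlt.not_gt, if_true, if_false] <;> ring

lemma annihilate_mul_annihilate {m m' : Mode N} (h : m ≠ m') :
    annihilate m * annihilate m' = -(annihilate m' * annihilate m) := by
  rw [annihilate, annihilate, ← Matrix.conjTranspose_mul, create_mul_create h.symm,
    Matrix.conjTranspose_neg, Matrix.conjTranspose_mul]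

lemma annihilate_mul_create {m m' : Mode N} (h : m ≠ m') :
    annihilate m * create m' = -(create m' * annihilate m) := by
  ext T S
  rw [← mul_one (create m'), ← mul_one (annihilate m), mul_assoc, mul_assoc, one_mul, one_mul,
    Matrix.neg_apply, create_mul_apply, annihilate_mul_apply, create_mul_apply,
    annihilate_mul_apply]
  by_cases h1 : m ∈ T <;> by_cases h2 : m' ∈ T <;>
    simp only [h1, h2, Finset.mem_erase, Finset.mem_insert, h, h.symm, if_true, if_false, ne_eq,
      not_false_eq_true, and_true, and_false, false_or, or_false, mul_zero,
      neg_zero]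
  rw [modeSign_erase h2, modeSign_insert h1, Finset.erase_insert_of_ne h]
  rcases lt_or_gt_of_ne h with hlt | hlt <;> simp only [hlt, hlt.not_gt, if_true, if_false] <;> ring

lemma number_eq_diagonal (m : Mode N) :
    number m = Matrix.diagonal fun S => if m ∈ S then (1 : ℂ) else 0 := by
  ext T S
  rw [number, ← mul_one (annihilate m), create_mul_apply, annihilate_mul_apply]
  by_cases h1 : m ∈ T
  · simp [h1, Matrix.one_apply, Matrix.diagonal_apply, modeSign_erase_self,
      modeSign_mul_self]
  · simp [h1, Matrix.diagonal_apply]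

lemma annihilate_mul_create_self (m : Mode N) : annihilate m * create m = 1 - number m := by
  rw [number_eq_diagonal]
  ext T S
  rw [← mul_one (create m), annihilate_mul_apply, create_mul_apply]
  by_cases h1 : m ∈ T
  · simp [h1, Matrix.one_apply, Matrix.diagonal_apply]
  · simp [h1, Matrix.one_apply, Matrix.diagonal_apply, modeSign_insert_self,
      modeSign_mul_self]

lemma conjTranspose_number (m : Mode N) : (number m)ᴴ = number m := by
  rw [number, annihilate, Matrix.conjTranspose_mul, Matrix.conjTranspose_conjTranspose]

lemma conjTranspose_create (m : Mode N) : (create m)ᴴ = annihilate m := rfl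

lemma conjTranspose_annihilate (m : Mode N) : (annihilate m)ᴴ = create m := by
  rw [annihilate, Matrix.conjTranspose_conjTranspose]

lemma number_commute_number (m m' : Mode N) : Commute (number m) (number m') := by
  simp only [number_eq_diagonal, Commute, SemiconjBy, Matrix.diagonal_mul_diagonal]
  congr 1; ext S; ring

/-- The two signs cancel. This is why products of two fermionic operators behave as local operators:
they commute, rather than anticommute, with the operators of other modes. -/
lemma Commute.of_neg_neg {R : Type*} [Ring R] {a b c : R} (hb : a * b = -(b * a))
    (hc : a * c = -(c * a)) : Commute a (b * c) := by
  rw [Commute, SemiconjBy, ← mul_assoc, hb, neg_mul, mul_assoc, hc, mul_neg, neg_neg, mul_assoc]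

lemma create_commute_number {m m' : Mode N} (h : m ≠ m') : Commute (create m) (number m') := by
  refine Commute.of_neg_neg (create_mul_create h) ?_
  rw [annihilate_mul_create h.symm, neg_neg]

lemma annihilate_commute_number {m m' : Mode N} (h : m ≠ m') :
    Commute (annihilate m) (number m') :=
  Commute.of_neg_neg (annihilate_mul_create h) (annihilate_mul_annihilate h)

lemma create_commute_create_mul_annihilate {m a b : Mode N} (ha : m ≠ a) (hb : m ≠ b) :
    Commute (create m) (create a * annihilate b) := by
  refine Commute.of_neg_neg (create_mul_create ha) ?_
  rw [annihilate_mul_create hb.symm, neg_neg]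

lemma annihilate_commute_create_mul_annihilate {m a b : Mode N} (ha : m ≠ a) (hb : m ≠ b) :
    Commute (annihilate m) (create a * annihilate b) :=
  Commute.of_neg_neg (annihilate_mul_create ha) (annihilate_mul_annihilate hb)

lemma create_commute_create_mul_create {m a b : Mode N} (ha : m ≠ a) (hb : m ≠ b) :
    Commute (create m) (create a * create b) :=
  Commute.of_neg_neg (create_mul_create ha) (create_mul_create hb)

lemma annihilate_commute_create_mul_create {m a b : Mode N} (ha : m ≠ a) (hb : m ≠ b) :
    Commute (annihilate m) (create a * create b) :=
  Commute.of_neg_neg (annihilate_mul_create ha) (annihilate_mul_create hb)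

lemma annihilate_mul_one_sub_number (m : Mode N) : annihilate m * (1 - number m) = 0 := by
  rw [← annihilate_mul_create_self, ← mul_assoc, annihilate_mul_self, zero_mul]

end Fock

/-! ### Local operators and the locality of the Hamiltonian -/

section Locality

open scoped Matrix.Norms.L2Operator

variable {N : ℕ}

/-- The site of a mode. -/
def Mode.site (m : Mode N) : Fin N := (ofLex m).1

@[simp] lemma site_up (i : Fin N) : Mode.site (up i) = i := rfl
@[simp] lemma site_dn (i : Fin N) : Mode.site (dn i) = i := rfl

lemma up_ne_dn (i j : Fin N) : up i ≠ dn j := by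
  intro h
  have := congrArg (fun m : Mode N => (ofLex m).2) h
  simp [up, dn] at this

lemma up_ne_up {i j : Fin N} (h : i ≠ j) : up i ≠ up j := fun e => h (congrArg Mode.site e)

/-- The creation and annihilation operators of the sites in `X`. -/
def localGenerators (X : Finset (Fin N)) : Set (Op N) :=
  {A | ∃ m : Mode N, m.site ∈ X ∧ (A = create m ∨ A = annihilate m)}

/-- The operators supported on the sites in `X`. -/
def localAlgebra (X : Finset (Fin N)) : Subalgebra ℂ (Op N) :=
  Subalgebra.centralizer ℂ (Set.centralizer (localGenerators X))

variable {X Y : Finset (Fin N)} {A B : Op N}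

lemma create_mem_localAlgebra {m : Mode N} (h : m.site ∈ X) : create m ∈ localAlgebra X :=
  Set.subset_centralizer_centralizer ⟨m, h, Or.inl rfl⟩

lemma annihilate_mem_localAlgebra {m : Mode N} (h : m.site ∈ X) :
    annihilate m ∈ localAlgebra X :=
  Set.subset_centralizer_centralizer ⟨m, h, Or.inr rfl⟩

lemma number_mem_localAlgebra {m : Mode N} (h : m.site ∈ X) : number m ∈ localAlgebra X :=
  mul_mem (create_mem_localAlgebra h) (annihilate_mem_localAlgebra h)

/-- The reason for defining `localAlgebra` as a bicommutant: locality arguments reduce to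
generators, without writing elements as polynomials in them. -/
lemma commute_of_mem_localAlgebra (hA : A ∈ localAlgebra X)
    (hB : ∀ m : Mode N, m.site ∈ X → Commute B (create m) ∧ Commute B (annihilate m)) :
    Commute B A := by
  refine (Set.mem_centralizer_iff.1 hA) B ?_
  rintro _ ⟨m, hm, rfl | rfl⟩
  · exact (hB m hm).1.symm
  · exact (hB m hm).2.symm

lemma localAlgebra_mono (h : X ⊆ Y) : localAlgebra X ≤ localAlgebra Y := by
  refine Set.centralizer_subset (Set.centralizer_subset ?_)
  rintro _ ⟨m, hm, hA⟩
  exact ⟨m, h hm, hA⟩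

/-- Whatever commutes with `A` commutes with its exponential, so a bicommutant needs no closedness
argument here. -/
lemma exp_mem_localAlgebra (hA : A ∈ localAlgebra X) : NormedSpace.exp A ∈ localAlgebra X :=
  Set.mem_centralizer_iff.2 fun _ hB =>
    (Commute.exp_right (Set.mem_centralizer_iff.1 hA _ hB : Commute _ _)).eq

/-- The generators are closed under adjoints; so is their commutant, and hence the bicommutant. -/
lemma conjTranspose_mem_localAlgebra (hA : A ∈ localAlgebra X) : Aᴴ ∈ localAlgebra X := by
  refine Set.mem_centralizer_iff.2 fun B hB => ?_
  have h : Bᴴ ∈ Set.centralizer (localGenerators X) := by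
    rintro _ ⟨m, hm, rfl | rfl⟩
    · have := hB (annihilate m) ⟨m, hm, Or.inr rfl⟩
      rw [← conjTranspose_annihilate, ← Matrix.conjTranspose_mul, ← this,
        Matrix.conjTranspose_mul]
    · have := hB (create m) ⟨m, hm, Or.inl rfl⟩
      rw [← conjTranspose_create, ← Matrix.conjTranspose_mul, ← this, Matrix.conjTranspose_mul]
  have := Set.mem_centralizer_iff.1 hA _ h
  have := congrArg Matrix.conjTranspose this
  simpa [Matrix.conjTranspose_mul] using this.symm

lemma hopping_mem_localAlgebra {i j : Fin N} (hi : i ∈ X) (hj : j ∈ X) :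
    hopping i j ∈ localAlgebra X :=
  add_mem (mul_mem (create_mem_localAlgebra hi) (annihilate_mem_localAlgebra hj))
    (mul_mem (create_mem_localAlgebra hi) (annihilate_mem_localAlgebra hj))

lemma onsite_mem_localAlgebra {i : Fin N} (hi : i ∈ X) : onsite i ∈ localAlgebra X :=
  mul_mem (number_mem_localAlgebra hi) (number_mem_localAlgebra hi)

lemma number_commute_of_mem_localAlgebra (hA : A ∈ localAlgebra X) {m : Mode N}
    (hm : m.site ∉ X) : Commute (number m) A :=
  commute_of_mem_localAlgebra hA fun m' hm' => by
    have h : m' ≠ m := fun e => hm (e ▸ hm')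
    exact ⟨(create_commute_number h).symm, (annihilate_commute_number h).symm⟩

lemma hopping_commute_of_mem_localAlgebra (hA : A ∈ localAlgebra X) {i j : Fin N}
    (hi : i ∉ X) (hj : j ∉ X) : Commute (hopping i j) A := by
  refine commute_of_mem_localAlgebra hA fun m hm => ?_
  have h : ∀ m' : Mode N, m'.site ∉ X → m ≠ m' := fun m' hm' e => hm' (e ▸ hm)
  exact ⟨Commute.add_left
      (create_commute_create_mul_annihilate (h (up i) hi) (h (up j) hj)).symm
      (create_commute_create_mul_annihilate (h (dn i) hi) (h (dn j) hj)).symm,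
    Commute.add_left
      (annihilate_commute_create_mul_annihilate (h (up i) hi) (h (up j) hj)).symm
      (annihilate_commute_create_mul_annihilate (h (dn i) hi) (h (dn j) hj)).symm⟩

lemma onsite_commute_of_mem_localAlgebra (hA : A ∈ localAlgebra X) {i : Fin N}
    (hi : i ∉ X) : Commute (onsite i) A :=
  Commute.mul_left (number_commute_of_mem_localAlgebra hA (m := up i) hi)
    (number_commute_of_mem_localAlgebra hA (m := dn i) hi)

/-! ### Norms and adjoints of the terms of the Hamiltonian -/

lemma norm_number_le (m : Mode N) : ‖number m‖ ≤ 1 := by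
  rw [number_eq_diagonal, Matrix.l2_opNorm_diagonal]
  refine (pi_norm_le_iff_of_nonneg zero_le_one).2 fun S => ?_
  split_ifs <;> simp

lemma norm_create_le (m : Mode N) : ‖create m‖ ≤ 1 := by
  have h : ‖create m‖ * ‖create m‖ ≤ 1 := by
    rw [← Matrix.l2_opNorm_conjTranspose_mul_self, conjTranspose_create,
      annihilate_mul_create_self, number_eq_diagonal, ← Matrix.diagonal_one, Matrix.diagonal_sub,
      Matrix.l2_opNorm_diagonal]
    refine (pi_norm_le_iff_of_nonneg zero_le_one).2 fun S => ?_
    split_ifs <;> simp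
  nlinarith [norm_nonneg (create m)]

lemma norm_annihilate_le (m : Mode N) : ‖annihilate m‖ ≤ 1 := by
  rw [← conjTranspose_create, Matrix.l2_opNorm_conjTranspose]; exact norm_create_le m

lemma norm_mul_le_one {A B : Op N} (hA : ‖A‖ ≤ 1) (hB : ‖B‖ ≤ 1) : ‖A * B‖ ≤ 1 :=
  (norm_mul_le _ _).trans (mul_le_one₀ hA (norm_nonneg _) hB)

lemma norm_hopping_le (i j : Fin N) : ‖hopping i j‖ ≤ 2 := by
  refine (norm_add_le _ _).trans ?_
  have h1 := norm_mul_le_one (norm_create_le (up i)) (norm_annihilate_le (up j))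
  have h2 := norm_mul_le_one (norm_create_le (dn i)) (norm_annihilate_le (dn j))
  linarith

lemma norm_onsite_le (i : Fin N) : ‖onsite i‖ ≤ 1 :=
  norm_mul_le_one (norm_number_le _) (norm_number_le _)

lemma conjTranspose_hopping (i j : Fin N) : (hopping i j)ᴴ = hopping j i := by
  simp [hopping, Matrix.conjTranspose_mul, conjTranspose_create, conjTranspose_annihilate]

lemma conjTranspose_onsite (i : Fin N) : (onsite i)ᴴ = onsite i := by
  rw [onsite, Matrix.conjTranspose_mul, conjTranspose_number, conjTranspose_number]
  exact number_commute_number _ _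

open Classical in
/-- The hopping terms of the ordered pairs in `E` and the on-site terms of the sites in `S`. -/
noncomputable def partialHubbard (G : SimpleGraph (Fin N)) (h : Fin N → Fin N → ℝ)
    (ξ : Fin N → ℝ) (E : Fin N → Fin N → Prop) (S : Fin N → Prop) : Op N :=
  -(∑ i, ∑ j, if G.Adj i j ∧ E i j then (h i j : ℂ) • hopping i j else 0)
    + ∑ i, if S i then (ξ i : ℂ) • onsite i else 0

variable {G : SimpleGraph (Fin N)} {h : Fin N → Fin N → ℝ} {ξ : Fin N → ℝ}
  {E E' : Fin N → Fin N → Prop} {S S' : Fin N → Prop}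

lemma hubbard_eq_partialHubbard :
    hubbard G h ξ = partialHubbard G h ξ (fun _ _ => True) (fun _ => True) := by
  classical
  simp only [hubbard, partialHubbard, and_true, if_true]

lemma partialHubbard_mem_localAlgebra (hE : ∀ i j, G.Adj i j → E i j → i ∈ X ∧ j ∈ X)
    (hS : ∀ i, S i → i ∈ X) : partialHubbard G h ξ E S ∈ localAlgebra X := by
  refine add_mem (neg_mem (sum_mem fun i _ => sum_mem fun j _ => ?_)) (sum_mem fun i _ => ?_)
  · split_ifs with hij
    · exact Subalgebra.smul_mem _
        (hopping_mem_localAlgebra (hE i j hij.1 hij.2).1 (hE i j hij.1 hij.2).2) _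
    · exact zero_mem _
  · split_ifs with hi
    · exact Subalgebra.smul_mem _ (onsite_mem_localAlgebra (hS i hi)) _
    · exact zero_mem _

/-- Terms touching `X` cancel in the difference. The remaining ones are even and live away from `X`,
so they commute with everything in `localAlgebra X`. -/
lemma partialHubbard_sub_commute (hA : A ∈ localAlgebra X)
    (hE : ∀ i j, G.Adj i j → (i ∈ X ∨ j ∈ X) → (E i j ↔ E' i j))
    (hS : ∀ i ∈ X, (S i ↔ S' i)) :
    Commute (partialHubbard G h ξ E S - partialHubbard G h ξ E' S') A := by
  classical
  have hsum : partialHubbard G h ξ E S - partialHubbard G h ξ E' S' =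
      partialHubbard G h ξ (fun i j => E i j ∧ ¬ (i ∈ X ∨ j ∈ X)) (fun i => S i ∧ i ∉ X)
      - partialHubbard G h ξ (fun i j => E' i j ∧ ¬ (i ∈ X ∨ j ∈ X)) (fun i => S' i ∧ i ∉ X) := by
    simp only [partialHubbard, add_sub_add_comm, neg_sub_neg, ← Finset.sum_sub_distrib]
    congr 1
    · refine Finset.sum_congr rfl fun i _ => Finset.sum_congr rfl fun j _ => ?_
      have := hE i j
      by_cases h1 : G.Adj i j <;> by_cases h2 : i ∈ X ∨ j ∈ X
      · simp [h1, h2, this h1 h2]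
      · simp [h1, h2]
      · simp [h1]
      · simp [h1]
    · refine Finset.sum_congr rfl fun i _ => ?_
      by_cases h2 : i ∈ X
      · simp [h2, hS i h2]
      · simp [h2]
  rw [hsum]
  have key : ∀ (F : Fin N → Fin N → Prop) (T : Fin N → Prop), Commute
      (partialHubbard G h ξ (fun i j => F i j ∧ ¬ (i ∈ X ∨ j ∈ X)) (fun i => T i ∧ i ∉ X)) A := by
    intro F T
    refine Commute.add_left (Commute.neg_left (Commute.sum_left _ _ _ fun i _ =>
      Commute.sum_left _ _ _ fun j _ => ?_)) (Commute.sum_left _ _ _ fun i _ => ?_)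
    · split_ifs with hij
      · obtain ⟨_, _, hij⟩ := hij
        push Not at hij
        exact (hopping_commute_of_mem_localAlgebra hA hij.1 hij.2).smul_left _
      · exact Commute.zero_left _
    · split_ifs with hi
      · exact (onsite_commute_of_mem_localAlgebra hA hi.2).smul_left _
      · exact Commute.zero_left _
  exact (key E S).sub_left (key E' S')

lemma isHermitian_partialHubbard (hsymm : ∀ i j, G.Adj i j → h i j = h j i)
    (hE : ∀ i j, E i j → E j i) : (partialHubbard G h ξ E S)ᴴ = partialHubbard G h ξ E S := by
  classical
  simp only [partialHubbard, Matrix.conjTranspose_add, Matrix.conjTranspose_neg,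
    Matrix.conjTranspose_sum]
  congr 1
  · rw [Finset.sum_comm]
    congr 1
    refine Finset.sum_congr rfl fun i _ => Finset.sum_congr rfl fun j _ => ?_
    have h1 : (G.Adj j i ∧ E j i) ↔ (G.Adj i j ∧ E i j) :=
      ⟨fun h => ⟨h.1.symm, hE _ _ h.2⟩, fun h => ⟨h.1.symm, hE _ _ h.2⟩⟩
    rw [if_congr h1 rfl rfl]
    split_ifs with hij
    · rw [Matrix.conjTranspose_smul, conjTranspose_hopping, hsymm i j hij.1]; simp
    · simp
  · refine Finset.sum_congr rfl fun i _ => ?_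
    split_ifs with hi
    · rw [Matrix.conjTranspose_smul, conjTranspose_onsite]; simp
    · simp

/-- A site lies on at most `d` edges, hence in `2d` ordered pairs, each contributing a term of norm
at most 2; its on-site term adds 1. This gives `4d + 1` per site of `X`. -/
lemma norm_partialHubbard_le {d : ℕ} (hdeg : ∀ i, (G.neighborSet i).ncard ≤ d)
    (hh : ∀ i j, G.Adj i j → |h i j| ≤ 1) (hξ : ∀ i, |ξ i| ≤ 1)
    (hE : ∀ i j, G.Adj i j → E i j → i ∈ X ∨ j ∈ X) (hS : ∀ i, S i → i ∈ X) :
    ‖partialHubbard G h ξ E S‖ ≤ X.card * (4 * d + 1) := by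
  classical
  have hsmul : ∀ (c : ℝ) (B : Op N) (b : ℝ), |c| ≤ 1 → ‖B‖ ≤ b → ‖(c : ℂ) • B‖ ≤ b := by
    intro c B b hc hB
    rw [norm_smul, Complex.norm_real, Real.norm_eq_abs]
    nlinarith [norm_nonneg B, abs_nonneg c]
  have hcount : ∀ i, (∑ j, if G.Adj i j then (2 : ℝ) else 0) ≤ 2 * d := by
    intro i
    rw [← Finset.sum_filter, Finset.sum_const, nsmul_eq_mul, mul_comm]
    have : (Finset.univ.filter (G.Adj i)).card = (G.neighborSet i).ncard := by
      rw [← Set.ncard_coe_finset]; congr 1; ext j; simp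
    rw [this]
    have := hdeg i
    gcongr
  have hind : ∀ f : Fin N → Fin N → ℝ,
      (∑ i, ∑ j, if i ∈ X then f i j else 0) = ∑ i ∈ X, ∑ j, f i j := by
    intro f
    rw [← Finset.filter_univ_mem X, Finset.sum_filter]
    refine Finset.sum_congr rfl fun i _ => ?_
    by_cases hi : i ∈ X <;> simp [hi]
  have h1 : ‖∑ i, ∑ j, if G.Adj i j ∧ E i j then (h i j : ℂ) • hopping i j else 0‖
      ≤ X.card * (4 * d) := by
    -- Each ordered pair is charged to an end point in `X`. Pairs with both ends in `X` are charged
    -- twice, which only weakens the bound and makes the two sums symmetric.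
    calc _ ≤ ∑ i, ∑ j, ((if i ∈ X then (if G.Adj i j then (2 : ℝ) else 0) else 0)
            + (if j ∈ X then (if G.Adj j i then (2 : ℝ) else 0) else 0)) := by
          refine (norm_sum_le _ _).trans (Finset.sum_le_sum fun i _ =>
            (norm_sum_le _ _).trans (Finset.sum_le_sum fun j _ => ?_))
          by_cases hij : G.Adj i j ∧ E i j
          · rw [if_pos hij]
            have hle := hsmul _ _ _ (hh i j hij.1) (norm_hopping_le i j)
            rcases hE i j hij.1 hij.2 with hi | hj
            · simp only [hi, hij.1, if_true]
              split_ifs <;> linarith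
            · simp only [hj, hij.1.symm, if_true]
              split_ifs <;> linarith
          · rw [if_neg hij, norm_zero]
            positivity
      _ = (∑ i ∈ X, ∑ j, if G.Adj i j then (2 : ℝ) else 0)
          + ∑ j ∈ X, ∑ i, if G.Adj j i then (2 : ℝ) else 0 := by
          simp only [Finset.sum_add_distrib]
          congr 1
          · exact hind _
          · rw [Finset.sum_comm]; exact hind _
      _ ≤ (∑ i ∈ X, 2 * (d : ℝ)) + ∑ j ∈ X, 2 * (d : ℝ) :=
          add_le_add (Finset.sum_le_sum fun i _ => hcount i) (Finset.sum_le_sum fun i _ => hcount i)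
      _ = X.card * (4 * d) := by rw [Finset.sum_const, nsmul_eq_mul]; ring
  have h2 : ‖∑ i, if S i then (ξ i : ℂ) • onsite i else 0‖ ≤ X.card := by
    calc _ ≤ ∑ i, if i ∈ X then (1 : ℝ) else 0 := by
          refine (norm_sum_le _ _).trans (Finset.sum_le_sum fun i _ => ?_)
          by_cases hi : S i
          · rw [if_pos hi, if_pos (hS i hi)]
            exact hsmul _ _ _ (hξ i) (norm_onsite_le i)
          · rw [if_neg hi, norm_zero]; positivity
      _ = X.card := by simp
  calc _ ≤ X.card * (4 * (d : ℝ)) + X.card := by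
        refine (norm_add_le _ _).trans (add_le_add ?_ h2)
        rwa [norm_neg]
    _ = _ := by ring

open Classical in
/-- The sites in `X` and their neighbours. -/
noncomputable def closedNeighborhood (G : SimpleGraph (Fin N)) (X : Finset (Fin N)) :
    Finset (Fin N) :=
  X ∪ X.biUnion fun i => Finset.univ.filter (G.Adj i)

lemma card_closedNeighborhood_le {d : ℕ} (hdeg : ∀ i, (G.neighborSet i).ncard ≤ d) :
    (closedNeighborhood G X).card ≤ X.card * (d + 1) := by
  classical
  refine (Finset.card_union_le _ _).trans ?_
  have : (X.biUnion fun i => Finset.univ.filter (G.Adj i)).card ≤ X.card * d := by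
    refine Finset.card_biUnion_le_card_mul _ _ _ fun i _ => ?_
    refine le_trans (le_of_eq ?_) (hdeg i)
    rw [← Set.ncard_coe_finset]; congr 1; ext j; simp
  linarith [mul_add X.card d 1]

/-- The commutator `[H, [H, A]]`. -/
def doubleCommutator (H A : Op N) : Op N := H * (H * A - A * H) - (H * A - A * H) * H

/-- Used to replace the full Hamiltonian inside a commutator by the few terms that do not commute
with `A`. -/
lemma commutator_eq_of_sub_commute {H H' : Op N} (hc : Commute (H - H') A) :
    H * A - A * H = H' * A - A * H' := by
  have := hc.eq
  rw [sub_mul, mul_sub] at this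
  rw [sub_eq_sub_iff_sub_eq_sub, this]

lemma norm_commutator_le (B A : Op N) : ‖B * A - A * B‖ ≤ 2 * ‖B‖ * ‖A‖ := by
  refine (norm_sub_le _ _).trans ?_
  have h1 := norm_mul_le B A
  have h2 := norm_mul_le A B
  linarith [mul_comm ‖A‖ ‖B‖]

/-- The constant in the bounds of second order in the time step. -/
def stepConstant (d : ℕ) : ℝ := 16 * (d + 1) * (4 * d + 1) ^ 2

/-- The inner commutator sees only the terms touching `X` (`H₁`) and is supported on the closed
neighbourhood `Y`; the outer one sees only the terms touching `Y` (`H₂`). Since `Y` has at most `2(d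
+ 1)` sites, both norms are free of `N`. Each commutator costs a further factor 2, which gives the
16 in `stepConstant`. -/
lemma norm_doubleCommutator_hubbard_le {d : ℕ} (hdeg : ∀ i, (G.neighborSet i).ncard ≤ d)
    (hh : ∀ i j, G.Adj i j → |h i j| ≤ 1) (hξ : ∀ i, |ξ i| ≤ 1) (hX : X.card ≤ 2)
    (hA : A ∈ localAlgebra X) :
    ‖doubleCommutator (hubbard G h ξ) A‖ ≤ stepConstant d * ‖A‖ := by
  set Y := closedNeighborhood G X with hY
  set H₁ := partialHubbard G h ξ (fun i j => i ∈ X ∨ j ∈ X) (fun i => i ∈ X) with hH₁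
  set H₂ := partialHubbard G h ξ (fun i j => i ∈ Y ∨ j ∈ Y) (fun i => i ∈ Y) with hH₂
  have hXY : X ⊆ Y := Finset.subset_union_left
  have hadj : ∀ i j, G.Adj i j → i ∈ X → j ∈ Y := fun i j hij hi =>
    Finset.mem_union_right _ (Finset.mem_biUnion.2 ⟨i, hi, by simpa using hij⟩)
  have hH₁Y : H₁ ∈ localAlgebra Y := by
    refine partialHubbard_mem_localAlgebra (fun i j hij hE => ?_) (fun i hi => hXY hi)
    rcases hE with hi | hj
    · exact ⟨hXY hi, hadj i j hij hi⟩
    · exact ⟨hadj j i hij.symm hj, hXY hj⟩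
  have hAY := localAlgebra_mono hXY hA
  have e₁ : hubbard G h ξ * A - A * hubbard G h ξ = H₁ * A - A * H₁ := by
    refine commutator_eq_of_sub_commute ?_
    rw [hubbard_eq_partialHubbard]
    exact partialHubbard_sub_commute hA (by simp) (by simp)
  have hc : H₁ * A - A * H₁ ∈ localAlgebra Y := sub_mem (mul_mem hH₁Y hAY) (mul_mem hAY hH₁Y)
  have e₂ := commutator_eq_of_sub_commute (H := hubbard G h ξ) (H' := H₂) (A := H₁ * A - A * H₁)
    (by
      rw [hubbard_eq_partialHubbard]
      exact partialHubbard_sub_commute hc (by simp) (by simp))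
  rw [doubleCommutator, e₁, e₂]
  have n₁ : ‖H₁‖ ≤ 2 * (4 * d + 1) := by
    refine (norm_partialHubbard_le hdeg hh hξ (X := X) (fun _ _ _ h => h) (fun _ h => h)).trans ?_
    have : (X.card : ℝ) ≤ 2 := by exact_mod_cast hX
    gcongr
  have n₂ : ‖H₂‖ ≤ 2 * (d + 1) * (4 * d + 1) := by
    refine (norm_partialHubbard_le hdeg hh hξ (X := Y) (fun _ _ _ h => h) (fun _ h => h)).trans ?_
    have : (Y.card : ℝ) ≤ 2 * (d + 1) := by
      have := card_closedNeighborhood_le (X := X) hdeg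
      have : Y.card ≤ 2 * (d + 1) := this.trans (Nat.mul_le_mul_right _ hX)
      exact_mod_cast this
    gcongr
  calc _ ≤ 2 * ‖H₂‖ * ‖H₁ * A - A * H₁‖ := norm_commutator_le _ _
    _ ≤ 2 * (2 * (d + 1) * (4 * d + 1)) * (2 * (2 * (4 * d + 1)) * ‖A‖) := by
      gcongr
      exact (norm_commutator_le _ _).trans (by gcongr)
    _ = stepConstant d * ‖A‖ := by rw [stepConstant]; ring

/-- The restricted Hamiltonian is itself small in norm, so no locality of `A` is needed. The larger
constant is kept so that both second-order remainders share one bound. -/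
lemma norm_doubleCommutator_partialHubbard_le {d : ℕ} (hdeg : ∀ i, (G.neighborSet i).ncard ≤ d)
    (hh : ∀ i j, G.Adj i j → |h i j| ≤ 1) (hξ : ∀ i, |ξ i| ≤ 1) (hX : X.card ≤ 2) (A : Op N) :
    ‖doubleCommutator (partialHubbard G h ξ (fun i j => i ∈ X ∧ j ∈ X) (fun i => i ∈ X)) A‖
      ≤ stepConstant d * ‖A‖ := by
  set H₁ := partialHubbard G h ξ (fun i j => i ∈ X ∧ j ∈ X) (fun i => i ∈ X) with hH₁
  have n₁ : ‖H₁‖ ≤ 2 * (4 * d + 1) := by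
    refine (norm_partialHubbard_le hdeg hh hξ (X := X) (fun _ _ _ h => Or.inl h.1)
      (fun _ h => h)).trans ?_
    have : (X.card : ℝ) ≤ 2 := by exact_mod_cast hX
    gcongr
  calc _ ≤ 2 * ‖H₁‖ * ‖H₁ * A - A * H₁‖ := norm_commutator_le _ _
    _ ≤ 2 * (2 * (4 * d + 1)) * (2 * (2 * (4 * d + 1)) * ‖A‖) := by
      gcongr
      exact (norm_commutator_le _ _).trans (by gcongr)
    _ = 16 * 1 * (4 * d + 1) ^ 2 * ‖A‖ := by ring
    _ ≤ stepConstant d * ‖A‖ := by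
      rw [stepConstant]
      gcongr
      linarith [(Nat.cast_nonneg d : (0 : ℝ) ≤ d)]

end Locality

/-! ### Random phases -/

section Phases

open scoped Matrix.Norms.L2Operator
open MeasureTheory

variable {N : ℕ}

instance : IsProbabilityMeasure uniformPhase := by
  refine ProbabilityTheory.cond_isProbabilityMeasure_of_finite ?_ ?_
  · rw [Real.volume_Icc]; simp [Real.pi_pos]
  · rw [Real.volume_Icc]; exact ENNReal.ofReal_ne_top

instance (N r : ℕ) : IsProbabilityMeasure (phaseLaw N r) := by
  unfold phaseLaw; infer_instance

lemma integral_exp_uniformPhase {c : ℂ} (hc : c = 1 ∨ c = -1) :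
    ∫ x, Complex.exp (c * Complex.I * x) ∂uniformPhase = 0 := by
  have hc0 : c * Complex.I ≠ 0 := by rcases hc with rfl | rfl <;> simp
  rw [uniformPhase, ProbabilityTheory.cond, integral_smul_measure, integral_Icc_eq_integral_Ioc,
    ← intervalIntegral.integral_of_le Real.two_pi_pos.le, integral_exp_mul_complex hc0]
  have h1 : Complex.exp (c * Complex.I * ((2 * Real.pi : ℝ) : ℂ)) = 1 := by
    push_cast
    rcases hc with rfl | rfl
    · rw [one_mul, mul_comm, Complex.exp_two_pi_mul_I]
    · rw [mul_comm, mul_left_comm, neg_one_mul, Complex.exp_neg, Complex.exp_two_pi_mul_I, inv_one]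
  simp only [h1, Complex.ofReal_zero, mul_zero, Complex.exp_zero, sub_self, zero_div, smul_zero]

/-- The phase that `phaseUnitary` imparts to a site. -/
def sitePhase (R : Finset (Fin N)) (θ : Fin N → ℝ) (i : Fin N) : ℝ := if i ∈ R then θ i else 0

/-- The integral factorises over sites, and `exp(±iθ)` averages to zero over a full period. With `i
= j` the phases would cancel instead. -/
lemma integral_exp_sitePhase (R : Finset (Fin N)) {i j : Fin N} (hij : i ≠ j) :
    ∫ θ : Fin N → ℝ, Complex.exp (Complex.I * (sitePhase R θ i - sitePhase R θ j))
      ∂(Measure.pi fun _ => uniformPhase) = if i ∉ R ∧ j ∉ R then 1 else 0 := by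
  classical
  let f : Fin N → ℝ → ℂ := fun k x =>
    if k ∈ R then (if k = i then Complex.exp (1 * Complex.I * x)
      else if k = j then Complex.exp (-1 * Complex.I * x) else 1) else 1
  have hprod : ∀ θ : Fin N → ℝ,
      Complex.exp (Complex.I * (sitePhase R θ i - sitePhase R θ j)) = ∏ k, f k (θ k) := by
    intro θ
    rw [← Finset.prod_subset (Finset.subset_univ {i, j}), Finset.prod_pair hij]
    · simp only [f, sitePhase, hij.symm, if_true, if_false]
      by_cases hi : i ∈ R <;> by_cases hj : j ∈ R <;>
        simp only [hi, hj, if_true, if_false, ← Complex.exp_add, mul_one] <;>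
        first | (congr 1; push_cast; ring1) | simp
    · intro k _ hk
      simp only [Finset.mem_insert, Finset.mem_singleton, not_or] at hk
      simp [f, hk]
  simp_rw [hprod]
  rw [integral_fintype_prod_eq_prod]
  split_ifs with h
  · refine Finset.prod_eq_one fun k _ => ?_
    have : ∀ x, f k x = 1 := by
      intro x
      by_cases hk : k ∈ R
      · have hi : k ≠ i := fun e => h.1 (e ▸ hk)
        have hj : k ≠ j := fun e => h.2 (e ▸ hk)
        simp [f, hi, hj]
      · simp [f, hk]
    simp [this]
  · rw [not_and_or, not_not, not_not] at h
    rcases h with h | h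
    · refine Finset.prod_eq_zero (Finset.mem_univ i) ?_
      simp only [f, h, if_true]
      exact integral_exp_uniformPhase (Or.inl rfl)
    · refine Finset.prod_eq_zero (Finset.mem_univ j) ?_
      simp only [f, h, hij.symm, if_true, if_false]
      exact integral_exp_uniformPhase (Or.inr rfl)

/-- The number of particles at a site. -/
def occupation (S : Finset (Mode N)) (i : Fin N) : ℝ :=
  (if up i ∈ S then 1 else 0) + (if dn i ∈ S then 1 else 0)

lemma siteUnitary_eq_diagonal (i : Fin N) (θ : ℝ) :
    siteUnitary i θ =
      Matrix.diagonal fun S => Complex.exp (-(Complex.I * (θ * occupation S i : ℝ))) := by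
  rw [siteUnitary, number_eq_diagonal, number_eq_diagonal, Matrix.diagonal_add,
    ← Matrix.diagonal_smul, Matrix.exp_diagonal]
  congr 1
  ext S
  rw [Pi.coe_exp, ← Complex.exp_eq_exp_ℂ]
  congr 1
  simp only [Pi.smul_apply, smul_eq_mul, occupation]
  split_ifs <;> push_cast <;> ring

lemma phaseUnitary_eq_diagonal (R : Finset (Fin N)) (θ : Fin N → ℝ) :
    phaseUnitary R θ = Matrix.diagonal fun S =>
      Complex.exp (-(Complex.I * (∑ i ∈ R, θ i * occupation S i : ℝ))) := by
  have h : ∀ l : List (Fin N), (l.map fun i => siteUnitary i (θ i)).prod =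
      Matrix.diagonal fun S =>
        Complex.exp (-(Complex.I * ((l.map fun i => θ i * occupation S i).sum : ℝ))) := by
    intro l
    induction l with
    | nil => simp
    | cons a l ih =>
      rw [List.map_cons, List.prod_cons, ih, siteUnitary_eq_diagonal,
        Matrix.diagonal_mul_diagonal]
      congr 1
      ext S
      rw [← Complex.exp_add, List.map_cons, List.sum_cons]
      congr 1
      push_cast
      ring
  rw [phaseUnitary, opProd, h]
  simp only [Finset.sum_map_toList]

lemma star_exp_neg_I_mul (x : ℝ) :
    star (Complex.exp (-(Complex.I * x))) = Complex.exp (Complex.I * x) := by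
  rw [Complex.star_def, ← Complex.exp_conj]; simp

lemma conjTranspose_phaseUnitary_mul_self (R : Finset (Fin N)) (θ : Fin N → ℝ) :
    (phaseUnitary R θ)ᴴ * phaseUnitary R θ = 1 := by
  rw [phaseUnitary_eq_diagonal, Matrix.diagonal_conjTranspose, Matrix.diagonal_mul_diagonal,
    ← Matrix.diagonal_one]
  congr 1
  ext S
  rw [Pi.star_apply, star_exp_neg_I_mul, ← Complex.exp_add]; simp

lemma phaseUnitary_mul_conjTranspose_self (R : Finset (Fin N)) (θ : Fin N → ℝ) :
    phaseUnitary R θ * (phaseUnitary R θ)ᴴ = 1 :=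
  mul_eq_one_comm.1 (conjTranspose_phaseUnitary_mul_self R θ)

lemma mode_eq_up_or_dn (m : Mode N) : m = up m.site ∨ m = dn m.site := by
  obtain ⟨k, b⟩ := m
  cases b
  · exact Or.inl rfl
  · exact Or.inr rfl

lemma up_inj {i j : Fin N} : up i = up j ↔ i = j := ⟨fun e => congrArg Mode.site e, fun e => e ▸ rfl⟩

lemma dn_inj {i j : Fin N} : dn i = dn j ↔ i = j := ⟨fun e => congrArg Mode.site e, fun e => e ▸ rfl⟩

lemma occupation_insert {m : Mode N} {S : Finset (Mode N)} (h : m ∉ S) (i : Fin N) :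
    occupation (insert m S) i = occupation S i + if i = m.site then 1 else 0 := by
  rcases mode_eq_up_or_dn m with e | e <;> rw [e] at h ⊢ <;>
    simp only [occupation, Finset.mem_insert, up_inj, dn_inj, up_ne_dn, (up_ne_dn _ _).symm,
      site_up, site_dn, false_or]
  all_goals
    by_cases hik : i = m.site
    · simp [hik, h, add_comm]
    · simp [hik]

/-- In the occupation basis the phase unitary is diagonal, and creation raises the occupation of one
site by one, so exactly that site's phase survives. -/
lemma phaseUnitary_conj_create (R : Finset (Fin N)) (θ : Fin N → ℝ) (m : Mode N) :
    (phaseUnitary R θ)ᴴ * create m * phaseUnitary R θ =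
      Complex.exp (Complex.I * sitePhase R θ m.site) • create m := by
  rw [phaseUnitary_eq_diagonal, Matrix.diagonal_conjTranspose]
  ext T S
  rw [Matrix.mul_diagonal, Matrix.diagonal_mul, Matrix.smul_apply, smul_eq_mul, Pi.star_apply,
    star_exp_neg_I_mul]
  by_cases h : m ∉ S ∧ T = insert m S
  · obtain ⟨hm, rfl⟩ := h
    have hsum : ∑ i ∈ R, θ i * occupation (insert m S) i
        = ∑ i ∈ R, θ i * occupation S i + sitePhase R θ m.site := by
      simp only [occupation_insert hm, mul_add, Finset.sum_add_distrib, sitePhase]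
      simp
    rw [mul_right_comm, ← Complex.exp_add, hsum]
    congr 2
    push_cast
    ring
  · simp [create, h]

lemma phaseUnitary_conj_annihilate (R : Finset (Fin N)) (θ : Fin N → ℝ) (m : Mode N) :
    (phaseUnitary R θ)ᴴ * annihilate m * phaseUnitary R θ =
      Complex.exp (-(Complex.I * sitePhase R θ m.site)) • annihilate m := by
  have := congrArg Matrix.conjTranspose (phaseUnitary_conj_create R θ m)
  rw [Matrix.conjTranspose_mul, Matrix.conjTranspose_mul, Matrix.conjTranspose_conjTranspose,
    Matrix.conjTranspose_smul, conjTranspose_create, ← mul_assoc, ← star_exp_neg_I_mul,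
    star_star] at this
  exact this

lemma phaseUnitary_conj_mul (R : Finset (Fin N)) (θ : Fin N → ℝ) (A B : Op N) :
    (phaseUnitary R θ)ᴴ * (A * B) * phaseUnitary R θ =
      ((phaseUnitary R θ)ᴴ * A * phaseUnitary R θ)
        * ((phaseUnitary R θ)ᴴ * B * phaseUnitary R θ) := by
  set U := phaseUnitary R θ
  calc _ = Uᴴ * A * 1 * B * U := by simp only [mul_assoc, one_mul]
    _ = _ := by
      rw [← phaseUnitary_mul_conjTranspose_self R θ]; simp only [mul_assoc]; rfl

/-- Both spins at a site receive the same phase, so the whole hopping term acquires a single scalar.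
-/
lemma phaseUnitary_conj_hopping (R : Finset (Fin N)) (θ : Fin N → ℝ) (i j : Fin N) :
    (phaseUnitary R θ)ᴴ * hopping i j * phaseUnitary R θ =
      Complex.exp (Complex.I * (sitePhase R θ i - sitePhase R θ j)) • hopping i j := by
  rw [hopping, mul_add, add_mul, phaseUnitary_conj_mul, phaseUnitary_conj_mul]
  simp only [phaseUnitary_conj_create, phaseUnitary_conj_annihilate, smul_mul_smul_comm, site_up,
    site_dn, smul_add, ← Complex.exp_add]
  simp only [sub_eq_add_neg, mul_add, mul_neg]

lemma phaseUnitary_conj_of_commute {R : Finset (Fin N)} {θ : Fin N → ℝ} {A : Op N}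
    (h : Commute (phaseUnitary R θ) A) :
    (phaseUnitary R θ)ᴴ * A * phaseUnitary R θ = A := by
  rw [mul_assoc, ← h.eq, ← mul_assoc, conjTranspose_phaseUnitary_mul_self, one_mul]

lemma phaseUnitary_conj_onsite (R : Finset (Fin N)) (θ : Fin N → ℝ) (i : Fin N) :
    (phaseUnitary R θ)ᴴ * onsite i * phaseUnitary R θ = onsite i := by
  refine phaseUnitary_conj_of_commute ?_
  rw [onsite, number_eq_diagonal, number_eq_diagonal, phaseUnitary_eq_diagonal,
    Matrix.diagonal_mul_diagonal, Commute, SemiconjBy, Matrix.diagonal_mul_diagonal,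
    Matrix.diagonal_mul_diagonal]
  congr 1; ext S; ring

lemma phaseUnitary_commute_of_mem_localAlgebra {R X : Finset (Fin N)} {θ : Fin N → ℝ} {A : Op N}
    (hA : A ∈ localAlgebra X) (hX : Disjoint X R) : Commute (phaseUnitary R θ) A := by
  refine Commute.list_prod_left _ _ fun B hB => ?_
  obtain ⟨i, hi, rfl⟩ := List.mem_map.1 hB
  have hiX : i ∉ X := fun h => Finset.disjoint_left.1 hX h (Finset.mem_toList.1 hi)
  refine Commute.exp_left (Commute.smul_left (Commute.add_left ?_ ?_) _)
  · exact number_commute_of_mem_localAlgebra hA hiX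
  · exact number_commute_of_mem_localAlgebra hA hiX

lemma norm_le_one_of_conjTranspose_mul_self {U : Op N} (h : Uᴴ * U = 1) : ‖U‖ ≤ 1 := by
  have h1 : ‖U‖ * ‖U‖ ≤ 1 := by
    rw [← Matrix.l2_opNorm_conjTranspose_mul_self, h, ← Matrix.diagonal_one,
      Matrix.l2_opNorm_diagonal]
    refine (pi_norm_le_iff_of_nonneg zero_le_one).2 fun S => ?_
    simp
  nlinarith [norm_nonneg U]

lemma norm_conj_le {U : Op N} (hU : ‖U‖ ≤ 1) (A : Op N) : ‖Uᴴ * A * U‖ ≤ ‖A‖ := by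
  calc ‖Uᴴ * A * U‖ ≤ ‖Uᴴ‖ * ‖A‖ * ‖U‖ := (norm_mul_le _ _).trans (by gcongr; exact norm_mul_le _ _)
    _ ≤ 1 * ‖A‖ * 1 := by rw [Matrix.l2_opNorm_conjTranspose]; gcongr
    _ = ‖A‖ := by ring

lemma norm_phaseUnitary_le (R : Finset (Fin N)) (θ : Fin N → ℝ) : ‖phaseUnitary R θ‖ ≤ 1 :=
  norm_le_one_of_conjTranspose_mul_self (conjTranspose_phaseUnitary_mul_self R θ)

lemma continuous_phaseUnitary (R : Finset (Fin N)) : Continuous (phaseUnitary (N := N) R) := by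
  simp only [funext (phaseUnitary_eq_diagonal R)]
  refine Continuous.matrix_diagonal ?_
  fun_prop

/-- The law of the phases of one time step. -/
noncomputable abbrev stepLaw (N : ℕ) : Measure (Fin N → ℝ) := Measure.pi fun _ => uniformPhase

lemma integrable_phaseUnitary_conj (R : Finset (Fin N)) (A : Op N) :
    Integrable (fun θ => (phaseUnitary R θ)ᴴ * A * phaseUnitary R θ) (stepLaw N) := by
  refine Integrable.of_bound (C := ‖A‖) (Continuous.aestronglyMeasurable ?_)
    (Filter.Eventually.of_forall fun θ => norm_conj_le (norm_phaseUnitary_le R θ) A)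
  have := continuous_phaseUnitary R
  fun_prop

/-- The average of an operator over the random phases on the sites in `R`. -/
noncomputable def phaseAverage (R : Finset (Fin N)) (A : Op N) : Op N :=
  ∫ θ, (phaseUnitary R θ)ᴴ * A * phaseUnitary R θ ∂(stepLaw N)

lemma phaseAverage_add (R : Finset (Fin N)) (A B : Op N) :
    phaseAverage R (A + B) = phaseAverage R A + phaseAverage R B := by
  simp only [phaseAverage, mul_add, add_mul]
  exact integral_add (integrable_phaseUnitary_conj R A) (integrable_phaseUnitary_conj R B)

lemma phaseAverage_smul (R : Finset (Fin N)) (c : ℂ) (A : Op N) :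
    phaseAverage R (c • A) = c • phaseAverage R A := by
  simp only [phaseAverage, mul_smul_comm, smul_mul_assoc]
  exact integral_smul c _

/-- The average over the random phases as a linear map. -/
noncomputable def phaseAverageₗ (R : Finset (Fin N)) : Op N →ₗ[ℂ] Op N where
  toFun := phaseAverage R
  map_add' := phaseAverage_add R
  map_smul' := phaseAverage_smul R

lemma norm_phaseAverage_le (R : Finset (Fin N)) (A : Op N) : ‖phaseAverage R A‖ ≤ ‖A‖ := by
  refine (norm_integral_le_of_norm_le_const (C := ‖A‖) (Filter.Eventually.of_forall fun θ =>
    norm_conj_le (norm_phaseUnitary_le R θ) A)).trans ?_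
  simp

lemma phaseAverage_of_mem_localAlgebra {R X : Finset (Fin N)} {A : Op N}
    (hA : A ∈ localAlgebra X) (hX : Disjoint X R) : phaseAverage R A = A := by
  simp only [phaseAverage,
    phaseUnitary_conj_of_commute (phaseUnitary_commute_of_mem_localAlgebra hA hX)]
  simp

/-- The phases fix operators supported off `R`, so these can be pulled out of the average, as with a
conditional expectation. Averaging `[H, A]` thus amounts to averaging `H`. -/
lemma phaseAverage_mul_of_mem_localAlgebra {R X : Finset (Fin N)} {A : Op N}
    (hA : A ∈ localAlgebra X) (hX : Disjoint X R) (B : Op N) :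
    phaseAverage R (B * A) = phaseAverage R B * A ∧
      phaseAverage R (A * B) = A * phaseAverage R B := by
  simp only [phaseAverage, phaseUnitary_conj_mul,
    phaseUnitary_conj_of_commute (phaseUnitary_commute_of_mem_localAlgebra hA hX)]
  have hi := integrable_phaseUnitary_conj R B
  exact ⟨(ContinuousLinearMap.integral_comp_comm (μ := stepLaw N)
      ((ContinuousLinearMap.mul ℂ (Op N)).flip A) hi),
    (ContinuousLinearMap.integral_comp_comm (μ := stepLaw N)
      (ContinuousLinearMap.mul ℂ (Op N) A) hi)⟩

lemma phaseAverage_hopping (R : Finset (Fin N)) {i j : Fin N} (hij : i ≠ j) :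
    phaseAverage R (hopping i j) = if i ∉ R ∧ j ∉ R then hopping i j else 0 := by
  simp only [phaseAverage, phaseUnitary_conj_hopping]
  rw [integral_smul_const, integral_exp_sitePhase R hij]
  split_ifs <;> simp

lemma phaseAverage_hubbard (G : SimpleGraph (Fin N)) (h : Fin N → Fin N → ℝ) (ξ : Fin N → ℝ)
    (R : Finset (Fin N)) : phaseAverage R (hubbard G h ξ) =
      partialHubbard G h ξ (fun i j => i ∉ R ∧ j ∉ R) (fun _ => True) := by
  classical
  change phaseAverageₗ R (hubbard G h ξ) = _
  simp only [hubbard, partialHubbard, map_add, map_neg, map_sum, if_true]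
  congr 1
  · congr 1
    refine Finset.sum_congr rfl fun i _ => Finset.sum_congr rfl fun j _ => ?_
    by_cases hij : G.Adj i j
    · simp only [hij, if_true, true_and, map_smul]
      change (h i j : ℂ) • phaseAverage R (hopping i j) = _
      rw [phaseAverage_hopping R hij.ne]
      split_ifs <;> simp_all
    · simp [hij]
  · refine Finset.sum_congr rfl fun i _ => ?_
    rw [map_smul]
    change (ξ i : ℂ) • phaseAverage R (onsite i) = _
    simp [phaseAverage, phaseUnitary_conj_onsite]

end Phases

/-! ### The reshaping error -/

section Reshaping

open scoped Matrix.Norms.L2Operator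
open MeasureTheory

variable {N : ℕ}

/-! ### Unitary evolution and its first-order expansion -/

lemma conjTranspose_evolution {H : Op N} (hH : Hᴴ = H) (t : ℝ) :
    (NormedSpace.exp ((-(Complex.I * t)) • H))ᴴ = NormedSpace.exp ((Complex.I * t) • H) := by
  rw [← Matrix.exp_conjTranspose, Matrix.conjTranspose_smul, hH]
  simp

lemma evolution_mul (H : Op N) (s t : ℝ) :
    NormedSpace.exp ((-(Complex.I * s)) • H) * NormedSpace.exp ((-(Complex.I * t)) • H)
      = NormedSpace.exp ((-(Complex.I * (s + t : ℝ))) • H) := by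
  rw [← Matrix.exp_add_of_commute _ _ (((Commute.refl H).smul_left _).smul_right _), ← add_smul]
  congr 2; push_cast; ring

lemma evolution_mul' (H : Op N) (s t : ℝ) :
    NormedSpace.exp ((Complex.I * s) • H) * NormedSpace.exp ((Complex.I * t) • H)
      = NormedSpace.exp ((Complex.I * (s + t : ℝ)) • H) := by
  rw [← Matrix.exp_add_of_commute _ _ (((Commute.refl H).smul_left _).smul_right _), ← add_smul]
  congr 2; push_cast; ring

lemma evolution_inv_mul (H : Op N) (t : ℝ) :
    NormedSpace.exp ((Complex.I * t) • H) * NormedSpace.exp ((-(Complex.I * t)) • H) = 1 := by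
  rw [← Matrix.exp_add_of_commute _ _ (((Commute.refl H).smul_left _).smul_right _), ← add_smul]
  simp

lemma norm_evolution_le {H : Op N} (hH : Hᴴ = H) (t : ℝ) :
    ‖NormedSpace.exp ((-(Complex.I * t)) • H)‖ ≤ 1 := by
  refine norm_le_one_of_conjTranspose_mul_self ?_
  rw [conjTranspose_evolution hH, evolution_inv_mul]

lemma norm_heisenberg_le {H : Op N} (hH : Hᴴ = H) (t : ℝ) (A : Op N) :
    ‖heisenberg H t A‖ ≤ ‖A‖ := by
  rw [heisenberg, ← conjTranspose_evolution hH]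
  exact norm_conj_le (norm_evolution_le hH t) A

lemma heisenberg_add (H : Op N) (s t : ℝ) (A : Op N) :
    heisenberg H (s + t) A = heisenberg H s (heisenberg H t A) := by
  rw [heisenberg, ← evolution_mul', add_comm s t, ← evolution_mul, heisenberg, heisenberg]
  simp only [mul_assoc]

lemma heisenberg_zero (H A : Op N) : heisenberg H 0 A = A := by
  simp [heisenberg]

lemma heisenberg_mem_localAlgebra {X : Finset (Fin N)} {H A : Op N} (hH : H ∈ localAlgebra X)
    (hA : A ∈ localAlgebra X) (t : ℝ) : heisenberg H t A ∈ localAlgebra X :=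
  mul_mem (mul_mem (exp_mem_localAlgebra (Subalgebra.smul_mem _ hH _)) hA)
    (exp_mem_localAlgebra (Subalgebra.smul_mem _ hH _))

lemma hasDerivAt_heisenberg (H A : Op N) (t : ℝ) :
    HasDerivAt (fun s : ℝ => heisenberg H s A)
      (heisenberg H t (Complex.I • (H * A - A * H))) t := by
  -- The imaginary unit is moved into the operator, so that the exponent is a real multiple of a
  -- fixed operator and the derivative is taken over `ℝ`.
  have e1 : ∀ s : ℝ, (Complex.I * s) • H = s • (Complex.I • H) := fun s => by
    rw [mul_comm, mul_smul, Complex.coe_smul]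
  have e2 : ∀ s : ℝ, (-(Complex.I * s)) • H = s • (-(Complex.I • H)) := fun s => by
    rw [neg_smul, e1, smul_neg]
  have h1 := (hasDerivAt_exp_smul_const (𝕂 := ℝ) (Complex.I • H) t).mul_const A
  have h2 := hasDerivAt_exp_smul_const' (𝕂 := ℝ) (-(Complex.I • H)) t
  have h3 := h1.mul h2
  simp only [heisenberg, e1, e2]
  refine h3.congr_deriv ?_
  simp only [mul_sub, sub_mul, mul_assoc, smul_sub, mul_smul_comm, smul_mul_assoc, mul_neg, neg_mul,
    ← sub_eq_add_neg]

/-- Mean value inequality: the derivative is a unitary conjugate of `i[H, A]`, so its norm never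
exceeds that of the commutator. -/
lemma norm_heisenberg_sub_le {H : Op N} (hH : Hᴴ = H) (A : Op N) {t : ℝ} (ht : 0 ≤ t) :
    ‖heisenberg H t A - A‖ ≤ t * ‖H * A - A * H‖ := by
  have := norm_image_sub_le_of_norm_deriv_le_segment' (f := fun s : ℝ => heisenberg H s A)
    (a := 0) (b := t) (C := ‖H * A - A * H‖)
    (fun s _ => (hasDerivAt_heisenberg H A s).hasDerivWithinAt)
    (fun s _ => (norm_heisenberg_le hH _ _).trans (by rw [norm_smul]; simp)) t ⟨ht, le_rfl⟩
  rw [heisenberg_zero] at this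
  linarith

/-- The first-order approximation of the Heisenberg evolution. -/
lemma norm_heisenberg_sub_first_order_le {H : Op N} (hH : Hᴴ = H) (A : Op N) {t : ℝ}
    (ht : 0 ≤ t) :
    ‖heisenberg H t A - (A + t • Complex.I • (H * A - A * H))‖
      ≤ t ^ 2 * ‖doubleCommutator H A‖ := by
  set K := Complex.I • (H * A - A * H) with hK
  have hKn : ‖H * K - K * H‖ = ‖doubleCommutator H A‖ := by
    rw [hK, mul_smul_comm, smul_mul_assoc, ← smul_sub, norm_smul, doubleCommutator]; simp
  -- The derivative of the remainder is the deviation of the evolved `K` from `K`, to which the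
  -- first-order estimate applies again. Bounding it by its value at `t` on the whole interval loses
  -- the Taylor factor 1/2.
  have hd : ∀ s : ℝ, HasDerivAt (fun s : ℝ => heisenberg H s A - s • K)
      (heisenberg H s K - K) s := by
    intro s
    have := ((hasDerivAt_id s).smul_const K)
    simpa using! (hasDerivAt_heisenberg H A s).sub this
  have := norm_image_sub_le_of_norm_deriv_le_segment'
    (f := fun s : ℝ => heisenberg H s A - s • K)
    (a := 0) (b := t) (C := t * ‖doubleCommutator H A‖)
    (fun s _ => (hd s).hasDerivWithinAt)
    (fun s hs => (norm_heisenberg_sub_le hH K hs.1).trans (by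
      rw [hKn]; exact mul_le_mul_of_nonneg_right hs.2.le (norm_nonneg _))) t ⟨ht, le_rfl⟩
  rw [heisenberg_zero, zero_smul, sub_zero, sub_zero] at this
  calc _ = ‖heisenberg H t A - t • K - A‖ := by congr 1; abel
    _ ≤ t * ‖doubleCommutator H A‖ * t := this
    _ = _ := by ring

/-- One step of the randomised propagator. -/
noncomputable def stepPropagator (H : Op N) (R : Finset (Fin N)) (τ : ℝ) (θ : Fin N → ℝ) : Op N :=
  (phaseUnitary R θ)ᴴ * NormedSpace.exp ((-(Complex.I * τ)) • H) * phaseUnitary R θ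

/-- The propagator of `r` randomised steps of length `τ`. -/
noncomputable def stepsPropagator (H : Op N) (R : Finset (Fin N)) (τ : ℝ) {r : ℕ}
    (θ : Fin r → Fin N → ℝ) : Op N :=
  ((List.ofFn fun l => stepPropagator H R τ (θ l)).reverse).prod

lemma reshapedPropagator_eq {H : Op N} {R : Finset (Fin N)} {t : ℝ} {r : ℕ}
    (θ : Fin r → Fin N → ℝ) :
    reshapedPropagator H R t θ = stepsPropagator H R (t / r) θ := rfl

lemma stepsPropagator_succ (H : Op N) (R : Finset (Fin N)) (τ : ℝ) {r : ℕ}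
    (θ : Fin (r + 1) → Fin N → ℝ) :
    stepsPropagator H R τ θ =
      stepsPropagator H R τ (fun l => θ l.succ) * stepPropagator H R τ (θ 0) := by
  rw [stepsPropagator, List.ofFn_succ, List.reverse_cons, List.prod_append, List.prod_singleton]
  rfl

lemma continuous_stepPropagator (H : Op N) (R : Finset (Fin N)) (τ : ℝ) :
    Continuous (stepPropagator H R τ) := by
  have := continuous_phaseUnitary R
  unfold stepPropagator
  fun_prop

lemma continuous_stepsPropagator (H : Op N) (R : Finset (Fin N)) (τ : ℝ) (r : ℕ) :
    Continuous (stepsPropagator H R τ (r := r)) := by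
  induction r with
  | zero => simpa [stepsPropagator] using! continuous_const
  | succ r ih =>
    simp only [funext (stepsPropagator_succ H R τ (r := r))]
    have h1 := continuous_stepPropagator H R τ
    refine Continuous.mul (ih.comp ?_) (h1.comp ?_) <;> fun_prop

lemma stepPropagator_unitary {H : Op N} (hH : Hᴴ = H) (R : Finset (Fin N)) (τ : ℝ)
    (θ : Fin N → ℝ) : (stepPropagator H R τ θ)ᴴ * stepPropagator H R τ θ = 1 := by
  rw [stepPropagator, Matrix.conjTranspose_mul, Matrix.conjTranspose_mul,
    Matrix.conjTranspose_conjTranspose, conjTranspose_evolution hH]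
  set U := phaseUnitary R θ
  set E := NormedSpace.exp ((-(Complex.I * τ)) • H)
  set E' := NormedSpace.exp ((Complex.I * τ) • H)
  calc _ = Uᴴ * E' * (U * Uᴴ) * E * U := by simp only [mul_assoc]
    _ = Uᴴ * (E' * E) * U := by rw [phaseUnitary_mul_conjTranspose_self]; simp only [mul_assoc, mul_one]
    _ = 1 := by rw [evolution_inv_mul, mul_one, conjTranspose_phaseUnitary_mul_self]

lemma stepsPropagator_unitary {H : Op N} (hH : Hᴴ = H) (R : Finset (Fin N)) (τ : ℝ) {r : ℕ}
    (θ : Fin r → Fin N → ℝ) : (stepsPropagator H R τ θ)ᴴ * stepsPropagator H R τ θ = 1 := by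
  induction r with
  | zero => simp [stepsPropagator]
  | succ r ih =>
    rw [stepsPropagator_succ, Matrix.conjTranspose_mul, mul_assoc,
      ← mul_assoc (stepsPropagator H R τ fun l => θ l.succ)ᴴ, ih, one_mul,
      stepPropagator_unitary hH]

lemma norm_stepPropagator_le {H : Op N} (hH : Hᴴ = H) (R : Finset (Fin N)) (τ : ℝ)
    (θ : Fin N → ℝ) : ‖stepPropagator H R τ θ‖ ≤ 1 :=
  norm_le_one_of_conjTranspose_mul_self (stepPropagator_unitary hH R τ θ)

lemma norm_stepsPropagator_le {H : Op N} (hH : Hᴴ = H) (R : Finset (Fin N)) (τ : ℝ) {r : ℕ}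
    (θ : Fin r → Fin N → ℝ) : ‖stepsPropagator H R τ θ‖ ≤ 1 :=
  norm_le_one_of_conjTranspose_mul_self (stepsPropagator_unitary hH R τ θ)

lemma integrable_conj_of_continuous {α : Type*} [TopologicalSpace α] [MeasurableSpace α]
    [OpensMeasurableSpace α] [SecondCountableTopology α] {μ : Measure α} [IsFiniteMeasure μ]
    {U : α → Op N} (hc : Continuous U) (hU : ∀ x, ‖U x‖ ≤ 1) (A : Op N) :
    Integrable (fun x => (U x)ᴴ * A * U x) μ := by
  refine Integrable.of_bound (C := ‖A‖) (Continuous.aestronglyMeasurable ?_)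
    (Filter.Eventually.of_forall fun θ => norm_conj_le (hU θ) A)
  fun_prop

/-- The average of the Heisenberg evolution over one randomised step. -/
noncomputable def averagedStep (H : Op N) (R : Finset (Fin N)) (τ : ℝ) (A : Op N) : Op N :=
  ∫ θ, (stepPropagator H R τ θ)ᴴ * A * stepPropagator H R τ θ ∂(stepLaw N)

/-- The average of the Heisenberg evolution over `r` randomised steps. -/
noncomputable def averagedSteps (H : Op N) (R : Finset (Fin N)) (τ : ℝ) (r : ℕ) (A : Op N) : Op N :=
  ∫ θ : Fin r → Fin N → ℝ,
    (stepsPropagator H R τ θ)ᴴ * A * stepsPropagator H R τ θ ∂(phaseLaw N r)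

lemma integral_op_apply {α : Type*} [MeasurableSpace α] {μ : Measure α} {f : α → Op N}
    (hf : Integrable f μ) (S T : Finset (Mode N)) : (∫ x, f x ∂μ) S T = ∫ x, f x S T ∂μ := by
  let L : Op N →ₗ[ℂ] ℂ := Matrix.entryLinearMap ℂ ℂ S T
  exact (ContinuousLinearMap.integral_comp_comm (LinearMap.toContinuousLinearMap L) hf).symm

/-- The entrywise integral agrees with a Bochner integral of operators, for which norm estimates and
linear maps are available. -/
lemma reshapedHeisenberg_eq {H : Op N} (hH : Hᴴ = H) (R : Finset (Fin N)) (t : ℝ) (r : ℕ)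
    (A : Op N) : reshapedHeisenberg H R t r A = averagedSteps H R (t / r) r A := by
  ext S T
  rw [averagedSteps, integral_op_apply
    (integrable_conj_of_continuous (continuous_stepsPropagator H R _ r)
      (norm_stepsPropagator_le hH R _) A)]
  rfl

/-- Step `0` acts first on states, so it stands rightmost in the propagator and outermost in the
Heisenberg picture. Its phases are independent of the others, and Fubini lets the later steps be
averaged first. -/
lemma averagedSteps_succ {H : Op N} (hH : Hᴴ = H) (R : Finset (Fin N)) (τ : ℝ) (r : ℕ)
    (A : Op N) :
    averagedSteps H R τ (r + 1) A = averagedStep H R τ (averagedSteps H R τ r A) := by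
  have hmp := (measurePreserving_piFinSuccAbove (fun _ : Fin (r + 1) => stepLaw N) 0).symm
  have hint := integrable_conj_of_continuous (μ := phaseLaw N (r + 1))
    (continuous_stepsPropagator H R τ (r + 1)) (norm_stepsPropagator_le hH R τ) A
  have hint' := (hmp.integrable_comp_emb (MeasurableEquiv.measurableEmbedding _)).2 hint
  rw [averagedSteps]
  change ∫ θ, _ ∂(Measure.pi fun _ : Fin (r + 1) => stepLaw N) = _
  rw [← hmp.integral_comp', averagedStep]
  refine (integral_prod _ hint').trans ?_
  refine integral_congr_ae (Filter.Eventually.of_forall fun a => ?_)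
  have hi := integrable_conj_of_continuous (μ := phaseLaw N r)
    (continuous_stepsPropagator H R τ r) (norm_stepsPropagator_le hH R τ) A
  set V := stepPropagator H R τ a with hV
  let L : Op N →L[ℂ] Op N := (ContinuousLinearMap.mul ℂ (Op N) Vᴴ).comp
    ((ContinuousLinearMap.mul ℂ (Op N)).flip V)
  have hL := ContinuousLinearMap.integral_comp_comm L hi
  have hLapp : ∀ B, L B = Vᴴ * B * V := fun B => (mul_assoc _ _ _).symm
  simp only [hLapp] at hL
  refine Eq.trans ?_ hL
  refine integral_congr_ae (Filter.Eventually.of_forall fun b => ?_)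
  simp only [stepsPropagator_succ, Matrix.conjTranspose_mul]
  have e0 : ((MeasurableEquiv.piFinSuccAbove (fun _ : Fin (r + 1) => Fin N → ℝ) 0).symm (a, b)) 0
      = a := rfl
  have e1 : ∀ l : Fin r, ((MeasurableEquiv.piFinSuccAbove
      (fun _ : Fin (r + 1) => Fin N → ℝ) 0).symm (a, b)) l.succ = b l := fun l => rfl
  simp only [Function.comp_apply, e0, e1, mul_assoc, hV]

/-- Neither unitary conjugation nor averaging increases norms: errors from other steps are carried
along without amplification. -/
lemma norm_averagedStep_sub_le {H : Op N} (hH : Hᴴ = H) (R : Finset (Fin N)) (τ : ℝ)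
    (A B : Op N) : ‖averagedStep H R τ A - averagedStep H R τ B‖ ≤ ‖A - B‖ := by
  have hc := continuous_stepPropagator H R τ
  have hn := norm_stepPropagator_le hH R τ
  rw [averagedStep, averagedStep, ← integral_sub (integrable_conj_of_continuous hc hn A)
    (integrable_conj_of_continuous hc hn B)]
  refine (norm_integral_le_of_norm_le_const (C := ‖A - B‖) (Filter.Eventually.of_forall fun θ =>
    ?_)).trans (by simp)
  rw [← sub_mul, ← mul_sub]
  exact norm_conj_le (hn θ) _

/-- The phases act off the support of `A`, so the inner pair `U A U†` collapses to `A` and only the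
outer conjugation remains. -/
lemma averagedStep_eq_phaseAverage {H : Op N} (hH : Hᴴ = H) {R X : Finset (Fin N)} (τ : ℝ)
    {A : Op N} (hA : A ∈ localAlgebra X) (hX : Disjoint X R) :
    averagedStep H R τ A = phaseAverage R (heisenberg H τ A) := by
  rw [averagedStep, phaseAverage]
  refine integral_congr_ae (Filter.Eventually.of_forall fun θ => ?_)
  have hc := phaseUnitary_commute_of_mem_localAlgebra (θ := θ) hA hX
  simp only [stepPropagator, heisenberg, Matrix.conjTranspose_mul,
    Matrix.conjTranspose_conjTranspose, conjTranspose_evolution hH]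
  set U := phaseUnitary R θ with hU
  set E := NormedSpace.exp ((-(Complex.I * τ)) • H)
  set E' := NormedSpace.exp ((Complex.I * τ) • H)
  calc _ = Uᴴ * E' * (U * A) * Uᴴ * E * U := by simp only [mul_assoc]
    _ = Uᴴ * E' * A * (U * Uᴴ) * E * U := by rw [hc.eq]; simp only [mul_assoc]
    _ = _ := by rw [phaseUnitary_mul_conjTranspose_self]; simp only [mul_assoc, one_mul]

variable {G : SimpleGraph (Fin N)} {h : Fin N → Fin N → ℝ} {ξ : Fin N → ℝ} {d : ℕ}
  {X R : Finset (Fin N)}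

/-- The Hamiltonian restricted to the sites in `X`. -/
noncomputable abbrev restrictedHubbard (G : SimpleGraph (Fin N)) (h : Fin N → Fin N → ℝ)
    (ξ : Fin N → ℝ) (X : Finset (Fin N)) : Op N :=
  partialHubbard G h ξ (fun i j => i ∈ X ∧ j ∈ X) (fun i => i ∈ X)

lemma isHermitian_hubbard (hsymm : ∀ i j, G.Adj i j → h i j = h j i) :
    (hubbard G h ξ)ᴴ = hubbard G h ξ := by
  rw [hubbard_eq_partialHubbard]
  exact isHermitian_partialHubbard hsymm fun _ _ h => h

/-- The two evolutions agree through first order after averaging, which leaves two second-order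
remainders. The hypothesis `hR` is what the colouring provides: no site of `X` has an unrandomised
neighbour outside `X`. -/
lemma norm_averagedStep_sub_heisenberg_le (hdeg : ∀ i, (G.neighborSet i).ncard ≤ d)
    (hsymm : ∀ i j, G.Adj i j → h i j = h j i)
    (hh : ∀ i j, G.Adj i j → |h i j| ≤ 1) (hξ : ∀ i, |ξ i| ≤ 1) (hX : X.card ≤ 2)
    (hXR : Disjoint X R) (hR : ∀ i j, G.Adj i j → i ∈ X → j ∉ R → j ∈ X) {τ : ℝ} (hτ : 0 ≤ τ)
    {A : Op N} (hA : A ∈ localAlgebra X) :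
    ‖averagedStep (hubbard G h ξ) R τ A - heisenberg (restrictedHubbard G h ξ X) τ A‖
      ≤ 2 * stepConstant d * τ ^ 2 * ‖A‖ := by
  have hH := isHermitian_hubbard (ξ := ξ) hsymm
  have hH' : (restrictedHubbard G h ξ X)ᴴ = restrictedHubbard G h ξ X :=
    isHermitian_partialHubbard hsymm fun _ _ h => ⟨h.2, h.1⟩
  set H := hubbard G h ξ with hHdef
  set H' := restrictedHubbard G h ξ X
  have hfirst : phaseAverage R (A + τ • Complex.I • (H * A - A * H))
      = A + τ • Complex.I • (H' * A - A * H') := by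
    have hmul := phaseAverage_mul_of_mem_localAlgebra hA hXR H
    change phaseAverageₗ R _ = _
    rw [← Complex.coe_smul τ, ← Complex.coe_smul τ]
    simp only [map_add, map_smul, map_sub]
    change phaseAverage R A + (τ : ℂ) • Complex.I • (phaseAverage R (H * A)
      - phaseAverage R (A * H)) = _
    rw [phaseAverage_of_mem_localAlgebra hA hXR, hmul.1, hmul.2, hHdef, phaseAverage_hubbard]
    congr 3
    -- Among the hopping terms touching `X`, those surviving the average are exactly those inside
    -- `X`; on-site terms away from `X` survive too but commute with `A`.
    refine commutator_eq_of_sub_commute (partialHubbard_sub_commute hA ?_ (by simp_all))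
    intro i j hij hiX
    have hn : ∀ k ∈ X, k ∉ R := fun k hk => Finset.disjoint_left.1 hXR hk
    constructor
    · rintro ⟨hi, hj⟩
      rcases hiX with hiX | hjX
      · exact ⟨hiX, hR i j hij hiX hj⟩
      · exact ⟨hR j i hij.symm hjX hi, hjX⟩
    · exact fun ⟨hi, hj⟩ => ⟨hn i hi, hn j hj⟩
  have h1 := norm_heisenberg_sub_first_order_le hH A hτ
  have h2 := norm_heisenberg_sub_first_order_le hH' A hτ
  have h3 := norm_doubleCommutator_hubbard_le hdeg hh hξ hX hA
  have h4 := norm_doubleCommutator_partialHubbard_le hdeg hh hξ hX A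
  rw [averagedStep_eq_phaseAverage hH τ hA hXR]
  have hsplit : phaseAverage R (heisenberg H τ A) - heisenberg H' τ A =
      phaseAverage R (heisenberg H τ A - (A + τ • Complex.I • (H * A - A * H)))
      - (heisenberg H' τ A - (A + τ • Complex.I • (H' * A - A * H'))) := by
    rw [← hfirst]
    change phaseAverageₗ R _ - _ = phaseAverageₗ R _ - (_ - phaseAverageₗ R _)
    rw [map_sub]
    abel
  rw [hsplit]
  calc _ ≤ τ ^ 2 * (stepConstant d * ‖A‖) + τ ^ 2 * (stepConstant d * ‖A‖) := by
        refine (norm_sub_le _ _).trans (add_le_add ?_ ?_)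
        · exact (norm_phaseAverage_le _ _).trans (h1.trans (by gcongr))
        · exact h2.trans (by gcongr)
    _ = _ := by ring

lemma stepConstant_pos (d : ℕ) : 0 < stepConstant d := by unfold stepConstant; positivity

/-- The one-step errors add up: each new step contributes one error of order `τ²`, and the
contraction property carries the old error unchanged. -/
lemma norm_averagedSteps_sub_heisenberg_le (hdeg : ∀ i, (G.neighborSet i).ncard ≤ d)
    (hsymm : ∀ i j, G.Adj i j → h i j = h j i)
    (hh : ∀ i j, G.Adj i j → |h i j| ≤ 1) (hξ : ∀ i, |ξ i| ≤ 1) (hX : X.card ≤ 2)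
    (hXR : Disjoint X R) (hR : ∀ i j, G.Adj i j → i ∈ X → j ∉ R → j ∈ X) {τ : ℝ} (hτ : 0 ≤ τ)
    {A : Op N} (hA : A ∈ localAlgebra X) (r : ℕ) :
    ‖averagedSteps (hubbard G h ξ) R τ r A - heisenberg (restrictedHubbard G h ξ X) (r * τ) A‖
      ≤ r * (2 * stepConstant d * τ ^ 2 * ‖A‖) := by
  have hH' : (restrictedHubbard G h ξ X)ᴴ = restrictedHubbard G h ξ X :=
    isHermitian_partialHubbard hsymm fun _ _ h => ⟨h.2, h.1⟩
  have hmem : restrictedHubbard G h ξ X ∈ localAlgebra X :=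
    partialHubbard_mem_localAlgebra (fun _ _ _ h => h) fun _ h => h
  induction r with
  | zero => simp [averagedSteps, stepsPropagator, heisenberg_zero]
  | succ r ih =>
    -- The one-step estimate is applied to the ideal operator `B`, not to the averaged one: the
    -- restricted evolution keeps `B` in `localAlgebra X`, whereas the true evolution may spread
    -- beyond `X`.
    set B := heisenberg (restrictedHubbard G h ξ X) (r * τ) A
    have hB : B ∈ localAlgebra X := heisenberg_mem_localAlgebra hmem hA _
    have hBn : ‖B‖ ≤ ‖A‖ := norm_heisenberg_le hH' _ _
    have hH := isHermitian_hubbard (ξ := ξ) hsymm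
    have e : ((r + 1 : ℕ) : ℝ) * τ = τ + r * τ := by push_cast; ring
    have h1 := norm_averagedStep_sub_le hH R τ (averagedSteps (hubbard G h ξ) R τ r A) B
    have h2 := norm_averagedStep_sub_heisenberg_le hdeg hsymm hh hξ hX hXR hR hτ hB
    have h3 : 2 * stepConstant d * τ ^ 2 * ‖B‖ ≤ 2 * stepConstant d * τ ^ 2 * ‖A‖ := by
      have := stepConstant_pos d
      gcongr
    rw [averagedSteps_succ hH, e, heisenberg_add]
    refine (norm_sub_le_norm_sub_add_norm_sub _ (averagedStep (hubbard G h ξ) R τ B) _).trans ?_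
    push_cast
    linarith

end Reshaping

/-! ### Admissible step numbers -/

section Admissible

open scoped Matrix.Norms.L2Operator

variable {N χ d : ℕ} {G : SimpleGraph (Fin N)} (A : ColouredEdges G χ)
  {h : Fin N → Fin N → ℝ} {ξ : Fin N → ℝ}

namespace ColouredEdges

lemma adj (C : G.edgeSet) : G.Adj (A.k₁ C) (A.k₂ C) := by
  have := C.2
  rwa [A.ends C, SimpleGraph.mem_edgeSet] at this

/-- The sites of the measured subsystem. -/
def localSites (C : G.edgeSet) : Pass → Finset (Fin N)
  | .hop => {A.k₁ C, A.k₂ C}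
  | .site₁ => {A.k₁ C}
  | .site₂ => {A.k₂ C}

variable {A}

lemma mem_edge_of_mem_localSites {C : G.edgeSet} {p : Pass} {i : Fin N}
    (hi : i ∈ A.localSites C p) : i ∈ (C : Sym2 (Fin N)) := by
  rw [A.ends C, Sym2.mem_iff]
  cases p <;> simp_all [localSites]

lemma card_localSites_le (C : G.edgeSet) (p : Pass) : (A.localSites C p).card ≤ 2 := by
  cases p
  · exact Finset.card_le_two
  · simp [localSites]
  · simp [localSites]

/-- If the end points are adjacent, the edge joining them shares a vertex with both, which is the
second kind of conflict. So different edges of a colour neither meet nor are joined by an edge. -/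
lemma eq_of_colour_eq {C C' : G.edgeSet} (hc : A.colour C = A.colour C') {i j : Fin N}
    (hi : i ∈ (C : Sym2 (Fin N))) (hj : j ∈ (C' : Sym2 (Fin N))) (hij : i = j ∨ G.Adj i j) :
    C = C' := by
  by_contra hne
  refine A.colour.valid (v := C) (w := C') ?_ hc
  rw [edgeConflictGraph, SimpleGraph.fromRel_adj]
  refine ⟨hne, Or.inl ?_⟩
  rcases hij with rfl | hij
  · exact Or.inl ⟨i, hi, hj⟩
  · exact Or.inr ⟨⟨s(i, j), hij⟩, ⟨i, hi, Sym2.mem_mk_left i j⟩, ⟨j, hj, Sym2.mem_mk_right i j⟩⟩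

lemma disjoint_localSites {C C' : G.edgeSet} (hc : A.colour C = A.colour C') (hne : C ≠ C')
    (p : Pass) : Disjoint (A.localSites C p) (A.localSites C' p) :=
  Finset.disjoint_left.2 fun _ hi hi' => hne (eq_of_colour_eq hc (mem_edge_of_mem_localSites hi)
    (mem_edge_of_mem_localSites hi') (Or.inl rfl))

lemma notMem_randomSites {c : Fin χ} {p : Pass} {i : Fin N} :
    i ∉ randomSites A c p ↔ ∃ C : ColourClass A c, i ∈ A.localSites C.1 p := by
  cases p <;> simp [randomSites, localSites]
  exact exists_congr fun _ => exists_congr fun _ => by tauto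

lemma disjoint_randomSites (C : G.edgeSet) (p : Pass) :
    Disjoint (A.localSites C p) (randomSites A (A.colour C) p) :=
  Finset.disjoint_left.2 fun _ hi => notMem_randomSites.2 ⟨⟨C, rfl⟩, hi⟩

/-- This is the hypothesis `hR` of the reshaping estimate: an unrandomised neighbour belongs to an
edge of the same colour, which must then be `C` itself. -/
lemma mem_localSites_of_adj {C : G.edgeSet} {p : Pass} {i j : Fin N} (hij : G.Adj i j)
    (hi : i ∈ A.localSites C p) (hj : j ∉ randomSites A (A.colour C) p) :
    j ∈ A.localSites C p := by
  obtain ⟨⟨C', hC'⟩, hj⟩ := notMem_randomSites.1 hj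
  have : C = C' := eq_of_colour_eq hC'.symm (mem_edge_of_mem_localSites hi)
    (mem_edge_of_mem_localSites hj) (Or.inr hij)
  rwa [this]

end ColouredEdges

open ColouredEdges

lemma restrictedHubbard_eq_sum (X : Finset (Fin N)) [DecidableRel G.Adj] :
    restrictedHubbard G h ξ X =
      -(∑ i ∈ X, ∑ j ∈ X, if G.Adj i j then (h i j : ℂ) • hopping i j else 0)
        + ∑ i ∈ X, (ξ i : ℂ) • onsite i := by
  classical
  rw [restrictedHubbard, partialHubbard]
  congr 1
  · congr 1
    rw [← Finset.sum_subset (Finset.subset_univ X)]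
    · refine Finset.sum_congr rfl fun i hi => ?_
      rw [← Finset.sum_subset (Finset.subset_univ X)]
      · refine Finset.sum_congr rfl fun j hj => ?_
        simp [hi, hj]
      · intro j _ hj
        simp [hj]
    · intro i _ hi
      simp [hi]
  · rw [← Finset.sum_subset (Finset.subset_univ X)]
    · exact Finset.sum_congr rfl fun i hi => if_pos hi
    · exact fun i _ hi => if_neg hi

/-- The symmetry of `h` matters because the restricted sum contains both orders of the edge, and
`localHamiltonian` uses one coefficient for both. -/
lemma localHamiltonian_eq_restrictedHubbard (hsymm : ∀ i j, G.Adj i j → h i j = h j i)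
    (C : G.edgeSet) (p : Pass) :
    localHamiltonian A h ξ C p = restrictedHubbard G h ξ (A.localSites C p) := by
  classical
  rw [restrictedHubbard_eq_sum]
  cases p
  · have hadj := A.adj C
    simp only [localSites, localHamiltonian, Finset.sum_pair hadj.ne, SimpleGraph.irrefl, hadj,
      hadj.symm, if_true, if_false, hsymm _ _ hadj.symm, smul_add, zero_add, add_zero]
    rw [add_assoc]
  · simp [localSites, localHamiltonian]
  · simp [localSites, localHamiltonian]

lemma createPair_mem_localAlgebra {X : Finset (Fin N)} {i : Fin N} (hi : i ∈ X) (z : ℂ) :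
    createPair i z ∈ localAlgebra X :=
  Subalgebra.smul_mem _ (add_mem (one_mem _) (Subalgebra.smul_mem _
    (mul_mem (create_mem_localAlgebra hi) (create_mem_localAlgebra hi)) _)) _

lemma localCreate_mem_localAlgebra (C : G.edgeSet) (p : Pass) (q : Quadrature) :
    localCreate A C p q ∈ localAlgebra (A.localSites C p) := by
  have h1 : A.k₁ C ∈ A.localSites C .hop := by simp [localSites]
  have h2 : A.k₂ C ∈ A.localSites C .hop := by simp [localSites]
  cases p <;> cases q
  · exact create_mem_localAlgebra h1
  · exact add_mem (Subalgebra.smul_mem _ (create_mem_localAlgebra h1) _)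
      (Subalgebra.smul_mem _ (create_mem_localAlgebra h2) _)
  all_goals exact createPair_mem_localAlgebra (by simp [localSites]) _

lemma emptySite_mem_localAlgebra {X : Finset (Fin N)} {i : Fin N} (hi : i ∈ X) :
    emptySite i ∈ localAlgebra X :=
  mul_mem (sub_mem (one_mem _) (number_mem_localAlgebra hi))
    (sub_mem (one_mem _) (number_mem_localAlgebra hi))

lemma localVacuum_mem_localAlgebra (C : G.edgeSet) (p : Pass) :
    localVacuum A C p ∈ localAlgebra (A.localSites C p) := by
  cases p
  · exact mul_mem (emptySite_mem_localAlgebra (by simp [localSites]))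
      (emptySite_mem_localAlgebra (by simp [localSites]))
  · exact emptySite_mem_localAlgebra (by simp [localSites])
  · exact emptySite_mem_localAlgebra (by simp [localSites])

lemma localObservable_mem_localAlgebra (C : G.edgeSet) (p : Pass) :
    localObservable A p C ∈ localAlgebra (A.localSites C p) :=
  mul_mem (mul_mem (localCreate_mem_localAlgebra A C p _) (localVacuum_mem_localAlgebra A C p))
    (conjTranspose_mem_localAlgebra (localCreate_mem_localAlgebra A C p _))

lemma norm_emptySite_le (i : Fin N) : ‖emptySite i‖ ≤ 1 := by
  refine norm_mul_le_one ?_ ?_ <;>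
  · rw [number_eq_diagonal, ← Matrix.diagonal_one, Matrix.diagonal_sub, Matrix.l2_opNorm_diagonal]
    refine (pi_norm_le_iff_of_nonneg zero_le_one).2 fun S => ?_
    split_ifs <;> simp

lemma norm_one_le : ‖(1 : Op N)‖ ≤ 1 :=
  norm_le_one_of_conjTranspose_mul_self (by simp)

lemma norm_createPair_one_le (i : Fin N) : ‖createPair i 1‖ ≤ Real.sqrt 2 := by
  have h1 : ‖(1 : Op N) + (1 : ℂ) • (create (up i) * create (dn i))‖ ≤ 2 := by
    refine (norm_add_le _ _).trans ?_
    have := norm_mul_le_one (norm_create_le (up i)) (norm_create_le (dn i))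
    have := norm_one_le (N := N)
    rw [one_smul]; linarith
  rw [createPair, norm_smul, norm_div, norm_one, Complex.norm_real,
    Real.norm_of_nonneg (Real.sqrt_nonneg 2)]
  calc _ ≤ 1 / Real.sqrt 2 * 2 := by gcongr
    _ = Real.sqrt 2 := by
      have h2 : (0 : ℝ) < Real.sqrt 2 := by positivity
      rw [div_mul_eq_mul_div, one_mul, div_eq_iff h2.ne', Real.mul_self_sqrt (by norm_num)]

/-- Submultiplicativity gives 2. The value affects only the constant in the step numbers, so the
projector property is not needed here. -/
lemma norm_localObservable_le (C : G.edgeSet) (p : Pass) : ‖localObservable A p C‖ ≤ 2 := by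
  have hs : 1 ≤ Real.sqrt 2 := Real.one_le_sqrt.2 (by norm_num)
  have ha : ‖localCreate A C p .cosine‖ ≤ Real.sqrt 2 := by
    cases p
    · exact (norm_create_le _).trans hs
    · exact norm_createPair_one_le _
    · exact norm_createPair_one_le _
  have hV : ‖localVacuum A C p‖ ≤ 1 := by
    cases p
    · exact norm_mul_le_one (norm_emptySite_le _) (norm_emptySite_le _)
    · exact norm_emptySite_le _
    · exact norm_emptySite_le _
  calc _ ≤ ‖localCreate A C p .cosine‖ * ‖localVacuum A C p‖ * ‖(localCreate A C p .cosine)ᴴ‖ :=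
        (norm_mul_le _ _).trans (by gcongr; exact norm_mul_le _ _)
    _ ≤ Real.sqrt 2 * 1 * Real.sqrt 2 := by rw [Matrix.l2_opNorm_conjTranspose]; gcongr
    _ = 2 := by rw [mul_one, Real.mul_self_sqrt (by norm_num)]

lemma evolutionTime_nonneg (j : ℕ) (p : Pass) : 0 ≤ evolutionTime j p := by
  cases p <;> simp only [evolutionTime] <;> positivity

lemma evolutionTime_le (j : ℕ) (p : Pass) : evolutionTime j p ≤ 2 ^ j := by
  have : (0 : ℝ) ≤ 2 ^ j := by positivity
  cases p <;> simp only [evolutionTime] <;> linarith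

lemma reshapingError_le (hdeg : ∀ i, (G.neighborSet i).ncard ≤ d)
    (hsymm : ∀ i j, G.Adj i j → h i j = h j i)
    (hh : ∀ i j, G.Adj i j → |h i j| ≤ 1) (hξ : ∀ i, |ξ i| ≤ 1) (p : Pass) (j : ℕ) {r : ℕ}
    (hr : 0 < r) (C : G.edgeSet) :
    reshapingError A h ξ p j r C ≤ 4 * stepConstant d * (2 ^ j) ^ 2 / r := by
  have hr' : (0 : ℝ) < r := by exact_mod_cast hr
  have ht := evolutionTime_nonneg j p
  have key := norm_averagedSteps_sub_heisenberg_le hdeg hsymm hh hξ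
    (A.card_localSites_le C p) (disjoint_randomSites C p)
    (fun i j hij hi hj => mem_localSites_of_adj hij hi hj)
    (div_nonneg ht hr'.le) (localObservable_mem_localAlgebra A C p) r
  rw [mul_div_cancel₀ _ hr'.ne'] at key
  rw [reshapingError, reshapedHeisenberg_eq (isHermitian_hubbard hsymm),
    localHamiltonian_eq_restrictedHubbard A hsymm]
  refine key.trans ?_
  have hM := stepConstant_pos d
  calc _ ≤ (r : ℝ) * (2 * stepConstant d * (2 ^ j / r) ^ 2 * 2) := by
        gcongr
        · exact evolutionTime_le j p
        · exact norm_localObservable_le A C p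
    _ = _ := by field_simp; ring

lemma reshapingTolerance_pos : 0 < (Real.sqrt 3 / 2 - 2 / 3) / 4 := by
  have : 4 / 3 < Real.sqrt 3 := Real.lt_sqrt_of_sq_lt (by norm_num)
  linarith

/-- The constant in the number of time steps. -/
noncomputable def stepsConstant (d : ℕ) : ℝ :=
  4 * stepConstant d / ((Real.sqrt 3 / 2 - 2 / 3) / 4)

lemma stepsConstant_pos (d : ℕ) : 0 < stepsConstant d :=
  div_pos (mul_pos four_pos (stepConstant_pos d)) reshapingTolerance_pos

lemma stepsAdmissible_ceil (hdeg : ∀ i, (G.neighborSet i).ncard ≤ d)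
    (hsymm : ∀ i j, G.Adj i j → h i j = h j i)
    (hh : ∀ i j, G.Adj i j → |h i j| ≤ 1) (hξ : ∀ i, |ξ i| ≤ 1) (J : ℕ) :
    StepsAdmissible A h ξ J fun j => ⌈stepsConstant d * (2 ^ j) ^ 2⌉₊ := by
  intro j _
  have hK := stepsConstant_pos d
  have hpos : 0 < stepsConstant d * (2 ^ j) ^ 2 := by positivity
  have hr : 0 < ⌈stepsConstant d * (2 ^ j) ^ 2⌉₊ := Nat.ceil_pos.2 hpos
  refine ⟨hr, fun p C => (reshapingError_le A hdeg hsymm hh hξ p j hr C).trans ?_⟩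
  have hδ := reshapingTolerance_pos
  rw [div_le_iff₀ (by exact_mod_cast hr)]
  calc 4 * stepConstant d * (2 ^ j) ^ 2
      = (Real.sqrt 3 / 2 - 2 / 3) / 4 * (stepsConstant d * (2 ^ j) ^ 2) := by
        rw [stepsConstant, ← mul_assoc, mul_div_cancel₀ _ hδ.ne']
    _ ≤ _ := mul_le_mul_of_nonneg_left (Nat.le_ceil _) hδ.le

end Admissible

/-! ### Local signals -/

section LocalSignals

open scoped Matrix.Norms.L2Operator

variable {N : ℕ}

/-- Eigenvectors are encoded as operators of the form (creation operators) times a vacuum projector.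
This solves the local dynamics inside the full Fock space, without a tensor factorisation. -/
lemma exp_mul_of_eigen {H B : Op N} {l : ℂ} (hHB : H * B = l • B) (c : ℂ) :
    NormedSpace.exp (c • H) * B = Complex.exp (c * l) • B := by
  have hpow : ∀ n : ℕ, H ^ n * B = l ^ n • B := by
    intro n
    induction n with
    | zero => simp
    | succ n ih => rw [pow_succ', mul_assoc, ih, mul_smul_comm, hHB, smul_smul, pow_succ]
  have h1 := (NormedSpace.exp_series_hasSum_exp' (𝕂 := ℂ) (c • H)).mul_right B
  have h2 := (NormedSpace.exp_series_hasSum_exp' (𝕂 := ℂ) (c * l)).smul_const B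
  rw [← Complex.exp_eq_exp_ℂ] at h2
  refine h1.unique (h2.congr_fun ?_)
  intro n
  rw [smul_mul_assoc, smul_pow, smul_mul_assoc, hpow, smul_smul, smul_smul, smul_eq_mul, mul_pow, mul_assoc]

lemma number_mul_of_annihilate {m : Mode N} {V : Op N} (h : annihilate m * V = 0) :
    number m * V = 0 := by rw [number, mul_assoc, h, mul_zero]

lemma annihilate_mul_create_mul_self {m : Mode N} {V : Op N} (h : annihilate m * V = 0) :
    annihilate m * (create m * V) = V := by
  rw [← mul_assoc, annihilate_mul_create_self, sub_mul, number_mul_of_annihilate h, one_mul,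
    sub_zero]

lemma annihilate_mul_create_mul {m m' : Mode N} (hm : m ≠ m') {V : Op N}
    (h : annihilate m * V = 0) : annihilate m * (create m' * V) = 0 := by
  rw [← mul_assoc, annihilate_mul_create hm, neg_mul, mul_assoc, h, mul_zero, neg_zero]

section Hopping

variable {i j : Fin N} {V : Op N}

lemma hopping_mul_create_up (hi : annihilate (up i) * V = 0)
    (hi' : annihilate (dn i) * V = 0) :
    hopping j i * (create (up i) * V) = create (up j) * V := by
  rw [hopping, add_mul, mul_assoc, mul_assoc, annihilate_mul_create_mul_self hi,
    annihilate_mul_create_mul (up_ne_dn _ _).symm hi', mul_zero, add_zero]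

lemma hopping_mul_create_up_eq_zero (hij : i ≠ j) (hj : annihilate (up j) * V = 0)
    (hj' : annihilate (dn j) * V = 0) : hopping i j * (create (up i) * V) = 0 := by
  rw [hopping, add_mul, mul_assoc, mul_assoc, annihilate_mul_create_mul (up_ne_up hij.symm) hj,
    annihilate_mul_create_mul (up_ne_dn _ _).symm hj', mul_zero, mul_zero, add_zero]

lemma onsite_mul_create_up (k : Fin N) (hk : annihilate (dn k) * V = 0) :
    onsite k * (create (up i) * V) = 0 := by
  rw [onsite, mul_assoc,
    number_mul_of_annihilate (annihilate_mul_create_mul (up_ne_dn _ _).symm hk), mul_zero]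

/-- The Hamiltonian of an edge exchanges its two spin-up states. -/
lemma edgeHamiltonian_mul_create_up (hij : i ≠ j)
    (hV : ∀ m : Mode N, (m.site = i ∨ m.site = j) → annihilate m * V = 0) (h x y : ℂ) :
    (-(h • (hopping i j + hopping j i)) + x • onsite i + y • onsite j) * (create (up i) * V)
        = -h • (create (up j) * V) ∧
      (-(h • (hopping i j + hopping j i)) + x • onsite i + y • onsite j) * (create (up j) * V)
        = -h • (create (up i) * V) := by
  have hi := hV (up i) (Or.inl rfl)
  have hi' := hV (dn i) (Or.inl rfl)
  have hj := hV (up j) (Or.inr rfl)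
  have hj' := hV (dn j) (Or.inr rfl)
  simp only [add_mul, neg_mul, smul_mul_assoc, onsite_mul_create_up i hi',
    onsite_mul_create_up j hj', hopping_mul_create_up hi hi',
    hopping_mul_create_up hj hj', hopping_mul_create_up_eq_zero hij hj hj',
    hopping_mul_create_up_eq_zero hij.symm hi hi', smul_zero, add_zero, zero_add, neg_smul, and_self]

/-- The symmetric and antisymmetric spin-up states of the edge are eigenvectors with eigenvalues
`-h` and `h`. The interactions drop out because no spin-down particle is present. -/
lemma exp_edgeHamiltonian_mul (hij : i ≠ j)
    (hV : ∀ m : Mode N, (m.site = i ∨ m.site = j) → annihilate m * V = 0) (h x y c α β : ℂ) :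
    NormedSpace.exp (c • (-(h • (hopping i j + hopping j i)) + x • onsite i + y • onsite j))
        * ((α • create (up i) + β • create (up j)) * V) =
      ((α + β) / 2 * Complex.exp (-(c * h)))
          • (create (up i) * V + create (up j) * V)
        + ((α - β) / 2 * Complex.exp (c * h))
          • (create (up i) * V - create (up j) * V) := by
  obtain ⟨h1, h2⟩ := edgeHamiltonian_mul_create_up hij hV h x y
  set H := -(h • (hopping i j + hopping j i)) + x • onsite i + y • onsite j
  have e1 : H * (create (up i) * V + create (up j) * V)
      = (-h) • (create (up i) * V + create (up j) * V) := by
    rw [mul_add, h1, h2, smul_add, add_comm]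
  have e2 : H * (create (up i) * V - create (up j) * V)
      = h • (create (up i) * V - create (up j) * V) := by
    rw [mul_sub, h1, h2, smul_sub, neg_smul, neg_smul]; abel
  have hsplit : (α • create (up i) + β • create (up j)) * V =
      ((α + β) / 2) • (create (up i) * V + create (up j) * V)
        + ((α - β) / 2) • (create (up i) * V - create (up j) * V) := by
    rw [add_mul, smul_mul_assoc, smul_mul_assoc]; module
  rw [hsplit, mul_add, mul_smul_comm, mul_smul_comm, exp_mul_of_eigen e1, exp_mul_of_eigen e2,
    smul_smul, smul_smul, mul_neg]

lemma annihilate_up_mul_superposition (hij : i ≠ j)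
    (hV : ∀ m : Mode N, (m.site = i ∨ m.site = j) → annihilate m * V = 0) (α β : ℂ) :
    annihilate (up i) * (α • (create (up i) * V) + β • (create (up j) * V)) = α • V ∧
      annihilate (up j) * (α • (create (up i) * V) + β • (create (up j) * V)) = β • V := by
  have hi := hV (up i) (Or.inl rfl)
  have hj := hV (up j) (Or.inr rfl)
  simp only [mul_add, mul_smul_comm, annihilate_mul_create_mul_self hi,
    annihilate_mul_create_mul_self hj, annihilate_mul_create_mul (up_ne_up hij) hi,
    annihilate_mul_create_mul (up_ne_up hij.symm) hj, smul_zero, add_zero, zero_add, and_self]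

end Hopping

section OnSite

variable {i : Fin N} {V : Op N}

lemma conjTranspose_createPair (i : Fin N) (z : ℂ) :
    (createPair i z)ᴴ =
      (1 / (Real.sqrt 2 : ℂ)) • (1 + star z • (annihilate (dn i) * annihilate (up i))) := by
  rw [createPair, Matrix.conjTranspose_smul, Matrix.conjTranspose_add, Matrix.conjTranspose_smul,
    Matrix.conjTranspose_mul, Matrix.conjTranspose_one, conjTranspose_create, conjTranspose_create]
  simp

lemma onsite_mul_pair (hu : annihilate (up i) * V = 0) (hd : annihilate (dn i) * V = 0) :
    onsite i * (create (up i) * create (dn i) * V) = create (up i) * create (dn i) * V := by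
  have h1 : annihilate (dn i) * (create (up i) * (create (dn i) * V)) = -(create (up i) * V) := by
    rw [← mul_assoc, annihilate_mul_create (up_ne_dn _ _).symm, neg_mul, mul_assoc,
      annihilate_mul_create_mul_self hd]
  have h2 : create (dn i) * (create (up i) * V) = -(create (up i) * (create (dn i) * V)) := by
    rw [← mul_assoc, create_mul_create (up_ne_dn _ _).symm, neg_mul, mul_assoc]
  rw [onsite, number, number]
  simp only [mul_assoc]
  rw [h1, mul_neg, h2, neg_neg,
    annihilate_mul_create_mul_self (annihilate_mul_create_mul (up_ne_dn _ _) hu)]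

/-- The empty site has energy 0 and the doubly occupied one energy `x`, so evolution only rotates
their relative phase. -/
lemma exp_onsite_mul_createPair (hu : annihilate (up i) * V = 0)
    (hd : annihilate (dn i) * V = 0) (x c z : ℂ) :
    NormedSpace.exp (c • (x • onsite i)) * (createPair i z * V) =
      createPair i (z * Complex.exp (c * x)) * V := by
  have h1 : (x • onsite i) * V = (0 : ℂ) • V := by
    rw [smul_mul_assoc, onsite, mul_assoc, number_mul_of_annihilate hd]; simp
  have h2 : (x • onsite i) * (create (up i) * create (dn i) * V)
      = x • (create (up i) * create (dn i) * V) := by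
    rw [smul_mul_assoc, onsite_mul_pair hu hd]
  rw [createPair, createPair, smul_mul_assoc, smul_mul_assoc, add_mul, add_mul, one_mul,
    smul_mul_assoc, smul_mul_assoc, mul_smul_comm, mul_add, mul_smul_comm, exp_mul_of_eigen h1,
    exp_mul_of_eigen h2, mul_zero, Complex.exp_zero, one_smul, smul_smul]

/-- The empty and doubly occupied states are orthogonal, so the cross terms vanish between two
copies of `V` and the overlap is diagonal in the two amplitudes. -/
lemma conjTranspose_createPair_mul_createPair (hV : Vᴴ = V) (hV2 : V * V = V)
    (hu : annihilate (up i) * V = 0) (hd : annihilate (dn i) * V = 0) (z w : ℂ) :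
    V * ((createPair i z)ᴴ * (createPair i w * V)) = ((1 + star z * w) / 2) • V := by
  have hu' : V * create (up i) = 0 := by
    have := congrArg Matrix.conjTranspose hu
    rwa [Matrix.conjTranspose_mul, hV, conjTranspose_annihilate, Matrix.conjTranspose_zero] at this
  have h1 : V * (create (up i) * (create (dn i) * V)) = 0 := by rw [← mul_assoc, hu', zero_mul]
  have h2 : V * (annihilate (dn i) * (annihilate (up i) * V)) = 0 := by
    rw [hu, mul_zero, mul_zero]
  have h3 : annihilate (dn i) * (annihilate (up i) * (create (up i) * (create (dn i) * V))) = V := by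
    rw [annihilate_mul_create_mul_self (annihilate_mul_create_mul (up_ne_dn _ _) hu),
      annihilate_mul_create_mul_self hd]
  have hs : (1 / (Real.sqrt 2 : ℂ)) * (1 / (Real.sqrt 2 : ℂ)) = 1 / 2 := by
    rw [div_mul_div_comm, one_mul, ← Complex.ofReal_mul, Real.mul_self_sqrt (by norm_num)]
    norm_num
  rw [conjTranspose_createPair, createPair]
  simp only [smul_mul_assoc, mul_smul_comm, add_mul, mul_add, one_mul, mul_assoc, hV2, h1, h2, h3,
    smul_zero, add_zero, zero_add]
  simp only [smul_smul, ← add_smul]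
  congr 1
  linear_combination (1 + star z * w) * hs

end OnSite

variable {χ : ℕ} {G : SimpleGraph (Fin N)} (A : ColouredEdges G χ)
  {h : Fin N → Fin N → ℝ} {ξ : Fin N → ℝ}

open ColouredEdges

/-! ### Local vacua and local states -/

lemma emptySite_eq_diagonal (i : Fin N) :
    emptySite i = Matrix.diagonal fun S => if up i ∈ S ∨ dn i ∈ S then (0 : ℂ) else 1 := by
  rw [emptySite, number_eq_diagonal, number_eq_diagonal, ← Matrix.diagonal_one,
    Matrix.diagonal_sub, Matrix.diagonal_sub, Matrix.diagonal_mul_diagonal]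
  congr 1; ext S
  by_cases h1 : up i ∈ S <;> by_cases h2 : dn i ∈ S <;> simp [h1, h2]

lemma emptySite_commute (i j : Fin N) : Commute (emptySite i) (emptySite j) := by
  simp only [emptySite_eq_diagonal, Commute, SemiconjBy, Matrix.diagonal_mul_diagonal]
  congr 1; ext S; ring

lemma emptySite_mul_self (i : Fin N) : emptySite i * emptySite i = emptySite i := by
  rw [emptySite_eq_diagonal, Matrix.diagonal_mul_diagonal]
  congr 1; ext S; split_ifs <;> simp

lemma conjTranspose_emptySite (i : Fin N) : (emptySite i)ᴴ = emptySite i := by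
  rw [emptySite_eq_diagonal, Matrix.diagonal_conjTranspose]
  congr 1; ext S
  rw [Pi.star_apply]; split_ifs <;> simp

lemma annihilate_mul_emptySite (m : Mode N) : annihilate m * emptySite m.site = 0 := by
  rcases mode_eq_up_or_dn m with e | e <;> rw [e, emptySite]
  · rw [← mul_assoc, site_up, annihilate_mul_one_sub_number, zero_mul]
  · have : Commute (1 - number (up m.site)) (1 - number (dn m.site)) :=
      ((Commute.one_left _).sub_left
        ((Commute.one_right _).sub_right (number_commute_number _ _)))
    rw [site_dn, this.eq, ← mul_assoc, annihilate_mul_one_sub_number, zero_mul]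

lemma emptySite_mulVec_vacuum (i : Fin N) : emptySite i *ᵥ vacuum N = vacuum N := by
  rw [emptySite_eq_diagonal, vacuum]
  ext S
  rw [Matrix.mulVec_diagonal]
  by_cases hS : S = ∅
  · simp [hS]
  · simp [hS]

lemma localVacuum_mul_self (C : G.edgeSet) (p : Pass) :
    localVacuum A C p * localVacuum A C p = localVacuum A C p := by
  cases p
  · rw [localVacuum, (emptySite_commute _ _).mul_mul_mul_comm, emptySite_mul_self,
      emptySite_mul_self]
  · exact emptySite_mul_self _
  · exact emptySite_mul_self _

lemma conjTranspose_localVacuum (C : G.edgeSet) (p : Pass) :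
    (localVacuum A C p)ᴴ = localVacuum A C p := by
  cases p
  · rw [localVacuum, Matrix.conjTranspose_mul, conjTranspose_emptySite, conjTranspose_emptySite,
      (emptySite_commute _ _).eq]
  · exact conjTranspose_emptySite _
  · exact conjTranspose_emptySite _

lemma annihilate_mul_localVacuum (C : G.edgeSet) (p : Pass) {m : Mode N}
    (hm : m.site ∈ A.localSites C p) : annihilate m * localVacuum A C p = 0 := by
  cases p <;> simp only [localSites, Finset.mem_insert, Finset.mem_singleton] at hm <;>
    rw [localVacuum]
  · rcases hm with hm | hm
    · rw [← hm, ← mul_assoc, annihilate_mul_emptySite, zero_mul]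
    · rw [← hm, (emptySite_commute _ _).eq, ← mul_assoc, annihilate_mul_emptySite, zero_mul]
  · rw [← hm, annihilate_mul_emptySite]
  · rw [← hm, annihilate_mul_emptySite]

lemma localVacuum_mulVec_vacuum (C : G.edgeSet) (p : Pass) :
    localVacuum A C p *ᵥ vacuum N = vacuum N := by
  cases p
  · rw [localVacuum, ← Matrix.mulVec_mulVec, emptySite_mulVec_vacuum, emptySite_mulVec_vacuum]
  · exact emptySite_mulVec_vacuum _
  · exact emptySite_mulVec_vacuum _

/-- The coefficients of the two vertices in the initial states of an edge. -/
noncomputable def hopAmplitudes : Quadrature → ℂ × ℂ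
  | .cosine => (1, 0)
  | .sine => ((1 + Complex.I) / 2, (1 - Complex.I) / 2)

/-- The coefficient of the doubly occupied state in the initial states of a site. -/
noncomputable def pairAmplitude : Quadrature → ℂ
  | .cosine => 1
  | .sine => Complex.I

lemma localCreate_hop (C : G.edgeSet) (q : Quadrature) :
    localCreate A C .hop q = (hopAmplitudes q).1 • create (up (A.k₁ C))
      + (hopAmplitudes q).2 • create (up (A.k₂ C)) := by
  cases q <;> simp [localCreate, hopAmplitudes]

lemma localCreate_site₁ (C : G.edgeSet) (q : Quadrature) :
    localCreate A C .site₁ q = createPair (A.k₁ C) (pairAmplitude q) := by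
  cases q <;> rfl

lemma localCreate_site₂ (C : G.edgeSet) (q : Quadrature) :
    localCreate A C .site₂ q = createPair (A.k₂ C) (pairAmplitude q) := by
  cases q <;> rfl

lemma star_pairAmplitude_mul_self (q : Quadrature) :
    star (pairAmplitude q) * pairAmplitude q = 1 := by
  cases q <;> simp [pairAmplitude]

/-- The local states are normalised. -/
lemma localCreate_normalised (C : G.edgeSet) (p : Pass) (q : Quadrature) :
    localVacuum A C p * ((localCreate A C p q)ᴴ * (localCreate A C p q * localVacuum A C p))
      = localVacuum A C p := by
  have hV := conjTranspose_localVacuum A C p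
  have hV2 := localVacuum_mul_self A C p
  cases p
  · have hann : ∀ m : Mode N, (m.site = A.k₁ C ∨ m.site = A.k₂ C) →
        annihilate m * localVacuum A C .hop = 0 := fun m hm =>
      annihilate_mul_localVacuum A C .hop (by simpa [localSites] using hm)
    rw [localCreate_hop, Matrix.conjTranspose_add, Matrix.conjTranspose_smul,
      Matrix.conjTranspose_smul, conjTranspose_create, conjTranspose_create]
    set V := localVacuum A C .hop
    obtain ⟨h1, h2⟩ := annihilate_up_mul_superposition (A.adj C).ne hann
      (hopAmplitudes q).1 (hopAmplitudes q).2
    rw [add_mul, smul_mul_assoc, smul_mul_assoc, add_mul, smul_mul_assoc, smul_mul_assoc, h1, h2,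
      smul_smul, smul_smul, ← add_smul, mul_smul_comm, hV2]
    have : star (hopAmplitudes q).1 * (hopAmplitudes q).1
        + star (hopAmplitudes q).2 * (hopAmplitudes q).2 = 1 := by
      cases q
      · simp [hopAmplitudes]
      · simp only [hopAmplitudes, Complex.star_def, map_div₀, map_add, map_sub, map_one,
          Complex.conj_I, map_ofNat]
        ring_nf
        simp only [Complex.I_sq]
        norm_num
    rw [this, one_smul]
  · rw [localCreate_site₁, conjTranspose_createPair_mul_createPair hV hV2
      (annihilate_mul_localVacuum A C .site₁ (by simp [localSites]))
      (annihilate_mul_localVacuum A C .site₁ (by simp [localSites])), star_pairAmplitude_mul_self]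
    norm_num
  · rw [localCreate_site₂, conjTranspose_createPair_mul_createPair hV hV2
      (annihilate_mul_localVacuum A C .site₂ (by simp [localSites]))
      (annihilate_mul_localVacuum A C .site₂ (by simp [localSites])), star_pairAmplitude_mul_self]
    norm_num

/-- The coefficient that a family of experiments measures. -/
def coefficient (h : Fin N → Fin N → ℝ) (ξ : Fin N → ℝ) (C : G.edgeSet) : Pass → ℝ
  | .hop => h (A.k₁ C) (A.k₂ C)
  | .site₁ => ξ (A.k₁ C)
  | .site₂ => ξ (A.k₂ C)

/-- The ideal signal of phase `φ`. -/
noncomputable def idealSignal (φ : ℝ) : Quadrature → ℝ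
  | .cosine => Real.cos φ
  | .sine => Real.sin φ

/-- With amplitudes `α, β` on the two sites, `μ = α cos x + iβ sin x`. The untilded state gives
`cos² x`; the tilded one gives `(1 + i)/2 · (cos x + sin x)`, of squared modulus `(1 + sin 2x)/2`.
-/
lemma mul_star_eq_hop (x : ℝ) (q : Quadrature) (μ : ℂ)
    (hμ : μ = ((hopAmplitudes q).1 + (hopAmplitudes q).2) / 2 * Complex.exp (x * Complex.I)
      + ((hopAmplitudes q).1 - (hopAmplitudes q).2) / 2 * Complex.exp (-(x * Complex.I))) :
    star μ * μ = ((1 + idealSignal (2 * x) q) / 2 : ℝ) := by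
  have e1 : Complex.exp (-(x * Complex.I)) = Real.cos x - Real.sin x * Complex.I := by
    rw [← neg_mul, Complex.exp_mul_I, Complex.cos_neg, Complex.sin_neg, Complex.ofReal_cos,
      Complex.ofReal_sin]; ring
  have e2 : Complex.exp (x * Complex.I) = Real.cos x + Real.sin x * Complex.I := by
    rw [Complex.exp_mul_I, Complex.ofReal_cos, Complex.ofReal_sin]
  rw [e1, e2] at hμ
  have hsc := Real.sin_sq_add_cos_sq x
  rw [Complex.star_def, ← Complex.normSq_eq_conj_mul_self, Complex.ofReal_inj, hμ,
    Complex.normSq_apply]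
  have hφ : idealSignal (2 * x) q
      = if q = .cosine then 2 * Real.cos x ^ 2 - 1 else 2 * Real.sin x * Real.cos x := by
    cases q <;> simp [idealSignal, Real.cos_two_mul, Real.sin_two_mul]
  rw [hφ]
  generalize Real.cos x = c at *
  generalize Real.sin x = s at *
  cases q
  · simp [hopAmplitudes]
    ring
  · simp [hopAmplitudes]
    linear_combination (1 / 2) * hsc

/-- Interference of the two levels: `|1 + w|² / 4 = (1 + Re w) / 2` for a unit number `w`, and the
factor `i` in the tilded state turns the cosine into a sine. -/
lemma mul_star_eq_pair (x : ℝ) (q : Quadrature) (μ : ℂ)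
    (hμ : μ = (1 + pairAmplitude q * Complex.exp (-(x * Complex.I))) / 2) :
    star μ * μ = ((1 + idealSignal x q) / 2 : ℝ) := by
  have e1 : Complex.exp (-(x * Complex.I)) = Real.cos x - Real.sin x * Complex.I := by
    rw [← neg_mul, Complex.exp_mul_I, Complex.cos_neg, Complex.sin_neg, Complex.ofReal_cos,
      Complex.ofReal_sin]; ring
  rw [e1] at hμ
  have hsc := Real.sin_sq_add_cos_sq x
  rw [Complex.star_def, ← Complex.normSq_eq_conj_mul_self, Complex.ofReal_inj, hμ,
    Complex.normSq_apply]
  have hφ : idealSignal x q = if q = .cosine then Real.cos x else Real.sin x := by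
    cases q <;> rfl
  rw [hφ]
  generalize Real.cos x = c at *
  generalize Real.sin x = s at *
  cases q
  · simp [pairAmplitude]
    linear_combination (1 / 4) * hsc
  · simp [pairAmplitude]
    linear_combination (1 / 4) * hsc

/-- The transition amplitude of the local evolution. -/
lemma exists_localAmplitude (C : G.edgeSet) (p : Pass) (q : Quadrature) (j : ℕ) :
    ∃ μ : ℂ, localVacuum A C p * ((localCreate A C p .cosine)ᴴ *
        (NormedSpace.exp ((-(Complex.I * evolutionTime j p)) • localHamiltonian A h ξ C p)
          * (localCreate A C p q * localVacuum A C p))) = μ • localVacuum A C p ∧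
      star μ * μ = ((1 + idealSignal (2 ^ j * coefficient A h ξ C p) q) / 2 : ℝ) := by
  have hV := conjTranspose_localVacuum A C p
  have hV2 := localVacuum_mul_self A C p
  cases p
  · have hann : ∀ m : Mode N, (m.site = A.k₁ C ∨ m.site = A.k₂ C) →
        annihilate m * localVacuum A C .hop = 0 := fun m hm =>
      annihilate_mul_localVacuum A C .hop (by simpa [localSites] using hm)
    obtain ⟨h1, -⟩ := annihilate_up_mul_superposition (A.adj C).ne hann 1 1
    obtain ⟨h2, -⟩ := annihilate_up_mul_superposition (A.adj C).ne hann 1 (-1)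
    rw [one_smul, one_smul] at h1
    rw [one_smul, neg_smul, one_smul, ← sub_eq_add_neg] at h2
    rw [localCreate_hop A C q, localHamiltonian, exp_edgeHamiltonian_mul (A.adj C).ne hann,
      localCreate, conjTranspose_create, mul_add, mul_smul_comm, mul_smul_comm, h1, h2, one_smul,
      ← add_smul, mul_smul_comm, hV2]
    refine ⟨_, rfl, ?_⟩
    -- The edge oscillates at the energy difference `2h`, which compensates the halved evolution
    -- time.
    have e : 2 ^ j * coefficient A h ξ C .hop
        = 2 * (evolutionTime j .hop * h (A.k₁ C) (A.k₂ C)) := by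
      simp only [coefficient, evolutionTime]; ring
    rw [e]
    refine mul_star_eq_hop _ q _ ?_
    push_cast
    congr 3 <;> ring_nf
  · rw [localCreate_site₁ A C q, localHamiltonian, exp_onsite_mul_createPair
      (annihilate_mul_localVacuum A C .site₁ (by simp [localSites]))
      (annihilate_mul_localVacuum A C .site₁ (by simp [localSites])), localCreate,
      conjTranspose_createPair_mul_createPair hV hV2
      (annihilate_mul_localVacuum A C .site₁ (by simp [localSites]))
      (annihilate_mul_localVacuum A C .site₁ (by simp [localSites]))]
    refine ⟨_, rfl, ?_⟩
    refine mul_star_eq_pair _ q _ ?_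
    simp only [coefficient, evolutionTime, star_one, one_mul]
    push_cast
    congr 4; ring
  · rw [localCreate_site₂ A C q, localHamiltonian, exp_onsite_mul_createPair
      (annihilate_mul_localVacuum A C .site₂ (by simp [localSites]))
      (annihilate_mul_localVacuum A C .site₂ (by simp [localSites])), localCreate,
      conjTranspose_createPair_mul_createPair hV hV2
      (annihilate_mul_localVacuum A C .site₂ (by simp [localSites]))
      (annihilate_mul_localVacuum A C .site₂ (by simp [localSites]))]
    refine ⟨_, rfl, ?_⟩
    refine mul_star_eq_pair _ q _ ?_
    simp only [coefficient, evolutionTime, star_one, one_mul]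
    push_cast
    congr 4; ring

end LocalSignals

/-! ### Initial states and measurements -/

section Measurement

open scoped Matrix.Norms.L2Operator
open MeasureTheory

variable {N χ : ℕ} {G : SimpleGraph (Fin N)} (A : ColouredEdges G χ)
  {h : Fin N → Fin N → ℝ} {ξ : Fin N → ℝ}

open ColouredEdges

lemma localVacuum_commute_of_mem_localAlgebra {C : G.edgeSet} {p : Pass} {X : Finset (Fin N)}
    (hX : Disjoint (A.localSites C p) X) {B : Op N} (hB : B ∈ localAlgebra X) :
    Commute (localVacuum A C p) B := by
  have hE : ∀ i ∈ A.localSites C p, Commute (emptySite i) B := by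
    intro i hi
    have hi' := Finset.disjoint_left.1 hX hi
    exact Commute.mul_left
      ((Commute.one_left B).sub_left (number_commute_of_mem_localAlgebra hB (m := up i) hi'))
      ((Commute.one_left B).sub_left (number_commute_of_mem_localAlgebra hB (m := dn i) hi'))
  cases p
  · exact (hE _ (by simp [localSites])).mul_left (hE _ (by simp [localSites]))
  · exact hE _ (by simp [localSites])
  · exact hE _ (by simp [localSites])

/-- The sign acquired when the creation operators of two subsystems are exchanged. -/
def exchangeSign : Pass → ℂ
  | .hop => -1
  | .site₁ => 1
  | .site₂ => 1

lemma createPair_commute_of_mem_localAlgebra {X : Finset (Fin N)} {B : Op N}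
    (hB : B ∈ localAlgebra X) {i : Fin N} (hi : i ∉ X) (z : ℂ) : Commute (createPair i z) B := by
  refine commute_of_mem_localAlgebra hB fun m hm => ?_
  have hm' : m.site ≠ i := fun e => hi (e ▸ hm)
  have hu : m ≠ up i := fun e => hm' (congrArg Mode.site e)
  have hd : m ≠ dn i := fun e => hm' (congrArg Mode.site e)
  constructor
  · exact ((Commute.one_left _).add_left
      ((create_commute_create_mul_create hu hd).symm.smul_left _)).smul_left _
  · exact ((Commute.one_left _).add_left
      ((annihilate_commute_create_mul_create hu hd).symm.smul_left _)).smul_left _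

/-- Hopping states hold one fermion each and anticommute; the on-site creators are even and commute.
-/
lemma localCreate_exchange {C C' : G.edgeSet} {p : Pass}
    (hX : Disjoint (A.localSites C p) (A.localSites C' p)) (q : Quadrature) :
    localCreate A C p q * localCreate A C' p q
      = exchangeSign p • (localCreate A C' p q * localCreate A C p q) := by
  cases p
  · simp only [localSites, Finset.disjoint_insert_left, Finset.disjoint_singleton_left,
      Finset.mem_insert, Finset.mem_singleton, not_or] at hX
    obtain ⟨⟨h1, h2⟩, h3, h4⟩ := hX
    rw [localCreate_hop, localCreate_hop]
    simp only [mul_add, add_mul, smul_mul_smul_comm, exchangeSign,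
      create_mul_create (up_ne_up h1), create_mul_create (up_ne_up h2),
      create_mul_create (up_ne_up h3), create_mul_create (up_ne_up h4)]
    module
  · rw [localCreate_site₁ A C, exchangeSign, one_smul]
    exact createPair_commute_of_mem_localAlgebra (localCreate_mem_localAlgebra A C' .site₁ q)
      (Finset.disjoint_left.1 hX (by simp [localSites])) _
  · rw [localCreate_site₂ A C, exchangeSign, one_smul]
    exact createPair_commute_of_mem_localAlgebra (localCreate_mem_localAlgebra A C' .site₂ q)
      (Finset.disjoint_left.1 hX (by simp [localSites])) _

/-- The squared norm of a vector. -/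
noncomputable def normSq (v : FockVec N) : ℝ := ∑ S, ‖v S‖ ^ 2

lemma coe_normSq (v : FockVec N) : (normSq v : ℂ) = star v ⬝ᵥ v := by
  simp only [normSq, dotProduct, Pi.star_apply, Complex.ofReal_sum, Complex.star_def,
    Complex.conj_mul', Complex.ofReal_pow]

lemma star_mulVec_dotProduct (B : Op N) (v w : FockVec N) :
    star (B *ᵥ v) ⬝ᵥ w = star v ⬝ᵥ (Bᴴ *ᵥ w) := by
  rw [Matrix.star_mulVec, Matrix.dotProduct_mulVec]

lemma coe_normSq_mulVec (B : Op N) (v : FockVec N) :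
    (normSq (B *ᵥ v) : ℂ) = star v ⬝ᵥ ((Bᴴ * B) *ᵥ v) := by
  rw [coe_normSq, star_mulVec_dotProduct, Matrix.mulVec_mulVec]

lemma normSq_nonneg (v : FockVec N) : 0 ≤ normSq v := by unfold normSq; positivity

lemma normSq_mulVec_of_unitary {U : Op N} (hU : Uᴴ * U = 1) (v : FockVec N) :
    normSq (U *ᵥ v) = normSq v := by
  rw [← Complex.ofReal_inj, coe_normSq_mulVec, hU, Matrix.one_mulVec, coe_normSq]

lemma normSq_vacuum : normSq (vacuum N) = 1 := by
  rw [normSq, Finset.sum_eq_single ∅]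
  · simp [vacuum]
  · intro S _ hS; simp [vacuum, hS]
  · simp

lemma normSq_mulVec_of_conj {B V : Op N} (hV : Vᴴ = V) {w : FockVec N} (hw : V *ᵥ w = w)
    {s : ℝ} (hB : V * (Bᴴ * (B * V)) = (s : ℂ) • V) : normSq (B *ᵥ w) = s * normSq w := by
  have : B *ᵥ w = (B * V) *ᵥ w := by rw [← Matrix.mulVec_mulVec, hw]
  rw [← Complex.ofReal_inj, this, coe_normSq_mulVec, Matrix.conjTranspose_mul, hV, mul_assoc, hB,
    Matrix.smul_mulVec, hw, dotProduct_smul, smul_eq_mul, Complex.ofReal_mul, coe_normSq]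

lemma norm_dotProduct_mulVec_le (B : Op N) (v : FockVec N) : ‖star v ⬝ᵥ (B *ᵥ v)‖ ≤ ‖B‖ * normSq v := by
  have h1 : star v ⬝ᵥ (B *ᵥ v) = inner ℂ (WithLp.toLp 2 v) (WithLp.toLp 2 (B *ᵥ v)) := by
    rw [EuclideanSpace.inner_toLp_toLp, dotProduct_comm]
  have h2 : ‖(WithLp.toLp 2 v : EuclideanSpace ℂ (Finset (Mode N)))‖ ^ 2 = normSq v := by
    rw [EuclideanSpace.norm_sq_eq]; rfl
  have h3 := Matrix.l2_opNorm_mulVec B (WithLp.toLp 2 v)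
  rw [h1, ← h2]
  refine (norm_inner_le_norm _ _).trans ?_
  calc _ ≤ ‖(WithLp.toLp 2 v : EuclideanSpace ℂ (Finset (Mode N)))‖
        * (‖B‖ * ‖(WithLp.toLp 2 v : EuclideanSpace ℂ (Finset (Mode N)))‖) := by
        gcongr; exact h3
    _ = _ := by ring

section States

variable {c : Fin χ} (p : Pass) (q : Quadrature)

/-- The state in which the subsystems in the list are prepared. -/
noncomputable def listState (l : List (ColourClass A c)) : FockVec N :=
  (l.map fun C => localCreate A C.1 p q).prod *ᵥ vacuum N

variable {A p}

lemma localSites_disjoint_of_ne {C C' : ColourClass A c} (hne : C ≠ C') :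
    Disjoint (A.localSites C.1 p) (A.localSites C'.1 p) :=
  disjoint_localSites (C.2.trans C'.2.symm) (fun e => hne (Subtype.ext e)) p

variable {q}

lemma localVacuum_mulVec_listState {C : ColourClass A c} {l : List (ColourClass A c)}
    (hC : C ∉ l) : localVacuum A C.1 p *ᵥ listState A p q l = listState A p q l := by
  have hcomm : Commute (localVacuum A C.1 p) (l.map fun C => localCreate A C.1 p q).prod := by
    refine Commute.list_prod_right _ _ fun B hB => ?_
    obtain ⟨C', hC', rfl⟩ := List.mem_map.1 hB
    have hne : C ≠ C' := fun e => hC (e ▸ hC')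
    exact localVacuum_commute_of_mem_localAlgebra A (localSites_disjoint_of_ne hne)
      (localCreate_mem_localAlgebra A C'.1 p q)
  rw [listState, Matrix.mulVec_mulVec, hcomm.eq, ← Matrix.mulVec_mulVec,
    localVacuum_mulVec_vacuum]

/-- Each creator preserves the norm of vectors in which its own subsystem is empty, so the factors
can be peeled off one by one. -/
lemma normSq_listState {l : List (ColourClass A c)} (hl : l.Nodup) :
    normSq (listState A p q l) = 1 := by
  induction l with
  | nil => simp [listState, normSq_vacuum]
  | cons C l ih =>
    rw [List.nodup_cons] at hl
    rw [listState, List.map_cons, List.prod_cons, ← Matrix.mulVec_mulVec]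
    change normSq (localCreate A C.1 p q *ᵥ listState A p q l) = 1
    rw [normSq_mulVec_of_conj (s := 1) (conjTranspose_localVacuum A C.1 p)
      (localVacuum_mulVec_listState hl.1)
      (by rw [localCreate_normalised]; simp), ih hl.2, one_mul]

lemma exchangeSign_norm (p : Pass) : ‖exchangeSign p‖ = 1 := by cases p <;> simp [exchangeSign]

/-- Moving the creator of `C` to the front costs only a sign, so for observables at `C` the other
subsystems form a spectator state `w` with `C` empty. -/
lemma exists_initialState_eq (C : ColourClass A c) :
    ∃ (s : ℂ) (w : FockVec N), ‖s‖ = 1 ∧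
      initialState A c p q = s • (localCreate A C.1 p q *ᵥ w) ∧
      localVacuum A C.1 p *ᵥ w = w ∧ normSq w = 1 := by
  have hnd := (Finset.univ : Finset (ColourClass A c)).nodup_toList
  obtain ⟨l₁, l₂, hl⟩ := List.append_of_mem
    (Finset.mem_toList.2 (Finset.mem_univ C) : C ∈ (Finset.univ : Finset (ColourClass A c)).toList)
  rw [hl, List.nodup_middle, List.nodup_cons] at hnd
  have hmove : ∀ l : List (ColourClass A c), C ∉ l →
      (l.map fun C => localCreate A C.1 p q).prod * localCreate A C.1 p q =
        exchangeSign p ^ l.length • (localCreate A C.1 p q *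
          (l.map fun C => localCreate A C.1 p q).prod) := by
    intro l hl
    induction l with
    | nil => simp
    | cons C' l ih =>
      rw [List.mem_cons, not_or] at hl
      rw [List.map_cons, List.prod_cons, mul_assoc, ih hl.2, mul_smul_comm, ← mul_assoc,
        localCreate_exchange A (localSites_disjoint_of_ne (Ne.symm hl.1)), smul_mul_assoc,
        smul_smul, List.length_cons, pow_succ, mul_assoc]
  refine ⟨exchangeSign p ^ l₁.length, listState A p q (l₁ ++ l₂), ?_, ?_,
    localVacuum_mulVec_listState hnd.1, normSq_listState hnd.2⟩
  · rw [norm_pow, exchangeSign_norm, one_pow]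
  · rw [initialState, opProd, hl, listState, List.map_append, List.map_append, List.map_cons,
      List.prod_append, List.prod_append, List.prod_cons, ← mul_assoc,
      hmove l₁ (fun h => hnd.1 (List.mem_append_left _ h)), smul_mul_assoc, Matrix.smul_mulVec,
      Matrix.mulVec_mulVec, mul_assoc]

lemma normSq_initialState : normSq (initialState A c p q) = 1 :=
  normSq_listState (Finset.nodup_toList _)

/-- The expectation of a local observable under the local evolution. -/
lemma expectation_heisenberg (hsymm : ∀ i j, G.Adj i j → h i j = h j i) (C : ColourClass A c)
    (j : ℕ) :
    star (initialState A c p q) ⬝ᵥ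
      (heisenberg (localHamiltonian A h ξ C.1 p) (evolutionTime j p) (localObservable A p C.1)
        *ᵥ initialState A c p q)
      = ((1 + idealSignal (2 ^ j * coefficient A h ξ C.1 p) q) / 2 : ℝ) := by
  obtain ⟨s, w, hs, hinit, hw, hw1⟩ := exists_initialState_eq (p := p) (q := q) C
  obtain ⟨μ, hμ, hμ2⟩ := exists_localAmplitude A (h := h) (ξ := ξ) C.1 p q j
  have hH : (localHamiltonian A h ξ C.1 p)ᴴ = localHamiltonian A h ξ C.1 p := by
    rw [localHamiltonian_eq_restrictedHubbard A hsymm]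
    exact isHermitian_partialHubbard hsymm fun _ _ h => ⟨h.2, h.1⟩
  have hV := conjTranspose_localVacuum A C.1 p
  have hV2 := localVacuum_mul_self A C.1 p
  rw [heisenberg, ← conjTranspose_evolution hH, localObservable, hinit]
  set E := NormedSpace.exp ((-(Complex.I * evolutionTime j p)) • localHamiltonian A h ξ C.1 p)
  set V := localVacuum A C.1 p
  set a := localCreate A C.1 p .cosine
  set b := localCreate A C.1 p q
  have hμ' : V * (bᴴ * (Eᴴ * (a * V))) = star μ • V := by
    have := congrArg Matrix.conjTranspose hμ
    simpa [Matrix.conjTranspose_mul, hV, mul_assoc] using this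
  have hVw : b *ᵥ w = (b * V) *ᵥ w := by rw [← Matrix.mulVec_mulVec, hw]
  rw [hVw, star_smul, smul_dotProduct, Matrix.mulVec_smul, dotProduct_smul, smul_smul,
    star_mulVec_dotProduct, Matrix.mulVec_mulVec, Matrix.mulVec_mulVec, Matrix.conjTranspose_mul,
    hV]
  have hprod : V * bᴴ * (Eᴴ * (a * V * aᴴ) * E) * (b * V)
      = (star μ * μ) • V := by
    -- Writing the middle projector as `V * V` splits the expectation into the transition amplitude
    -- and its conjugate.
    calc _ = (V * (bᴴ * (Eᴴ * (a * V)))) * (V * (aᴴ * (E * (b * V)))) := by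
          conv_lhs => rw [← hV2]
          simp only [mul_assoc, hV2]
          simp only [← mul_assoc V V, hV2]
      _ = _ := by rw [hμ, hμ', smul_mul_smul_comm, hV2]
  have hs2 : star s * s = 1 := by
    rw [Complex.star_def, Complex.conj_mul', hs]; simp
  rw [hprod, Matrix.smul_mulVec, hw, dotProduct_smul, ← coe_normSq, hw1, hμ2, hs2]
  simp

end States

end Measurement

/-! ### Laws of the outcomes -/

section OutcomeLaw

open scoped Matrix.Norms.L2Operator
open MeasureTheory

section CommutingProjections

variable {N : ℕ} {ι : Type*} {O : ι → Op N}

lemma commute_ite_one_sub (hcomm : ∀ i j, Commute (O i) (O j)) (i j : ι) (b b' : Bool) :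
    Commute (if b then O i else 1 - O i) (if b' then O j else 1 - O j) := by
  have h := hcomm i j
  cases b <;> cases b' <;> simp only [if_true, if_false, Bool.false_eq_true]
  · exact (Commute.one_left _).sub_left ((Commute.one_right _).sub_right h)
  · exact (Commute.one_left _).sub_left h
  · exact (Commute.one_right _).sub_right h
  · exact h

/-- Finite products over `ι` need a commutative ring. The subalgebra generated by the projectors is
one, and identities proved there are transported along the inclusion. -/
lemma exists_commRing_lift (hcomm : ∀ i j, Commute (O i) (O j)) :
    ∃ (S : Type) (_ : CommRing S) (φ : S →+* Op N) (e : ι → S),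
      Function.Injective φ ∧ ∀ i, φ (e i) = O i := by
  have : IsMulCommutative (Algebra.adjoin ℂ (Set.range O)) := Algebra.isMulCommutative_adjoin ℂ (by
    rintro _ ⟨i, rfl⟩ _ ⟨j, rfl⟩; exact hcomm i j)
  exact ⟨Algebra.adjoin ℂ (Set.range O),
    { (inferInstance : Ring (Algebra.adjoin ℂ (Set.range O))) with
      mul_comm := fun a b => mul_comm' a b },
    (Algebra.adjoin ℂ (Set.range O)).val.toRingHom,
    fun i => ⟨O i, Algebra.subset_adjoin ⟨i, rfl⟩⟩, Subtype.val_injective, fun _ => rfl⟩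

variable [Fintype ι]

/-- The joint spectral projector of a family of commuting projectors. -/
noncomputable def jointProjector (O : ι → Op N) (o : ι → Bool) : Op N :=
  opProd Finset.univ fun i => if o i then O i else 1 - O i

lemma conjTranspose_jointProjector (hcomm : ∀ i j, Commute (O i) (O j))
    (hherm : ∀ i, (O i)ᴴ = O i) (o : ι → Bool) :
    (jointProjector O o)ᴴ = jointProjector O o := by
  have hf : ∀ i, (if o i then O i else 1 - O i)ᴴ = if o i then O i else 1 - O i := by
    intro i; split_ifs <;> simp [hherm]
  rw [jointProjector, opProd, Matrix.conjTranspose_list_prod, List.map_map]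
  have : Matrix.conjTranspose ∘ (fun i => if o i then O i else 1 - O i)
      = fun i => if o i then O i else 1 - O i := funext hf
  rw [this]
  refine List.Perm.prod_eq' (List.reverse_perm _) ?_
  rw [List.pairwise_reverse, List.pairwise_map]
  exact List.pairwise_of_forall fun i j => (commute_ite_one_sub hcomm _ _ _ _)

lemma jointProjector_eq_map {S : Type} [CommRing S] {φ : S →+* Op N} {e : ι → S}
    (hφ : ∀ i, φ (e i) = O i) (o : ι → Bool) :
    jointProjector O o = φ (∏ i, if o i then e i else 1 - e i) := by
  rw [← Finset.prod_map_toList, map_list_prod, List.map_map, jointProjector, opProd]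
  congr 2
  ext1 i
  rw [Function.comp_apply, apply_ite φ, map_sub, map_one, hφ]

lemma jointProjector_mul_self (hcomm : ∀ i j, Commute (O i) (O j))
    (hidem : ∀ i, O i * O i = O i) (o : ι → Bool) :
    jointProjector O o * jointProjector O o = jointProjector O o := by
  obtain ⟨S, _, φ, e, hinj, hφ⟩ := exists_commRing_lift hcomm
  have he : ∀ i, e i * e i = e i := fun i => hinj (by rw [map_mul, hφ, hidem])
  rw [jointProjector_eq_map hφ, ← map_mul, ← Finset.prod_mul_distrib]
  congr 1
  refine Finset.prod_congr rfl fun i _ => ?_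
  split_ifs
  · exact he i
  · rw [mul_sub, sub_mul, sub_mul, he]; ring

lemma mul_jointProjector (hcomm : ∀ i j, Commute (O i) (O j))
    (hidem : ∀ i, O i * O i = O i) (i : ι) (o : ι → Bool) :
    O i * jointProjector O o = if o i then jointProjector O o else 0 := by
  classical
  obtain ⟨S, _, φ, e, hinj, hφ⟩ := exists_commRing_lift hcomm
  have he : ∀ i, e i * e i = e i := fun i => hinj (by rw [map_mul, hφ, hidem])
  rw [jointProjector_eq_map hφ, ← hφ i, ← map_mul,
    ← Finset.mul_prod_erase Finset.univ _ (Finset.mem_univ i), ← mul_assoc]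
  split_ifs with h
  · rw [he]
  · rw [mul_sub, he, mul_one, sub_self, zero_mul, map_zero]

/-- Expansion of the product of the factors `e i + (1 - e i)`, each equal to 1. -/
lemma sum_jointProjector [DecidableEq ι] (hcomm : ∀ i j, Commute (O i) (O j)) :
    ∑ o : ι → Bool, jointProjector O o = 1 := by
  obtain ⟨S, _, φ, e, hinj, hφ⟩ := exists_commRing_lift hcomm
  simp only [jointProjector_eq_map hφ, ← map_sum]
  have := Finset.prod_univ_sum (fun _ : ι => (Finset.univ : Finset Bool))
    (fun i b => if b then e i else 1 - e i)
  rw [Fintype.piFinset_univ] at this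
  rw [← this]
  simp

end CommutingProjections

variable {N χ : ℕ} {G : SimpleGraph (Fin N)} (A : ColouredEdges G χ)
  {h : Fin N → Fin N → ℝ} {ξ : Fin N → ℝ}

open ColouredEdges

lemma localObservable_mul_self (C : G.edgeSet) (p : Pass) :
    localObservable A p C * localObservable A p C = localObservable A p C := by
  have hn := localCreate_normalised A C p .cosine
  have hV2 := localVacuum_mul_self A C p
  rw [localObservable]
  set V := localVacuum A C p
  set a := localCreate A C p .cosine
  calc _ = a * (V * (aᴴ * (a * V))) * aᴴ := by simp only [mul_assoc]
    _ = _ := by rw [hn]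

lemma conjTranspose_localObservable (C : G.edgeSet) (p : Pass) :
    (localObservable A p C)ᴴ = localObservable A p C := by
  rw [localObservable, Matrix.conjTranspose_mul, Matrix.conjTranspose_mul,
    Matrix.conjTranspose_conjTranspose, conjTranspose_localVacuum, mul_assoc]

lemma localObservable_commute_of_mem_localAlgebra {C : G.edgeSet} {p : Pass}
    {X : Finset (Fin N)} (hX : Disjoint (A.localSites C p) X) {B : Op N}
    (hB : B ∈ localAlgebra X) : Commute (localObservable A p C) B := by
  have hpair : ∀ i ∈ A.localSites C p,
      Commute (createPair i 1) B ∧ Commute (createPair i 1)ᴴ B := by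
    intro i hi
    have hi' := Finset.disjoint_left.1 hX hi
    refine ⟨createPair_commute_of_mem_localAlgebra hB hi' _, ?_⟩
    have := createPair_commute_of_mem_localAlgebra (conjTranspose_mem_localAlgebra hB) hi' 1
    have := congrArg Matrix.conjTranspose this.eq
    simp only [Matrix.conjTranspose_mul, Matrix.conjTranspose_conjTranspose] at this
    exact this.symm
  have hV := localVacuum_commute_of_mem_localAlgebra A hX hB
  cases p
  -- The observable is `c† V c` with `V` even: a foreign fermion operator passes it with two sign
  -- changes.
  · refine commute_of_mem_localAlgebra hB fun m hm => ?_
    have hk : m ≠ up (A.k₁ C) := fun e =>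
      Finset.disjoint_left.1 hX (by simp [localSites] : A.k₁ C ∈ A.localSites C .hop)
        (by rwa [e] at hm)
    have hc := localVacuum_commute_of_mem_localAlgebra A hX (create_mem_localAlgebra hm)
    have ha := localVacuum_commute_of_mem_localAlgebra A hX (annihilate_mem_localAlgebra hm)
    rw [localObservable, localCreate, conjTranspose_create, mul_assoc]
    constructor
    · refine (Commute.of_neg_neg (create_mul_create hk) ?_).symm
      rw [← mul_assoc, ← hc.eq, mul_assoc, mul_assoc, annihilate_mul_create hk.symm, mul_neg,
        neg_neg]
    · refine (Commute.of_neg_neg (annihilate_mul_create hk) ?_).symm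
      rw [← mul_assoc, ← ha.eq, mul_assoc, mul_assoc, annihilate_mul_annihilate hk, mul_neg]
  · exact ((hpair _ (by simp [localSites])).1.mul_left hV).mul_left
      (hpair _ (by simp [localSites])).2
  · exact ((hpair _ (by simp [localSites])).1.mul_left hV).mul_left
      (hpair _ (by simp [localSites])).2

variable {c : Fin χ} {p : Pass} {q : Quadrature}

lemma localObservable_commute (C C' : ColourClass A c) :
    Commute (localObservable A p C.1) (localObservable A p C'.1) := by
  by_cases hne : C = C'
  · rw [hne]
  · exact localObservable_commute_of_mem_localAlgebra A (localSites_disjoint_of_ne hne)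
      (localObservable_mem_localAlgebra A C'.1 p)

lemma outcomeProjector_eq (o : Outcome A c) :
    outcomeProjector A c p o
      = jointProjector (fun C : ColourClass A c => localObservable A p C.1) o := rfl

lemma coe_normSq_outcomeProjector_mulVec (o : Outcome A c) (v : FockVec N) :
    (normSq (outcomeProjector A c p o *ᵥ v) : ℂ) = star v ⬝ᵥ (outcomeProjector A c p o *ᵥ v) := by
  rw [coe_normSq_mulVec, outcomeProjector_eq,
    conjTranspose_jointProjector (localObservable_commute A)
      (fun C => conjTranspose_localObservable A C.1 p),
    jointProjector_mul_self (localObservable_commute A)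
      (fun C => localObservable_mul_self A C.1 p)]

noncomputable instance : Fintype (Outcome A c) := by classical infer_instance

lemma sum_outcomeProjector : ∑ o : Outcome A c, outcomeProjector A c p o = 1 := by
  classical
  convert sum_jointProjector (localObservable_commute A (c := c) (p := p))
  rfl

/-- Marginalising the joint measurement gives the measurement of the single subsystem, so the other
results can be ignored. -/
lemma sum_outcomeProjector_ite (C : ColourClass A c) :
    ∑ o : Outcome A c, (if o C then outcomeProjector A c p o else 0)
      = localObservable A p C.1 := by
  rw [← mul_one (localObservable A p C.1), ← sum_outcomeProjector A (c := c) (p := p),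
    Finset.mul_sum]
  refine Finset.sum_congr rfl fun o _ => ?_
  exact (mul_jointProjector (localObservable_commute A)
      (fun C => localObservable_mul_self A C.1 p) C o).symm

lemma dotProduct_sum_mulVec {ι : Type*} (s : Finset ι) (f : ι → Op N) (v w : FockVec N) :
    w ⬝ᵥ ((∑ i ∈ s, f i) *ᵥ v) = ∑ i ∈ s, w ⬝ᵥ (f i *ᵥ v) := by
  rw [Matrix.sum_mulVec, dotProduct_sum]

lemma sum_normSq_outcomeProjector (v : FockVec N) :
    ∑ o : Outcome A c, normSq (outcomeProjector A c p o *ᵥ v) = normSq v := by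
  rw [← Complex.ofReal_inj, Complex.ofReal_sum]
  simp only [coe_normSq_outcomeProjector_mulVec]
  rw [← dotProduct_sum_mulVec, sum_outcomeProjector, Matrix.one_mulVec, coe_normSq]

lemma sum_normSq_outcomeProjector_ite (C : ColourClass A c) (v : FockVec N) :
    ((∑ o : Outcome A c, if o C then normSq (outcomeProjector A c p o *ᵥ v) else 0 : ℝ) : ℂ)
      = star v ⬝ᵥ (localObservable A p C.1 *ᵥ v) := by
  rw [← sum_outcomeProjector_ite A C, dotProduct_sum_mulVec, Complex.ofReal_sum]
  refine Finset.sum_congr rfl fun o _ => ?_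
  split_ifs
  · exact coe_normSq_outcomeProjector_mulVec A o v
  · simp

variable {H : Op N} (t : ℝ) (r : ℕ)

lemma bornWeight_nonneg (o : Outcome A c) : 0 ≤ bornWeight A H c p q t r o :=
  integral_nonneg fun _ => normSq_nonneg _

lemma integrable_bornWeight (hH : Hᴴ = H) (o : Outcome A c) :
    Integrable (fun θ : Fin r → Fin N → ℝ => normSq (outcomeProjector A c p o *ᵥ
      (reshapedPropagator H (randomSites A c p) t θ *ᵥ initialState A c p q))) (phaseLaw N r) := by
  refine Integrable.of_bound (C := 1) (Continuous.aestronglyMeasurable ?_)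
    (Filter.Eventually.of_forall fun θ => ?_)
  · have hc := continuous_stepsPropagator H (randomSites A c p) (t / r) r
    simp only [reshapedPropagator_eq]
    have hv : Continuous fun θ : Fin r → Fin N → ℝ => outcomeProjector A c p o *ᵥ
        (stepsPropagator H (randomSites A c p) (t / r) θ *ᵥ initialState A c p q) :=
      continuous_const.matrix_mulVec (hc.matrix_mulVec continuous_const)
    unfold normSq
    fun_prop
  · rw [Real.norm_of_nonneg (normSq_nonneg _)]
    have h1 : normSq (reshapedPropagator H (randomSites A c p) t θ *ᵥ initialState A c p q) = 1 := by
      rw [reshapedPropagator_eq, normSq_mulVec_of_unitary (stepsPropagator_unitary hH _ _ θ),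
        normSq_initialState]
    refine le_of_le_of_eq ?_ ((sum_normSq_outcomeProjector A (c := c) (p := p) _).trans h1)
    exact Finset.single_le_sum (f := fun o : Outcome A c => normSq (outcomeProjector A c p o *ᵥ
      (reshapedPropagator H (randomSites A c p) t θ *ᵥ initialState A c p q)))
      (fun o _ => normSq_nonneg _) (Finset.mem_univ o)

lemma sum_bornWeight (hH : Hᴴ = H) : ∑ o : Outcome A c, bornWeight A H c p q t r o = 1 := by
  have := integral_finsetSum (μ := phaseLaw N r) (Finset.univ : Finset (Outcome A c))
    fun o _ => integrable_bornWeight A (p := p) (q := q) t r hH o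
  refine this.symm.trans ?_
  simp only [sum_normSq_outcomeProjector, reshapedPropagator_eq,
    normSq_mulVec_of_unitary (stepsPropagator_unitary hH _ _ _), normSq_initialState]
  simp

/-- The change from the Schrödinger to the Heisenberg picture: the phase-averaged probability of
"yes" at `C` becomes the expectation of the averaged observable, which the reshaping error controls.
-/
lemma sum_bornWeight_ite (hH : Hᴴ = H) (C : ColourClass A c) :
    ((∑ o : Outcome A c, if o C then bornWeight A H c p q t r o else 0 : ℝ) : ℂ)
      = star (initialState A c p q) ⬝ᵥ
        (reshapedHeisenberg H (randomSites A c p) t r (localObservable A p C.1)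
          *ᵥ initialState A c p q) := by
  have h1 : ∑ o : Outcome A c, (if o C then bornWeight A H c p q t r o else 0) =
      ∫ θ : Fin r → Fin N → ℝ, ∑ o : Outcome A c, (if o C then normSq (outcomeProjector A c p o *ᵥ
        (reshapedPropagator H (randomSites A c p) t θ *ᵥ initialState A c p q)) else 0)
        ∂(phaseLaw N r) := by
    rw [integral_finsetSum]
    · refine Finset.sum_congr rfl fun o _ => ?_
      split_ifs
      · rfl
      · simp
    · intro o _
      split_ifs
      · exact integrable_bornWeight A t r hH o
      · exact integrable_zero _ _ _
  rw [h1, ← integral_complex_ofReal]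
  simp only [sum_normSq_outcomeProjector_ite, reshapedPropagator_eq, star_mulVec_dotProduct]
  rw [reshapedHeisenberg_eq hH, averagedSteps]
  set ψ := initialState A c p q
  let L : Op N →ₗ[ℂ] ℂ :=
    { toFun := fun B => star ψ ⬝ᵥ (B *ᵥ ψ)
      map_add' := fun B B' => by rw [Matrix.add_mulVec, dotProduct_add]
      map_smul' := fun z B => by rw [Matrix.smul_mulVec, dotProduct_smul]; rfl }
  have hint := integrable_conj_of_continuous (μ := phaseLaw N r)
    (continuous_stepsPropagator H (randomSites A c p) (t / r) r)
    (norm_stepsPropagator_le hH _ _) (localObservable A p C.1)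
  have := ContinuousLinearMap.integral_comp_comm (LinearMap.toContinuousLinearMap L) hint
  refine Eq.trans ?_ this
  refine integral_congr_ae (Filter.Eventually.of_forall fun θ => ?_)
  change _ = star ψ ⬝ᵥ (_ *ᵥ ψ)
  simp only [Matrix.mulVec_mulVec, mul_assoc]

lemma outcomeLaw_singleton (o : Outcome A c) :
    outcomeLaw A H c p q t r {o} = ENNReal.ofReal (bornWeight A H c p q t r o) := by
  rw [outcomeLaw, Measure.sum_apply _ (measurableSet_singleton o), tsum_eq_single o]
  · simp
  · intro o' ho'
    simp [ho']

lemma isProbabilityMeasure_outcomeLaw (hH : Hᴴ = H) : IsProbabilityMeasure (outcomeLaw A H c p q t r) := by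
  constructor
  rw [outcomeLaw, Measure.sum_apply _ MeasurableSet.univ, tsum_fintype]
  simp only [Measure.smul_apply, measure_univ, smul_eq_mul, mul_one]
  rw [← ENNReal.ofReal_sum_of_nonneg fun o _ => bornWeight_nonneg A t r o, sum_bornWeight A t r hH,
    ENNReal.ofReal_one]

lemma integral_outcomeLaw (hH : Hᴴ = H) (f : Outcome A c → ℝ) :
    ∫ o, f o ∂(outcomeLaw A H c p q t r) = ∑ o, bornWeight A H c p q t r o * f o := by
  have := isProbabilityMeasure_outcomeLaw A (c := c) (p := p) (q := q) t r hH
  rw [integral_fintype (Integrable.of_finite)]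
  refine Finset.sum_congr rfl fun o _ => ?_
  rw [measureReal_def, outcomeLaw_singleton, ENNReal.toReal_ofReal (bornWeight_nonneg A t r o),
    smul_eq_mul]

/-- The expectation of the rescaled outcome is close to the ideal signal. -/
lemma abs_integral_outcome_sub_le (hsymm : ∀ i j, G.Adj i j → h i j = h j i) (C : G.edgeSet)
    (p : Pass) (q : Quadrature) (j r : ℕ) {δ : ℝ} (hδ : reshapingError A h ξ p j r C ≤ δ) :
    |∫ o : Outcome A (A.colour C), (if o ⟨C, rfl⟩ then (1 : ℝ) else -1)
        ∂(outcomeLaw A (hubbard G h ξ) (A.colour C) p q (evolutionTime j p) r)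
      - idealSignal (2 ^ j * coefficient A h ξ C p) q| ≤ 2 * δ := by
  have hH := isHermitian_hubbard (ξ := ξ) hsymm
  rw [integral_outcomeLaw A _ _ hH]
  set w := bornWeight A (hubbard G h ξ) (A.colour C) p q (evolutionTime j p) r with hw
  set m := ∑ o : Outcome A (A.colour C), if o ⟨C, rfl⟩ then w o else 0 with hm
  -- Here `m` is the probability of "yes", and rescaling outcomes to `±1` gives mean `2m - 1`. This
  -- doubles the reshaping error, hence the factor 2 in the bound.
  have h1 : ∑ o : Outcome A (A.colour C), w o * (if o ⟨C, rfl⟩ then (1 : ℝ) else -1) = 2 * m - 1 := by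
    have hone : ∑ o, w o = 1 :=
      sum_bornWeight A (c := A.colour C) (p := p) (q := q) (evolutionTime j p) r hH
    have hsub : 2 * m - 1 = 2 * m - ∑ o, w o := by rw [hone]
    rw [hsub, hm, Finset.mul_sum, ← Finset.sum_sub_distrib]
    refine Finset.sum_congr rfl fun o _ => ?_
    split_ifs <;> ring
  rw [h1]
  have h2 := sum_bornWeight_ite A (p := p) (q := q) (evolutionTime j p) r hH ⟨C, rfl⟩
  have h3 := expectation_heisenberg (A := A) (p := p) (q := q) (ξ := ξ) hsymm ⟨C, rfl⟩ j
  have h4 := norm_dotProduct_mulVec_le (reshapedHeisenberg (hubbard G h ξ) (randomSites A (A.colour C) p)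
      (evolutionTime j p) r (localObservable A p C)
    - heisenberg (localHamiltonian A h ξ C p) (evolutionTime j p) (localObservable A p C))
    (initialState A (A.colour C) p q)
  rw [Matrix.sub_mulVec, dotProduct_sub, ← h2, h3, ← Complex.ofReal_sub, Complex.norm_real,
    normSq_initialState, mul_one, Real.norm_eq_abs] at h4
  have h5 := h4.trans hδ
  rw [← hw, ← hm] at h5
  rw [abs_le] at h5 ⊢
  constructor <;> linarith [h5.1, h5.2]

end OutcomeLaw

/-! ### Robust phase estimation -/

section PhaseEstimation

lemma norm_sub_exp_sq (z : ℂ) (φ : ℝ) :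
    ‖z - Complex.exp (φ * Complex.I)‖ ^ 2 = ‖z‖ ^ 2 - 2 * ‖z‖ * Real.cos (z.arg - φ) + 1 := by
  have hre : z.re = ‖z‖ * Real.cos z.arg := (Complex.norm_mul_cos_arg z).symm
  have him : z.im = ‖z‖ * Real.sin z.arg := (Complex.norm_mul_sin_arg z).symm
  rw [← Complex.normSq_eq_norm_sq, Complex.normSq_apply, Complex.sub_re, Complex.sub_im,
    Complex.exp_ofReal_mul_I_re, Complex.exp_ofReal_mul_I_im, hre, him, Real.cos_sub]
  have h1 := Real.sin_sq_add_cos_sq z.arg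
  have h2 := Real.sin_sq_add_cos_sq φ
  linear_combination ‖z‖ ^ 2 * h1 + h2

/-- If the angle were at least `π/3`, the law of cosines would give a squared distance of at least
`‖z‖² - ‖z‖ + 1 ≥ 3/4`. -/
lemma exists_arg_near {z : ℂ} {φ : ℝ}
    (h : ‖z - Complex.exp (φ * Complex.I)‖ < Real.sqrt 3 / 2) :
    ∃ k : ℤ, |z.arg + 2 * Real.pi * k - φ| < Real.pi / 3 := by
  have hsq : ‖z - Complex.exp (φ * Complex.I)‖ ^ 2 < 3 / 4 := by
    have h3 : Real.sqrt 3 ^ 2 = 3 := Real.sq_sqrt (by norm_num)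
    nlinarith [norm_nonneg (z - Complex.exp (φ * Complex.I)), Real.sqrt_nonneg 3]
  rw [norm_sub_exp_sq] at hsq
  have hcos : 1 / 2 < Real.cos (z.arg - φ) := by
    by_contra hle
    push Not at hle
    nlinarith [norm_nonneg z, sq_nonneg (‖z‖ - 1 / 2)]
  have hpi := Real.pi_pos
  -- The nearest multiple of `2π` brings the difference into `[-π, π]`, where the cosine decreases
  -- in the absolute value and can be inverted.
  set k : ℤ := round ((z.arg - φ) / (2 * Real.pi)) with hk
  refine ⟨-k, ?_⟩
  set β := z.arg + 2 * Real.pi * (-k : ℤ) - φ with hβ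
  have hβ' : β = z.arg - φ - k * (2 * Real.pi) := by rw [hβ]; push_cast; ring
  have hβπ : |β| ≤ Real.pi := by
    have h1 := abs_sub_round ((z.arg - φ) / (2 * Real.pi))
    rw [← hk] at h1
    have h2 : β = ((z.arg - φ) / (2 * Real.pi) - k) * (2 * Real.pi) := by
      rw [hβ']; field_simp
    rw [h2, abs_mul, abs_of_pos (by positivity : 0 < 2 * Real.pi)]
    nlinarith
  have hcosβ : 1 / 2 < Real.cos |β| := by
    rw [Real.cos_abs, hβ', Real.cos_sub_int_mul_two_pi]; exact hcos
  by_contra hge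
  push Not at hge
  have := Real.cos_le_cos_of_nonneg_of_le_pi (by positivity) hβπ hge
  rw [Real.cos_pi_div_three] at this
  linarith

lemma round_eq_of_abs_lt {x : ℝ} {k : ℤ} (h : |x - k| < 1 / 2) : round x = k := by
  rw [round_eq, Int.floor_eq_iff]
  rw [abs_lt] at h
  constructor <;> linarith [h.1, h.2]

/-- After scaling by `2 ^ j`, the inherited error is below `2π/3` and that of the argument below
`π/3`. Together they are below `π`, half the spacing of the candidates, so rounding selects the
right branch. -/
lemma abs_rpeStep_sub_lt {j : ℕ} {θ θ' : ℝ} {z : ℂ}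
    (hz : ‖z - Complex.exp ((2 ^ j * θ : ℝ) * Complex.I)‖ < Real.sqrt 3 / 2)
    (hθ : 2 ^ j * |θ' - θ| < 2 * Real.pi / 3) :
    |rpeStep j θ' z - θ| < Real.pi / 3 / 2 ^ j := by
  obtain ⟨k, hk⟩ := exists_arg_near hz
  have hpi := Real.pi_pos
  have h2 : (0 : ℝ) < 2 ^ j := by positivity
  have hround : round ((2 ^ j * θ' - z.arg) / (2 * Real.pi)) = k := by
    apply round_eq_of_abs_lt
    have e : (2 ^ j * θ' - z.arg) / (2 * Real.pi) - k
        = (2 ^ j * (θ' - θ) - (z.arg + 2 * Real.pi * k - 2 ^ j * θ)) / (2 * Real.pi) := by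
      field_simp; ring
    rw [e, abs_div, abs_of_pos (by positivity : 0 < 2 * Real.pi), div_lt_iff₀ (by positivity)]
    have := abs_sub (2 ^ j * (θ' - θ)) (z.arg + 2 * Real.pi * k - 2 ^ j * θ)
    rw [abs_mul, abs_of_pos h2] at this
    linarith
  rw [rpeStep, hround, div_sub' h2.ne', abs_div, abs_of_pos h2]
  exact div_lt_div_of_pos_right hk h2

/-- Passing to the next level doubles the scaled error `π/3` to the tolerated `2π/3`. The start at 0
is good enough because `|θ| ≤ 1 < 2π/3`. -/
lemma abs_rpe_sub_lt {Z : ℕ → ℂ} {θ : ℝ} (hθ : |θ| ≤ 1) (j : ℕ)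
    (hZ : ∀ i ≤ j, ‖Z i - Complex.exp ((2 ^ i * θ : ℝ) * Complex.I)‖ < Real.sqrt 3 / 2) :
    |rpe Z j - θ| < Real.pi / 3 / 2 ^ j := by
  induction j with
  | zero =>
    refine abs_rpeStep_sub_lt (hZ 0 le_rfl) ?_
    rw [zero_sub, abs_neg, pow_zero, one_mul]
    linarith [Real.pi_gt_three]
  | succ j ih =>
    refine abs_rpeStep_sub_lt (hZ (j + 1) le_rfl) ?_
    have h2 : (0 : ℝ) < 2 ^ j := by positivity
    have := ih fun i hi => hZ i (hi.trans (Nat.le_succ j))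
    rw [lt_div_iff₀ h2] at this
    rw [pow_succ]
    linarith

lemma pi_div_le_of_lastLevel {ε : ℝ} (hε : 0 < ε) : Real.pi / 3 / 2 ^ lastLevel ε ≤ ε := by
  have h1 : Real.logb 2 (Real.pi / (3 * ε)) ≤ (lastLevel ε : ℝ) := Nat.le_ceil _
  rw [Real.logb_le_iff_le_rpow (by norm_num) (by positivity), Real.rpow_natCast] at h1
  rw [div_le_iff₀ (by positivity)] at h1 ⊢
  linarith

end PhaseEstimation

/-! ### Concentration -/

section Concentration

open MeasureTheory ProbabilityTheory

/-- Hoeffding's inequality for both tails. Variables in `[-1, 1]` have sub-Gaussian parameter 1, and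
deviation `n/2` of the sum gives `exp(-(n/2)² / (2n)) = exp(-n/8)`. -/
lemma measureReal_half_le_abs_mean_sub_le {Ω : Type*} [MeasurableSpace Ω] {μ : Measure Ω}
    [IsProbabilityMeasure μ] {n : ℕ} (hn : 0 < n) {X : Fin n → Ω → ℝ} (hind : iIndepFun X μ)
    (hm : ∀ k, Measurable (X k)) (hb : ∀ k ω, X k ω ∈ Set.Icc (-1 : ℝ) 1) {E : ℝ}
    (hE : ∀ k, ∫ ω, X k ω ∂μ = E) :
    μ.real {ω | 1 / 2 ≤ |(∑ k, X k ω) / n - E|} ≤ 2 * Real.exp (-(n / 8)) := by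
  have hn' : (0 : ℝ) < n := by exact_mod_cast hn
  have hc : (((‖(1 : ℝ) - (-1)‖₊ / 2) ^ 2 : NNReal) : ℝ) = 1 := by
    push_cast; norm_num
  have hsub : ∀ k, HasSubgaussianMGF (fun ω => X k ω - E) ((‖(1 : ℝ) - (-1)‖₊ / 2) ^ 2) μ := by
    intro k
    rw [← hE k]
    exact hasSubgaussianMGF_of_mem_Icc (hm k).aemeasurable (Filter.Eventually.of_forall (hb k))
  have hexp : ∀ Y : Fin n → Ω → ℝ, iIndepFun Y μ →
      (∀ k, HasSubgaussianMGF (Y k) ((‖(1 : ℝ) - (-1)‖₊ / 2) ^ 2) μ) →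
      μ.real {ω | (n : ℝ) / 2 ≤ ∑ k, Y k ω} ≤ Real.exp (-(n / 8)) := by
    intro Y hY hs
    refine (HasSubgaussianMGF.measure_sum_ge_le_of_iIndepFun hY (s := Finset.univ)
      (fun k _ => hs k) (by positivity)).trans (le_of_eq ?_)
    congr 1
    push_cast at hc ⊢
    rw [Finset.sum_const, Finset.card_univ, Fintype.card_fin, hc]
    field_simp
    ring
  have h1 := hexp (fun k ω => X k ω - E)
    (hind.comp (fun _ x => x - E) fun _ => by fun_prop) hsub
  have h2 := hexp (fun k ω => -(X k ω - E))
    (hind.comp (fun _ x => -(x - E)) fun _ => by fun_prop) fun k => (hsub k).neg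
  refine (measureReal_mono (s₂ := {ω | (n : ℝ) / 2 ≤ ∑ k, (X k ω - E)}
    ∪ {ω | (n : ℝ) / 2 ≤ ∑ k, -(X k ω - E)}) ?_).trans
    ((measureReal_union_le _ _).trans (by linarith))
  intro ω hω
  have hmean : (∑ k, X k ω) / n - E = (∑ k, (X k ω - E)) / n := by
    rw [Finset.sum_sub_distrib, Finset.sum_const, Finset.card_univ, Fintype.card_fin, nsmul_eq_mul]
    field_simp
  simp only [Set.mem_ofPred_eq, hmean] at hω
  simp only [Set.mem_union, Set.mem_ofPred_eq, Finset.sum_neg_distrib]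
  rw [abs_div, abs_of_pos hn', le_div_iff₀ hn', le_abs] at hω
  rcases hω with hω | hω
  · left; linarith
  · right; linarith

lemma repetitions_pos {ε η : ℝ} (hη : 0 < η) (hη1 : η < 1) : 0 < repetitions ε η := by
  refine Nat.ceil_pos.2 ?_
  have h1 : 0 < Real.log (4 / η) := Real.log_pos (by rw [lt_div_iff₀ hη]; linarith)
  have h2 : 0 ≤ Real.log (lastLevel ε + 1) := Real.log_nonneg (by simp)
  linarith

/-- There are `J + 1` levels, two quadratures and two tails. The 9 in the repetition number, against
the 8 in the exponent, makes the inequality strict. -/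
lemma union_bound_lt {ε η : ℝ} (hη : 0 < η) (hη1 : η < 1) :
    (lastLevel ε + 1) * (2 * (2 * Real.exp (-(repetitions ε η / 8 : ℝ)))) < η := by
  set J := lastLevel ε
  set n := repetitions ε η with hn
  have hn0 : (0 : ℝ) < n := by exact_mod_cast repetitions_pos hη hη1
  have hJ : (0 : ℝ) < J + 1 := by positivity
  have h1 : 9 * (Real.log (4 / η) + Real.log (J + 1)) ≤ n := Nat.le_ceil _
  rw [← Real.log_mul (by positivity) hJ.ne'] at h1
  have h2 : Real.exp (-(n / 8 : ℝ)) < (4 / η * (J + 1))⁻¹ := by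
    rw [← Real.exp_log (by positivity : 0 < 4 / η * (J + 1)), ← Real.exp_neg, Real.exp_lt_exp]
    linarith
  calc _ < (J + 1) * (2 * (2 * (4 / η * (J + 1))⁻¹)) := by gcongr
    _ = η := by field_simp; norm_num

end Concentration

/-! ### Accuracy -/

section Accuracy

open MeasureTheory ProbabilityTheory ColouredEdges

variable {N χ : ℕ} {G : SimpleGraph (Fin N)} (A : ColouredEdges G χ)
  {h : Fin N → Fin N → ℝ} {ξ : Fin N → ℝ}

lemma isProbabilityMeasure_recordLaw (hsymm : ∀ i j, G.Adj i j → h i j = h j i) (J n : ℕ)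
    (r : ℕ → ℕ) : IsProbabilityMeasure (recordLaw A (hubbard G h ξ) J n r) := by
  have : ∀ s : Shot χ J n, IsProbabilityMeasure (outcomeLaw A (hubbard G h ξ) s.colour s.pass
      s.quad (evolutionTime s.level s.pass) (r s.level)) := fun s =>
    isProbabilityMeasure_outcomeLaw A _ _ (isHermitian_hubbard hsymm)
  unfold recordLaw
  infer_instance

/-- The expectation of the rescaled outcome at an edge. -/
noncomputable def meanOutcome (H : Op N) (r : ℕ → ℕ) (p : Pass) (q : Quadrature) (j : ℕ)
    (C : G.edgeSet) : ℝ :=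
  ∫ o : Outcome A (A.colour C), (if o ⟨C, rfl⟩ then (1 : ℝ) else -1)
    ∂(outcomeLaw A H (A.colour C) p q (evolutionTime j p) (r j))

lemma measureReal_average_le (hsymm : ∀ i j, G.Adj i j → h i j = h j i) {J n : ℕ} (hn : 0 < n)
    (r : ℕ → ℕ) (p : Pass) (q : Quadrature) (j : Fin (J + 1)) (C : G.edgeSet) :
    (recordLaw A (hubbard G h ξ) J n r).real
      {ω | 1 / 2 ≤ |average A ω p q j C - meanOutcome A (hubbard G h ξ) r p q j C|}
      ≤ 2 * Real.exp (-(n / 8)) := by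
  have hprob : ∀ s : Shot χ J n, IsProbabilityMeasure (outcomeLaw A (hubbard G h ξ) s.colour s.pass
      s.quad (evolutionTime s.level s.pass) (r s.level)) := fun s =>
    isProbabilityMeasure_outcomeLaw A _ _ (isHermitian_hubbard hsymm)
  have := isProbabilityMeasure_recordLaw A (ξ := ξ) hsymm J n r
  -- Only different repetitions enter one average, so independence of the shots suffices. Results of
  -- different subsystems in the same shot may be correlated.
  let shot : Fin n → Shot χ J n := fun k => ⟨A.colour C, p, j, q, k⟩
  have hinj : Function.Injective shot := fun k k' e => by simpa [shot] using e
  let f : Outcome A (A.colour C) → ℝ := fun o => if o ⟨C, rfl⟩ then 1 else -1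
  have hf : Measurable f := measurable_of_finite f
  have hind : iIndepFun (fun (s : Shot χ J n) (ω : Record A J n) => ω s)
      (recordLaw A (hubbard G h ξ) J n r) :=
    iIndepFun_pi (X := fun (s : Shot χ J n) (o : Outcome A s.colour) => o)
      fun s => aemeasurable_id
  have hind' : iIndepFun (fun (k : Fin n) (ω : Record A J n) => f (ω (shot k)))
      (recordLaw A (hubbard G h ξ) J n r) :=
    (hind.precomp hinj).comp (fun _ => f) fun _ => hf
  refine measureReal_half_le_abs_mean_sub_le hn hind' (fun k => ?_) (fun k ω => ?_) fun k => ?_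
  · exact hf.comp (measurable_pi_apply (shot k))
  · simp only [f]; split_ifs <;> simp
  · have hmp := measurePreserving_eval (fun s : Shot χ J n => outcomeLaw A (hubbard G h ξ) s.colour
      s.pass s.quad (evolutionTime s.level s.pass) (r s.level)) (shot k)
    have h1 := integral_map (μ := recordLaw A (hubbard G h ξ) J n r) (f := f)
      (measurable_pi_apply (shot k)).aemeasurable hf.aestronglyMeasurable
    rw [← h1]
    exact congrArg (fun ν => ∫ o, f o ∂ν) hmp.map_eq

/-- Each coordinate has statistical error below `1/2` and reshaping bias at most `2δ`, in total
below `1/6 + √3/4`. Times `√2` this is still less than `√3/2`. -/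
lemma norm_signal_sub_lt {x y φ δ : ℝ} (hδ : δ = (Real.sqrt 3 / 2 - 2 / 3) / 4)
    (hx : |x - Real.cos φ| < 1 / 2 + 2 * δ) (hy : |y - Real.sin φ| < 1 / 2 + 2 * δ) :
    ‖((x : ℂ) + Complex.I * y) - Complex.exp (φ * Complex.I)‖ < Real.sqrt 3 / 2 := by
  have h3 : Real.sqrt 3 ^ 2 = 3 := Real.sq_sqrt (by norm_num)
  have h3' : Real.sqrt 3 < 1.8 := by
    rw [Real.sqrt_lt' (by norm_num)]; norm_num
  have hsq : ‖((x : ℂ) + Complex.I * y) - Complex.exp (φ * Complex.I)‖ ^ 2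
      = |x - Real.cos φ| ^ 2 + |y - Real.sin φ| ^ 2 := by
    rw [← Complex.normSq_eq_norm_sq, Complex.normSq_apply, Complex.sub_re, Complex.sub_im,
      Complex.exp_ofReal_mul_I_re, Complex.exp_ofReal_mul_I_im, sq_abs, sq_abs]
    simp
    ring
  refine lt_of_pow_lt_pow_left₀ 2 (by positivity) ?_
  rw [hsq]
  have h1 : |x - Real.cos φ| ^ 2 < (1 / 2 + 2 * δ) ^ 2 := by gcongr
  have h2 : |y - Real.sin φ| ^ 2 < (1 / 2 + 2 * δ) ^ 2 := by gcongr
  have h4 : (1 / 2 + 2 * δ) ^ 2 = 1 / 36 + Real.sqrt 3 / 12 + Real.sqrt 3 ^ 2 / 16 := by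
    rw [hδ]; ring
  rw [h4] at h1 h2
  rw [div_pow]
  linarith

lemma measureReal_estimate_gt (hsymm : ∀ i j, G.Adj i j → h i j = h j i)
    {ε η : ℝ} (hε : 0 < ε) (hη : 0 < η) (hη1 : η < 1) {r : ℕ → ℕ}
    (hr : StepsAdmissible A h ξ (lastLevel ε) r) (p : Pass) (C : G.edgeSet)
    (hcoef : |coefficient A h ξ C p| ≤ 1) :
    (recordLaw A (hubbard G h ξ) (lastLevel ε) (repetitions ε η) r).real
      {ω | |estimate A ω p C - coefficient A h ξ C p| < ε} > 1 - η := by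
  have := isProbabilityMeasure_recordLaw A (ξ := ξ) hsymm (lastLevel ε) (repetitions ε η) r
  set J := lastLevel ε with hJ
  set n := repetitions ε η with hn
  set μ := recordLaw A (hubbard G h ξ) J n r with hμ
  set θ := coefficient A h ξ C p with hθ
  let bad : Fin (J + 1) → Quadrature → Set (Record A J n) := fun j q =>
    {ω | 1 / 2 ≤ |average A ω p q j C - meanOutcome A (hubbard G h ξ) r p q j C|}
  have hbad : μ.real (⋃ j, ⋃ q, bad j q) < η := by
    calc μ.real (⋃ j, ⋃ q, bad j q) ≤ ∑ j : Fin (J + 1), μ.real (⋃ q, bad j q) :=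
          measureReal_iUnion_fintype_le _
      _ ≤ ∑ j : Fin (J + 1), ∑ q : Quadrature, μ.real (bad j q) :=
          Finset.sum_le_sum fun j _ => measureReal_iUnion_fintype_le _
      _ ≤ ∑ j : Fin (J + 1), ∑ q : Quadrature, 2 * Real.exp (-(n / 8)) :=
          Finset.sum_le_sum fun j _ => Finset.sum_le_sum fun q _ =>
            measureReal_average_le A hsymm (repetitions_pos hη hη1) r p q j C
      _ = (J + 1) * (2 * (2 * Real.exp (-(n / 8)))) := by
          have : Fintype.card Quadrature = 2 := rfl
          simp [this]
      _ < η := union_bound_lt hη hη1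
  have hgood : (⋃ j, ⋃ q, bad j q)ᶜ ⊆ {ω | |estimate A ω p C - θ| < ε} := by
    intro ω hω
    simp only [bad, Set.mem_compl_iff, Set.mem_iUnion, Set.mem_ofPred_eq, not_exists, not_le] at hω
    refine lt_of_lt_of_le (abs_rpe_sub_lt hcoef J fun i hi => ?_) (pi_div_le_of_lastLevel hε)
    -- `Fin.ofNat` reduces modulo `J + 1`, which changes nothing at the levels up to `J` that the
    -- estimate uses.
    have hlevel : ((Fin.ofNat (J + 1) i : Fin (J + 1)) : ℕ) = i :=
      Nat.mod_eq_of_lt (Nat.lt_succ_of_le hi)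
    have hq : ∀ q, |average A ω p q (Fin.ofNat (J + 1) i) C - idealSignal (2 ^ i * θ) q|
        < 1 / 2 + 2 * ((Real.sqrt 3 / 2 - 2 / 3) / 4) := by
      intro q
      have h1 := hω (Fin.ofNat (J + 1) i) q
      have h2 := abs_integral_outcome_sub_le A hsymm C p q i (r i) ((hr i hi).2 p C)
      rw [hlevel] at h1
      refine (abs_sub_le _ (meanOutcome A (hubbard G h ξ) r p q i C) _).trans_lt ?_
      exact add_lt_add_of_lt_of_le h1 h2
    exact norm_signal_sub_lt rfl (hq .cosine) (hq .sine)
  have hcompl : 1 - μ.real (⋃ j, ⋃ q, bad j q) ≤ μ.real (⋃ j, ⋃ q, bad j q)ᶜ := by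
    rw [probReal_compl_eq_one_sub (Set.toFinite _).measurableSet]
  have := measureReal_mono (μ := μ) hgood
  linarith

lemma abs_hHat_probability (hsymm : ∀ i j, G.Adj i j → h i j = h j i)
    (hh : ∀ i j, G.Adj i j → |h i j| ≤ 1)
    {ε η : ℝ} (hε : 0 < ε) (hη : 0 < η) (hη1 : η < 1) {r : ℕ → ℕ}
    (hr : StepsAdmissible A h ξ (lastLevel ε) r) {i j : Fin N} (hij : G.Adj i j) :
    (recordLaw A (hubbard G h ξ) (lastLevel ε) (repetitions ε η) r).real
      {ω | |hHat A ω hij - h i j| < ε} > 1 - η := by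
  have hends := A.ends ⟨s(i, j), hij⟩
  have hcoef : coefficient A h ξ ⟨s(i, j), hij⟩ .hop = h i j := by
    rw [coefficient]
    -- The naming of the vertices may reverse the pair; symmetry of `h` makes the coefficient the
    -- same.
    rcases Sym2.eq_iff.1 hends with ⟨h1, h2⟩ | ⟨h1, h2⟩
    · rw [← h1, ← h2]
    · rw [← h1, ← h2, hsymm i j hij]
  have := measureReal_estimate_gt A hsymm (ξ := ξ) hε hη hη1 hr .hop ⟨s(i, j), hij⟩
    (by rw [hcoef]; exact hh i j hij)
  rwa [hcoef] at this

lemma abs_ξHat_probability (hsymm : ∀ i j, G.Adj i j → h i j = h j i)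
    (hξ : ∀ i, |ξ i| ≤ 1)
    {ε η : ℝ} (hε : 0 < ε) (hη : 0 < η) (hη1 : η < 1) {r : ℕ → ℕ}
    (hr : StepsAdmissible A h ξ (lastLevel ε) r) {i j : Fin N} (hij : G.Adj i j) :
    (recordLaw A (hubbard G h ξ) (lastLevel ε) (repetitions ε η) r).real
      {ω | |ξHat A ω hij - ξ i| < ε} > 1 - η := by
  have hends := A.ends ⟨s(i, j), hij⟩
  set p : Pass := if i = A.k₁ ⟨s(i, j), hij⟩ then .site₁ else .site₂ with hp
  have hcoef : coefficient A h ξ ⟨s(i, j), hij⟩ p = ξ i := by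
    rw [hp]
    split_ifs with hi
    · rw [coefficient, ← hi]
    · rcases Sym2.eq_iff.1 hends with ⟨h1, h2⟩ | ⟨h1, h2⟩
      · exact absurd h1 hi
      · rw [coefficient, ← h1]
  have := measureReal_estimate_gt A hsymm (ξ := ξ) hε hη hη1 hr p ⟨s(i, j), hij⟩
    (by rw [hcoef]; exact hξ i)
  rwa [hcoef] at this

end Accuracy

/-! ### Existence of edge colourings -/

section Colouring

/-- Greedy colouring: a new vertex has fewer than `χ` neighbours, so some colour is free. -/
lemma SimpleGraph.colorable_of_card_neighbors_lt {V : Type*} [Fintype V] (F : SimpleGraph V)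
    [DecidableRel F.Adj] {χ : ℕ} (hF : ∀ v, (Finset.univ.filter (F.Adj v)).card < χ) :
    F.Colorable χ := by
  classical
  have key : ∀ s : Finset V, ∃ col : V → Fin χ, ∀ v ∈ s, ∀ w ∈ s, F.Adj v w → col v ≠ col w := by
    intro s
    induction s using Finset.induction_on with
    | empty =>
      -- A default colouring needs a colour; the degree bound at any vertex yields `0 < χ`.
      rcases isEmpty_or_nonempty V with hV | ⟨⟨v⟩⟩
      · exact ⟨fun v => (hV.false v).elim, by simp⟩
      · exact ⟨fun _ => ⟨0, (Nat.zero_le _).trans_lt (hF v)⟩, by simp⟩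
    | insert a s ha ih =>
      obtain ⟨col, hcol⟩ := ih
      obtain ⟨x, hx⟩ : ∃ x : Fin χ, x ∉ (Finset.univ.filter (F.Adj a)).image col := by
        by_contra hall
        push Not at hall
        have h1 : (Finset.univ : Finset (Fin χ)).card ≤
            ((Finset.univ.filter (F.Adj a)).image col).card :=
          Finset.card_le_card fun x _ => hall x
        rw [Finset.card_univ, Fintype.card_fin] at h1
        exact absurd (h1.trans Finset.card_image_le) (not_le.2 (hF a))
      have hx' : ∀ w, F.Adj a w → col w ≠ x := fun w hw e =>
        hx (Finset.mem_image.2 ⟨w, by simpa using hw, e⟩)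
      refine ⟨Function.update col a x, ?_⟩
      intro v hv w hw hvw
      rw [Finset.mem_insert] at hv hw
      by_cases hva : v = a
      · subst hva
        rw [Function.update_self, Function.update_of_ne hvw.ne']
        exact (hx' w hvw).symm
      · by_cases hwa : w = a
        · subst hwa
          rw [Function.update_self, Function.update_of_ne hva]
          exact hx' v hvw.symm
        · rw [Function.update_of_ne hva, Function.update_of_ne hwa]
          exact hcol v (hv.resolve_left hva) w (hw.resolve_left hwa) hvw
  obtain ⟨col, hcol⟩ := key Finset.univ
  exact ⟨SimpleGraph.Coloring.mk col fun hvw => hcol _ (Finset.mem_univ _) _ (Finset.mem_univ _) hvw⟩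

variable {N d : ℕ} {G : SimpleGraph (Fin N)}

lemma edgeConflictGraph_exists_near {C C' : G.edgeSet} (h : (edgeConflictGraph G).Adj C C') :
    ∃ x ∈ (C : Sym2 (Fin N)), ∃ y ∈ (C' : Sym2 (Fin N)), x = y ∨ G.Adj x y := by
  have hnear : ∀ D D' : G.edgeSet,
      (ShareVertex D D' ∨ ∃ D'' : G.edgeSet, ShareVertex D D'' ∧ ShareVertex D' D'') →
      ∃ x ∈ (D : Sym2 (Fin N)), ∃ y ∈ (D' : Sym2 (Fin N)), x = y ∨ G.Adj x y := by
    rintro D D' (⟨v, hv, hv'⟩ | ⟨D'', ⟨x, hx, hx'⟩, ⟨y, hy, hy'⟩⟩)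
    · exact ⟨v, hv, v, hv', Or.inl rfl⟩
    · refine ⟨x, hx, y, hy, ?_⟩
      by_cases hxy : x = y
      · exact Or.inl hxy
      · have he := ((Sym2.mem_and_mem_iff hxy).1 ⟨hx', hy'⟩)
        have := D''.2
        rw [he, SimpleGraph.mem_edgeSet] at this
        exact Or.inr this
  rw [edgeConflictGraph, SimpleGraph.fromRel_adj] at h
  rcases h.2 with h | h
  · exact hnear C C' h
  · obtain ⟨x, hx, y, hy, hxy⟩ := hnear C' C h
    exact ⟨y, hy, x, hx, hxy.imp Eq.symm SimpleGraph.Adj.symm⟩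

/-- A conflicting edge has an end point equal or adjacent to `u` or `v`. There are at most `2d` such
points, each on at most `d` edges, so at most `2d²` conflicts occur. -/
lemma card_edgeConflictGraph_lt [DecidableRel G.Adj] [DecidableRel (edgeConflictGraph G).Adj]
    [Fintype G.edgeSet] (hdeg : ∀ i, (G.neighborSet i).ncard ≤ d) (C : G.edgeSet) :
    (Finset.univ.filter ((edgeConflictGraph G).Adj C)).card < 4 * d ^ 2 + 1 := by
  classical
  have hN : ∀ i, (Finset.univ.filter (G.Adj i)).card ≤ d := by
    intro i
    refine le_trans (le_of_eq ?_) (hdeg i)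
    rw [← Set.ncard_coe_finset]; congr 1; ext j; simp
  obtain ⟨C, hC⟩ := C
  induction C using Sym2.ind with
  | _ u v =>
  have huv : G.Adj u v := hC
  set W := Finset.univ.filter (G.Adj u) ∪ Finset.univ.filter (G.Adj v) with hW
  have hWc : W.card ≤ 2 * d := (Finset.card_union_le _ _).trans (by linarith [hN u, hN v])
  -- The points `u` and `v` need no separate count, because each is a neighbour of the other.
  have hmem : ∀ x ∈ s(u, v), ∀ y, x = y ∨ G.Adj x y → y ∈ W := by
    intro x hx y hxy
    rw [Sym2.mem_iff] at hx
    simp only [hW, Finset.mem_union, Finset.mem_filter, Finset.mem_univ, true_and]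
    rcases hx with rfl | rfl <;> rcases hxy with rfl | hxy
    · exact Or.inr huv.symm
    · exact Or.inl hxy
    · exact Or.inl huv
    · exact Or.inr hxy
  let T : Finset (Sym2 (Fin N)) :=
    W.biUnion fun y => (Finset.univ.filter (G.Adj y)).image fun z => s(y, z)
  have hT : T.card ≤ 2 * d * d :=
    (Finset.card_biUnion_le_card_mul _ _ d fun y _ => Finset.card_image_le.trans (hN y)).trans
      (Nat.mul_le_mul_right _ hWc)
  have hle : (Finset.univ.filter ((edgeConflictGraph G).Adj ⟨s(u, v), hC⟩)).card ≤ T.card := by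
    refine Finset.card_le_card_of_injOn (fun C' => (C' : Sym2 (Fin N))) ?_
      (Subtype.val_injective.injOn)
    intro C' hC'
    have hadj : (edgeConflictGraph G).Adj ⟨s(u, v), hC⟩ C' := by simpa using hC'
    obtain ⟨x, hx, y, hy, hxy⟩ := edgeConflictGraph_exists_near hadj
    obtain ⟨z, hz⟩ := Sym2.mem_iff_exists.1 hy
    have hyz : G.Adj y z := by
      have := C'.2
      rwa [hz, SimpleGraph.mem_edgeSet] at this
    refine Finset.mem_coe.2 (Finset.mem_biUnion.2 ⟨y, hmem x hx y hxy, ?_⟩)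
    exact Finset.mem_image.2 ⟨z, by simpa using hyz, hz.symm⟩
  have : 2 * d * d ≤ 4 * d ^ 2 := by nlinarith
  omega

lemma nonempty_colouredEdges (hdeg : ∀ i, (G.neighborSet i).ncard ≤ d) :
    Nonempty (ColouredEdges G (4 * d ^ 2 + 1)) := by
  classical
  obtain ⟨col⟩ := SimpleGraph.colorable_of_card_neighbors_lt (edgeConflictGraph G)
    (card_edgeConflictGraph_lt hdeg)
  exact ⟨⟨col, fun C => (Quot.out (C : Sym2 (Fin N))).1, fun C => (Quot.out (C : Sym2 (Fin N))).2,
    fun C => (Quot.out_eq (C : Sym2 (Fin N))).symm⟩⟩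

end Colouring

/-! ### Cost -/

section Cost

/-- The experiments as tuples. -/
def shotEquiv (χ J n : ℕ) :
    Shot χ J n ≃ Fin χ × Pass × Fin (J + 1) × Quadrature × Fin n where
  toFun s := (s.colour, s.pass, s.level, s.quad, s.rep)
  invFun x := ⟨x.1, x.2.1, x.2.2.1, x.2.2.2.1, x.2.2.2.2⟩
  left_inv _ := rfl
  right_inv _ := rfl

lemma card_pass : Fintype.card Pass = 3 := rfl

lemma card_quadrature : Fintype.card Quadrature = 2 := rfl

lemma numExperiments_eq (χ J n : ℕ) : numExperiments χ J n = χ * (3 * ((J + 1) * (2 * n))) := by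
  rw [numExperiments, Fintype.card_congr (shotEquiv χ J n)]
  simp [card_pass, card_quadrature]

/-- The 6 counts three families and two quadratures. -/
lemma sum_shot_level (χ J n : ℕ) (g : ℕ → ℝ) :
    ∑ s : Shot χ J n, g s.level = 6 * χ * n * ∑ j ∈ Finset.range (J + 1), g j := by
  rw [Fintype.sum_equiv (shotEquiv χ J n) (fun s => g s.level) (fun x => g x.2.2.1) fun _ => rfl,
    Finset.sum_range]
  simp only [Fintype.sum_prod_type, Finset.sum_const, Finset.card_univ, Fintype.card_fin,
    Fintype.card_prod, card_pass, card_quadrature, nsmul_eq_mul, ← Finset.mul_sum]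
  push_cast
  ring

/-! ### Bounds on levels and repetitions in terms of accuracy and confidence -/

lemma log_inv_nonneg {x : ℝ} (hx : 0 < x) (hx1 : x ≤ 1) : 0 ≤ Real.log x⁻¹ :=
  Real.log_nonneg ((one_le_inv₀ hx).2 hx1)

variable {ε η : ℝ}

/-- For `ε ≤ 1` the argument of the logarithm is at least 1, so the truncation of the ceiling at 0
plays no role. -/
lemma lastLevel_lt (hε : 0 < ε) (hε1 : ε ≤ 1) :
    (lastLevel ε : ℝ) < Real.logb 2 (Real.pi / (3 * ε)) + 1 := by
  refine Nat.ceil_lt_add_one (Real.logb_nonneg (by norm_num) ?_)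
  rw [le_div_iff₀ (by positivity)]
  linarith [Real.pi_gt_three]

/-- Rounding up costs at most a factor 2, and `2π/3 ≤ 3`. -/
lemma two_pow_lastLevel_le (hε : 0 < ε) (hε1 : ε ≤ 1) : (2 : ℝ) ^ lastLevel ε ≤ 3 * ε⁻¹ := by
  have h1 := lastLevel_lt hε hε1
  have h2 : (2 : ℝ) ^ ((lastLevel ε : ℝ) - 1) < Real.pi / (3 * ε) := by
    rw [← Real.lt_logb_iff_rpow_lt (by norm_num) (by positivity)]
    linarith
  rw [Real.rpow_sub_one (by norm_num), Real.rpow_natCast, div_lt_iff₀ (by norm_num)] at h2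
  have h3 : Real.pi / (3 * ε) * 2 = (2 * Real.pi / 3) * ε⁻¹ := by field_simp
  rw [h3] at h2
  refine h2.le.trans (mul_le_mul_of_nonneg_right ?_ (by positivity))
  linarith [Real.pi_lt_four]

lemma lastLevel_add_one_le (hε : 0 < ε) (hε1 : ε ≤ 1) :
    (lastLevel ε + 1 : ℝ) ≤ 4 * (1 + Real.log ε⁻¹) := by
  have h1 := lastLevel_lt hε hε1
  have hx := log_inv_nonneg hε hε1
  have hlog2 : 1 / 2 < Real.log 2 := by linarith [Real.log_two_gt_d9]
  have h2 : Real.log (Real.pi / (3 * ε)) ≤ 1 / 3 + Real.log ε⁻¹ := by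
    have e : Real.pi / (3 * ε) = Real.pi / 3 * ε⁻¹ := by field_simp
    rw [e, Real.log_mul (by positivity) (by positivity)]
    have := Real.log_le_sub_one_of_pos (by positivity : 0 < Real.pi / 3)
    linarith [Real.pi_lt_four]
  have h3 : Real.logb 2 (Real.pi / (3 * ε)) ≤ 2 * (1 / 3 + Real.log ε⁻¹) := by
    rw [Real.logb, div_le_iff₀ (by linarith)]
    nlinarith
  linarith

/-- The logarithmic factor in the cost. -/
noncomputable def logFactor (ε η : ℝ) : ℝ :=
  1 + Real.log η⁻¹ + Real.log (1 + Real.log ε⁻¹)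

lemma one_le_logFactor (hε : 0 < ε) (hε1 : ε ≤ 1) (hη : 0 < η) (hη1 : η < 1) :
    1 ≤ logFactor ε η := by
  have h1 := log_inv_nonneg hη hη1.le
  have h2 : 0 ≤ Real.log (1 + Real.log ε⁻¹) :=
    Real.log_nonneg (by linarith [log_inv_nonneg hε hε1])
  rw [logFactor]; linarith

/-- The number of levels is itself logarithmic in `1/ε`, so its logarithm is the iterated logarithm
in `logFactor`; constants are absorbed because `logFactor` is at least 1. -/
lemma repetitions_le (hε : 0 < ε) (hε1 : ε ≤ 1) (hη : 0 < η) (hη1 : η < 1) :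
    (repetitions ε η : ℝ) ≤ 64 * logFactor ε η := by
  have hL := one_le_logFactor hε hε1 hη hη1
  have hx := log_inv_nonneg hε hε1
  have hη' := log_inv_nonneg hη hη1.le
  have h4 : Real.log 4 ≤ 3 := by
    have := Real.log_le_sub_one_of_pos (by norm_num : (0 : ℝ) < 4); linarith
  have h1 : Real.log (4 / η) ≤ 3 + Real.log η⁻¹ := by
    rw [div_eq_mul_inv, Real.log_mul (by norm_num) (by positivity)]; linarith
  have h2 : Real.log (lastLevel ε + 1) ≤ 3 + Real.log (1 + Real.log ε⁻¹) := by
    calc _ ≤ Real.log (4 * (1 + Real.log ε⁻¹)) :=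
          Real.log_le_log (by positivity) (lastLevel_add_one_le hε hε1)
      _ ≤ _ := by rw [Real.log_mul (by norm_num) (by positivity)]; linarith
  have h3 : 0 ≤ Real.log (lastLevel ε + 1) := Real.log_nonneg (by simp)
  have h5 : 0 ≤ Real.log (4 / η) := Real.log_nonneg (by rw [le_div_iff₀ hη]; linarith)
  have h6 := Nat.ceil_lt_add_one (by positivity :
    0 ≤ 9 * (Real.log (4 / η) + Real.log (lastLevel ε + 1)))
  rw [repetitions]
  rw [logFactor] at hL ⊢
  linarith

/-- For `a ≥ 2` the last term of the geometric sum dominates, so the finest level determines the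
cost up to a constant. -/
lemma sum_pow_le {a : ℝ} (ha : 2 ≤ a) (J : ℕ) :
    ∑ j ∈ Finset.range (J + 1), a ^ j ≤ 2 * a ^ J := by
  induction J with
  | zero => simp
  | succ J ih =>
    rw [Finset.sum_range_succ]
    have : 0 < a ^ J := by positivity
    have h2 : 2 * a ^ J ≤ a ^ (J + 1) := by rw [pow_succ]; nlinarith
    linarith

lemma totalEvolutionTime_le (hε : 0 < ε) (hε1 : ε ≤ 1) (hη : 0 < η) (hη1 : η < 1) (χ : ℕ) :
    totalEvolutionTime χ (lastLevel ε) (repetitions ε η)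
      ≤ 2304 * χ * (ε⁻¹ * logFactor ε η) := by
  have hn := repetitions_le hε hε1 hη hη1
  have hL := one_le_logFactor hε hε1 hη hη1
  calc _ ≤ ∑ s : Shot χ (lastLevel ε) (repetitions ε η), (2 : ℝ) ^ (s.level : ℕ) :=
        Finset.sum_le_sum fun s _ => evolutionTime_le _ _
    _ = 6 * χ * repetitions ε η * ∑ j ∈ Finset.range (lastLevel ε + 1), (2 : ℝ) ^ j :=
        sum_shot_level _ _ _ fun j => (2 : ℝ) ^ j
    _ ≤ 6 * χ * (64 * logFactor ε η) * (2 * (3 * ε⁻¹)) := by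
        gcongr
        exact (sum_pow_le le_rfl _).trans (by gcongr; exact two_pow_lastLevel_le hε hε1)
    _ = _ := by ring

lemma numExperiments_le (hε : 0 < ε) (hε1 : ε ≤ 1) (hη : 0 < η) (hη1 : η < 1) (χ : ℕ) :
    (numExperiments χ (lastLevel ε) (repetitions ε η) : ℝ)
      ≤ 1536 * χ * ((1 + Real.log ε⁻¹) * logFactor ε η) := by
  have hn := repetitions_le hε hε1 hη hη1
  have hL := one_le_logFactor hε hε1 hη hη1
  have hJ := lastLevel_add_one_le hε hε1
  have hx := log_inv_nonneg hε hε1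
  rw [numExperiments_eq]
  push_cast
  calc (χ : ℝ) * (3 * ((lastLevel ε + 1) * (2 * repetitions ε η)))
      ≤ χ * (3 * ((4 * (1 + Real.log ε⁻¹)) * (2 * (64 * logFactor ε η)))) := by gcongr
    _ = _ := by ring

lemma numInsertions_le {N χ : ℕ} {G : SimpleGraph (Fin N)} (A : ColouredEdges G χ)
    (hε : 0 < ε) (hε1 : ε ≤ 1) (hη : 0 < η) (hη1 : η < 1) {K : ℝ} (hK : 0 < K) :
    (numInsertions A (lastLevel ε) (repetitions ε η) (fun j => ⌈K * (2 ^ j) ^ 2⌉₊) : ℝ)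
      ≤ 13824 * χ * (K + 1) * (N * ε⁻¹ ^ 2 * logFactor ε η) := by
  have hn := repetitions_le hε hε1 hη hη1
  have hL := one_le_logFactor hε hε1 hη hη1
  rw [numInsertions]
  push_cast
  calc _ ≤ ∑ s : Shot χ (lastLevel ε) (repetitions ε η),
          2 * ((K + 1) * (4 : ℝ) ^ (s.level : ℕ)) * N := by
        refine Finset.sum_le_sum fun s _ => ?_
        -- The rounding error is at most 1, which is absorbed into `4 ^ j ≥ 1`; hence `K + 1`.
        have h1 : (⌈K * (2 ^ (s.level : ℕ)) ^ 2⌉₊ : ℝ) ≤ (K + 1) * (4 : ℝ) ^ (s.level : ℕ) := by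
          have e : ((2 : ℝ) ^ (s.level : ℕ)) ^ 2 = 4 ^ (s.level : ℕ) := by
            rw [← pow_mul, mul_comm, pow_mul]; norm_num
          have h4 : (1 : ℝ) ≤ 4 ^ (s.level : ℕ) := one_le_pow₀ (by norm_num)
          have := Nat.ceil_lt_add_one (by positivity : 0 ≤ K * ((2 : ℝ) ^ (s.level : ℕ)) ^ 2)
          rw [e] at this ⊢
          linarith
        have h2 : ((randomSites A s.colour s.pass).card : ℝ) ≤ N := by
          exact_mod_cast (Finset.card_le_univ _).trans (by rw [Fintype.card_fin])
        gcongr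
    _ = 6 * χ * repetitions ε η *
          ∑ j ∈ Finset.range (lastLevel ε + 1), 2 * ((K + 1) * (4 : ℝ) ^ j) * N :=
        sum_shot_level _ _ _ fun j => 2 * ((K + 1) * (4 : ℝ) ^ j) * N
    _ = 6 * χ * repetitions ε η *
          (2 * ((K + 1) * ∑ j ∈ Finset.range (lastLevel ε + 1), (4 : ℝ) ^ j) * N) := by
        rw [← Finset.sum_mul, ← Finset.mul_sum, ← Finset.mul_sum]
    _ ≤ 6 * χ * (64 * logFactor ε η) * (2 * ((K + 1) * (2 * (3 * ε⁻¹) ^ 2)) * N) := by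
        have h4 : ∑ j ∈ Finset.range (lastLevel ε + 1), (4 : ℝ) ^ j ≤ 2 * (3 * ε⁻¹) ^ 2 := by
          refine (sum_pow_le (by norm_num) _).trans ?_
          have e : (4 : ℝ) ^ lastLevel ε = (2 ^ lastLevel ε) ^ 2 := by
            rw [← pow_mul, mul_comm, pow_mul]; norm_num
          rw [e]
          have := two_pow_lastLevel_le hε hε1
          gcongr
        gcongr
    _ = _ := by ring

end Cost

theorem theorem3 (d : ℕ) :
    ∃ K B : ℝ, 0 < K ∧ 0 < B ∧
      ∀ (N : ℕ) (G : SimpleGraph (Fin N)), (∀ i, (G.neighborSet i).ncard ≤ d) →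
        Nonempty (ColouredEdges G (4 * d ^ 2 + 1)) ∧
        ∀ (A : ColouredEdges G (4 * d ^ 2 + 1)) (h : Fin N → Fin N → ℝ) (ξ : Fin N → ℝ),
          (∀ i j, G.Adj i j → h i j = h j i) →
          (∀ i j, G.Adj i j → |h i j| ≤ 1) →
          (∀ i, |ξ i| ≤ 1) →
          ∀ ε η : ℝ, 0 < ε → ε ≤ 1 → 0 < η → η < 1 →
            -- the step numbers `⌈K t²⌉` make the reshaping error small enough
            StepsAdmissible A h ξ (lastLevel ε) (fun j => ⌈K * (2 ^ j) ^ 2⌉₊) ∧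
            -- accuracy, for all admissible step numbers
            (∀ r : ℕ → ℕ, StepsAdmissible A h ξ (lastLevel ε) r →
              MeasureTheory.IsProbabilityMeasure
                (recordLaw A (hubbard G h ξ) (lastLevel ε) (repetitions ε η) r) ∧
              ∀ (i j : Fin N) (hij : G.Adj i j),
                (recordLaw A (hubbard G h ξ) (lastLevel ε) (repetitions ε η) r).real
                    {ω | |hHat A ω hij - h i j| < ε} > 1 - η ∧
                (recordLaw A (hubbard G h ξ) (lastLevel ε) (repetitions ε η) r).real
                    {ω | |ξHat A ω hij - ξ i| < ε} > 1 - η) ∧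
            -- cost
            totalEvolutionTime (4 * d ^ 2 + 1) (lastLevel ε) (repetitions ε η)
              ≤ B * (ε⁻¹ * (1 + Real.log η⁻¹ + Real.log (1 + Real.log ε⁻¹))) ∧
            (numExperiments (4 * d ^ 2 + 1) (lastLevel ε) (repetitions ε η) : ℝ)
              ≤ B * ((1 + Real.log ε⁻¹) * (1 + Real.log η⁻¹ + Real.log (1 + Real.log ε⁻¹))) ∧
            (numInsertions A (lastLevel ε) (repetitions ε η) (fun j => ⌈K * (2 ^ j) ^ 2⌉₊) : ℝ)
              ≤ B * (N * ε⁻¹ ^ 2 * (1 + Real.log η⁻¹ + Real.log (1 + Real.log ε⁻¹))) := by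
  have hK := stepsConstant_pos d
  -- The constant of the insertion count serves for all three costs, since it exceeds those of the
  -- evolution time and of the number of experiments.
  refine ⟨stepsConstant d, 13824 * (4 * d ^ 2 + 1) * (stepsConstant d + 1), hK, by positivity, ?_⟩
  intro N G hdeg
  refine ⟨nonempty_colouredEdges hdeg, ?_⟩
  intro A h ξ hsymm hh hξ ε η hε hε1 hη hη1
  have hL := one_le_logFactor hε hε1 hη hη1
  have hx := log_inv_nonneg hε hε1
  have hχ : ((4 * d ^ 2 + 1 : ℕ) : ℝ) = 4 * d ^ 2 + 1 := by push_cast; rfl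
  have hχ0 : (0 : ℝ) < 4 * d ^ 2 + 1 := by positivity
  refine ⟨stepsAdmissible_ceil A hdeg hsymm hh hξ _, fun r hr =>
    ⟨isProbabilityMeasure_recordLaw A hsymm _ _ r, fun i j hij =>
      ⟨abs_hHat_probability A hsymm hh hε hη hη1 hr hij,
        abs_ξHat_probability A hsymm hξ hε hη hη1 hr hij⟩⟩, ?_, ?_, ?_⟩
  · refine (totalEvolutionTime_le hε hε1 hη hη1 _).trans ?_
    rw [hχ]
    refine mul_le_mul_of_nonneg_right ?_ (by positivity)
    nlinarith
  · refine (numExperiments_le hε hε1 hη hη1 _).trans ?_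
    rw [hχ]
    refine mul_le_mul_of_nonneg_right ?_ (by positivity)
    nlinarith
  · refine (numInsertions_le A hε hε1 hη hη1 hK).trans (le_of_eq ?_)
    rw [hχ, logFactor]
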